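/- Let $K$ be a field, $\ell\ge 3$, let $q\in K$ be a primitive $\ell$-th root of unity, and let $H=H_q(\ell)$ be the Iwahori–Hecke algebra of the symmetric group $W=S_\ell$: the $K$-algebra with generators $T_1,\dots,T_{\ell-1}$ and relations $T_iT_{i+1}T_i=T_{i+1}T_iT_{i+1}$, $T_iT_j=T_jT_i$ for $|i-j|\ge 2$, and $T_i^2=(q-1)T_i+q$. For $w\in W$ of length $l(w)$ let $T_w$ be the product of the generators along a reduced expression of $w$. For an interval $[a,b]\subseteq\{1,\dots,\ell\}$ let $W_{[a,b]}\le W$ be the group of permutations fixing every letter outside $[a,b]$, and put $x_{[a,b]}=\sum_{w\in W_{[a,b]}}T_w$ and $y_{[a,b]}=\sum_{w\in W_{[a,b]}}(-q)^{-l(w)}T_w$. For $1\le r\le \ell-1$ and $s=\ell-r$ let $$\varepsilon_r=c_r\,x_{[1,s]}y_{[s+1,\ell]}\ (r\text{ odd}),\qquad \varepsilon_r=c_r\,y_{[1,r]}x_{[r+1,\ell]}\ (r\text{ even}),\qquad c_r=\big([s]_q!\,[r]_{q^{-1}}!\big)^{-1},$$ where $[m]_u!=\prod_{k=1}^m(1+u+\dots+u^{k-1})$,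 and let $\varepsilon=\varepsilon_1+\dots+\varepsilon_{\ell-1}$. Attach to $\varepsilon_r$ the composition $\lambda(r)=(s,r)$ if $r$ is odd and $\lambda(r)=(r,s)$ if $r$ is even, with standard Young subgroup $W_{\lambda(r)}$. For $1\le r\le\ell-2$ put $$\alpha_r=\varepsilon_rT_d\varepsilon_{r+1},\qquad \beta_r=\varepsilon_{r+1}T_{d^{-1}}\varepsilon_r,$$ where $d$ is the distinguished $W_{\lambda(r)}$–$W_{\lambda(r+1)}$ double coset representative with $\varepsilon_rT_d\varepsilon_{r+1}\ne 0$. (A distinguished representative is an element $d$ such that $d$ is the unique element of minimal length in $W_{\lambda(r)}d$ and $d^{-1}$ is the unique element of minimal length in $W_{\lambda(r+1)}d^{-1}$.) Modules are right modules. Put $\omega_r=\alpha_r\beta_r$ for $1\le r\le \ell-2$ and $\omega_{\ell-1}=\beta_{\ell-2}\alpha_{\ell-2}$. Then the $\varepsilon_r$ are pairwise orthogonal idempotents (so $\varepsilon$ is an idempotent), for each $1\le r\le \ell-2$ the representative $d$ exists and is unique, and the following hold. (a) For $1\le r\le\ell-1$, $\varepsilon_rH$ is an indecomposable projective $H$-module,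 and $\varepsilon_rH\varepsilon$ is an indecomposable projective $\varepsilon H\varepsilon$-module. The radical of the $\varepsilon H\varepsilon$-module $\varepsilon_rH\varepsilon$ has $K$-basis $\{\alpha_r,\beta_{r-1},\alpha_r\beta_r\}$ if $2\le r\le \ell-2$, $K$-basis $\{\alpha_1,\alpha_1\beta_1\}$ if $r=1$, and $K$-basis $\{\beta_{\ell-2},\beta_{\ell-2}\alpha_{\ell-2}\}$ if $r=\ell-1$. (b) For $1\le r\le \ell-1$, the socle of the $\varepsilon H\varepsilon$-module $\varepsilon_rH\varepsilon$ is simple and is spanned over $K$ by $\omega_r$. The socle of the $H$-module $\varepsilon_rH$ is simple and is equal to $\omega_rH$. (c) The quotients $\varepsilon_rH\varepsilon/\mathrm{rad}(\varepsilon_rH\varepsilon)$, $1\le r\le\ell-1$, are simple $\varepsilon H\varepsilon$-modules of dimension $1$ over $K$, they are pairwise non-isomorphic, and every simple $\varepsilon H\varepsilon$-module is isomorphic to one of them. The socle of $\varepsilon H\varepsilon$ (as a right module over itself) is spanned over $K$ by the elements $\alpha_r\beta_r$, $1\le r\le\ell-2$, together with $\beta_{\ell-2}\alpha_{\ell-2}$.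 -/

import Mathlib

noncomputable section

namespace HeckeBlock

/-! ### Module-theoretic notions -/

/-- A module is indecomposable if it is nonzero and is not the direct sum of two nonzero
submodules. -/
def IsIndecomposable (R M : Type*) [Ring R] [AddCommGroup M] [Module R M] : Prop :=
  Nontrivial M ∧ ∀ N N' : Submodule R M, IsCompl N N' → N = ⊥ ∨ N' = ⊥

/-- The socle of a module: the sum of its simple submodules, i.e. the largest semisimple
submodule. -/
def socle (R M : Type*) [Ring R] [AddCommGroup M] [Module R M] : Submodule R M :=
  sSup {N : Submodule R M | IsSimpleModule R N}

/-- The principal right ideal `x R`, as a right `R`-module (right `R`-modules are modules over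
`Rᵐᵒᵖ`). -/
def rightIdeal {R : Type*} [Ring R] (x : R) : Submodule Rᵐᵒᵖ R :=
  Submodule.span Rᵐᵒᵖ {x}

/-- The family `v` is a `K`-basis of the subset `S` of `V` (which is then a subspace). -/
def IsBasisOf (K : Type*) {V ι : Type*} [Field K] [AddCommGroup V] [Module K V]
    (v : ι → V) (S : Set V) : Prop :=
  LinearIndependent K v ∧ (Submodule.span K (Set.range v) : Set V) = S

section Corner

variable {K R : Type*} [Field K] [Ring R] [Algebra K R] {e : R}

/-- The ring `e R e` with identity `e`, for an idempotent `e`. -/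
def CornerAlg (he : IsIdempotentElem e) : Type _ := he.Corner

instance cornerRing (he : IsIdempotentElem e) : Ring (CornerAlg he) :=
  inferInstanceAs (Ring he.Corner)

/-- The inclusion of the ring `e R e` (with identity `e`) into `R`. -/
def cornerVal (he : IsIdempotentElem e) : CornerAlg he →+ R where
  toFun a := a.1
  map_zero' := rfl
  map_add' _ _ := rfl

theorem cornerVal_injective (he : IsIdempotentElem e) : Function.Injective (cornerVal he) :=
  fun _ _ h => Subtype.ext h

theorem cornerVal_mul (he : IsIdempotentElem e) (a b : CornerAlg he) :
    cornerVal he (a * b) = cornerVal he a * cornerVal he b := rfl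

theorem cornerVal_mul_right (he : IsIdempotentElem e) (a : CornerAlg he) :
    cornerVal he a * e = cornerVal he a :=
  ((Subsemigroup.mem_corner_iff he).mp a.2).2

instance cornerSMul (he : IsIdempotentElem e) : SMul K (CornerAlg he) where
  smul c a := ⟨c • a.1, by
    obtain ⟨x, hx⟩ := a.2
    exact ⟨c • x, by simp only [← hx, mul_smul_comm, smul_mul_assoc]⟩⟩

instance cornerModule (he : IsIdempotentElem e) : Module K (CornerAlg he) :=
  Function.Injective.module K (cornerVal he) (cornerVal_injective he) fun _ _ => rfl

/-- `e R e` is a `K`-algebra with scalars acting as in `R`. -/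
instance cornerAlgebra (he : IsIdempotentElem e) : Algebra K (CornerAlg he) :=
  Algebra.ofModule
    (fun c a b => cornerVal_injective he (smul_mul_assoc c (cornerVal he a) (cornerVal he b)))
    (fun c a b => cornerVal_injective he (mul_smul_comm c (cornerVal he a) (cornerVal he b)))

/-- The right `e R e`-module `x R e`, realised inside `e R e`. (For `x` with `e x = x` all of
`x R e` lies in `e R e`.) -/
def cornerRightIdeal (he : IsIdempotentElem e) (x : R) : Submodule (CornerAlg he)ᵐᵒᵖ (CornerAlg he) where
  carrier := {a | ∃ h : R, cornerVal he a = x * h * e}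
  zero_mem' := ⟨0, by simp⟩
  add_mem' := by
    rintro a b ⟨g, hg⟩ ⟨h, hh⟩
    exact ⟨g + h, by rw [map_add, hg, hh, mul_add, add_mul]⟩
  smul_mem' := by
    rintro c a ⟨h, hh⟩
    refine ⟨h * e * cornerVal he c.unop, ?_⟩
    change cornerVal he (a * c.unop) = _
    rw [cornerVal_mul, hh]
    conv_lhs => rw [← cornerVal_mul_right he c.unop]
    simp only [mul_assoc]

/-- The radical of the right `e R e`-module `x R e`. -/
def cornerRad (he : IsIdempotentElem e) (x : R) :
    Submodule (CornerAlg he)ᵐᵒᵖ (cornerRightIdeal he x) :=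
  Module.jacobson (CornerAlg he)ᵐᵒᵖ (cornerRightIdeal he x)

/-- The top of the right `e R e`-module `x R e`: its quotient by its radical. -/
abbrev CornerTop (he : IsIdempotentElem e) (x : R) : Type _ :=
  cornerRightIdeal he x ⧸ cornerRad he x

/-- A submodule of the right `e R e`-module `x R e`, as a subset of `R`. -/
def asSubset (he : IsIdempotentElem e) {x : R}
    (N : Submodule (CornerAlg he)ᵐᵒᵖ (cornerRightIdeal he x)) : Set R :=
  {y | ∃ z ∈ N, cornerVal he z.1 = y}

end Corner

/-! ### The symmetric group -/

/-- The basic transposition exchanging the (zero-based) letters `i` and `i + 1`. -/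
def simpleRefl (n : ℕ) (i : Fin (n - 1)) : Equiv.Perm (Fin n) :=
  Equiv.swap ⟨i, by omega⟩ ⟨i + 1, by omega⟩

/-- The product in the symmetric group of a word in the basic transpositions. -/
def wordPerm (n : ℕ) (ω : List (Fin (n - 1))) : Equiv.Perm (Fin n) :=
  (ω.map (simpleRefl n)).prod

theorem exists_wordPerm (n : ℕ) (w : Equiv.Perm (Fin n)) : ∃ ω, wordPerm n ω = w := by
  cases n with
  | zero => exact ⟨[], Subsingleton.elim _ _⟩
  | succ m =>
    have hw : w ∈ Submonoid.closure (Set.range fun i : Fin m => Equiv.swap i.castSucc i.succ) := by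
      rw [Equiv.Perm.mclosure_swap_castSucc_succ]; trivial
    induction hw using Submonoid.closure_induction with
    | mem x hx =>
      obtain ⟨i, rfl⟩ := hx
      exact ⟨[i], by simp [wordPerm, simpleRefl]; rfl⟩
    | one => exact ⟨[], rfl⟩
    | mul x y _ _ hx hy =>
      obtain ⟨a, rfl⟩ := hx
      obtain ⟨b, rfl⟩ := hy
      exact ⟨a ++ b, by simp [wordPerm]⟩

/-- The length of a permutation: the least `k` such that it is a product of `k` basic
transpositions. -/
def len {n : ℕ} (w : Equiv.Perm (Fin n)) : ℕ :=
  sInf {k | ∃ ω, wordPerm n ω = w ∧ ω.length = k}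

theorem exists_reducedWord {n : ℕ} (w : Equiv.Perm (Fin n)) :
    ∃ ω, wordPerm n ω = w ∧ ω.length = len w := by
  obtain ⟨ω, hω⟩ := exists_wordPerm n w
  exact Nat.sInf_mem (s := {k | ∃ ω, wordPerm n ω = w ∧ ω.length = k}) ⟨_, ω, hω, rfl⟩

/-- A (chosen) reduced expression of a permutation. -/
def reducedWord {n : ℕ} (w : Equiv.Perm (Fin n)) : List (Fin (n - 1)) :=
  (exists_reducedWord w).choose

/-- The group `W_[a,b]` of permutations of the interval `[a,b]` of `{1, …, n}`, inside the
symmetric group: all letters outside the interval are fixed. (The letter `k` in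
`{1, …, n}` is `k - 1 : Fin n`.) -/
def intervalGroup (n a b : ℕ) : Finset (Equiv.Perm (Fin n)) :=
  {w | ∀ k : Fin n, ¬ (a ≤ k.val + 1 ∧ k.val + 1 ≤ b) → w k = k}

/-- The permutations lying in the standard Young subgroup of the composition `(a, n - a)`, that is,
those preserving `{1, …, a}` and `{a + 1, …, n}`. -/
def youngSet (n a : ℕ) : Set (Equiv.Perm (Fin n)) :=
  {w | ∀ k : Fin n, (w k).val < a ↔ k.val < a}

/-- The distinguished right coset representatives `d` of the Young subgroup of `(a, n - a)`:
`d` is the unique element of minimal length in its coset. -/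
def rightReps (n a : ℕ) : Set (Equiv.Perm (Fin n)) :=
  {d | ∀ h ∈ youngSet n a, h ≠ 1 → len d < len (h * d)}

/-- The distinguished double coset representatives for the Young subgroups of `(a, n - a)` and
`(b, n - b)`. -/
def doubleReps (n a b : ℕ) : Set (Equiv.Perm (Fin n)) :=
  {d | d ∈ rightReps n a ∧ d⁻¹ ∈ rightReps n b}

/-! ### The Iwahori-Hecke algebra -/

section Hecke

variable {K : Type*} [Field K]

/-- The defining relations of the Hecke algebra of type `A_{n-1}`; the generator `T_{i+1}`
corresponds to `i : Fin (n - 1)`. -/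
inductive HeckeRel (q : K) (n : ℕ) :
    FreeAlgebra K (Fin (n - 1)) → FreeAlgebra K (Fin (n - 1)) → Prop
  | braid (i j : Fin (n - 1)) (h : j.val = i.val + 1) : HeckeRel q n
      (FreeAlgebra.ι K i * FreeAlgebra.ι K j * FreeAlgebra.ι K i)
      (FreeAlgebra.ι K j * FreeAlgebra.ι K i * FreeAlgebra.ι K j)
  | comm (i j : Fin (n - 1)) (h : i.val + 2 ≤ j.val) : HeckeRel q n
      (FreeAlgebra.ι K i * FreeAlgebra.ι K j) (FreeAlgebra.ι K j * FreeAlgebra.ι K i)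
  | quad (i : Fin (n - 1)) : HeckeRel q n
      (FreeAlgebra.ι K i * FreeAlgebra.ι K i)
      ((q - 1) • FreeAlgebra.ι K i + algebraMap K _ q)

/-- The Iwahori-Hecke algebra `H_q(n)`. -/
def Hecke (q : K) (n : ℕ) : Type _ := RingQuot (HeckeRel q n)

instance heckeRing (q : K) (n : ℕ) : Ring (Hecke q n) :=
  inferInstanceAs (Ring (RingQuot (HeckeRel q n)))

instance heckeAlgebra (q : K) (n : ℕ) : Algebra K (Hecke q n) :=
  inferInstanceAs (Algebra K (RingQuot (HeckeRel q n)))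

/-- The generators of `H_q(n)`. -/
def gen (q : K) (n : ℕ) (i : Fin (n - 1)) : Hecke q n :=
  RingQuot.mkAlgHom K (HeckeRel q n) (FreeAlgebra.ι K i)

/-- The element `T_w`: the product of the generators along a reduced expression of `w`. -/
def T (q : K) {n : ℕ} (w : Equiv.Perm (Fin n)) : Hecke q n :=
  ((reducedWord w).map (gen q n)).prod

/-- `x_[a,b] = ∑ T_w`, the sum over `w` in `W_[a,b]`. -/
def xElt (q : K) (n a b : ℕ) : Hecke q n :=
  ∑ w ∈ intervalGroup n a b, T q w

/-- `y_[a,b] = ∑ (-q)^{-l(w)} T_w`, the sum over `w` in `W_[a,b]`. -/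
def yElt (q : K) (n a b : ℕ) : Hecke q n :=
  ∑ w ∈ intervalGroup n a b, ((-q) ^ len w)⁻¹ • T q w

/-- The quantum factorial `∏_{m=1}^{r} (1 + u + … + u^{m-1})`. -/
def qFactorial (u : K) (r : ℕ) : K :=
  ∏ m ∈ Finset.Icc 1 r, ∑ i ∈ Finset.range m, u ^ i

/-- The idempotent `ε_r` of `H_q(ℓ)`, for `1 ≤ r ≤ ℓ - 1`. -/
def eps (q : K) (ℓ r : ℕ) : Hecke q ℓ :=
  (qFactorial q (ℓ - r) * qFactorial q⁻¹ r)⁻¹ •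
    (if Odd r then xElt q ℓ 1 (ℓ - r) * yElt q ℓ (ℓ - r + 1) ℓ
      else yElt q ℓ 1 r * xElt q ℓ (r + 1) ℓ)

/-- The first part of the two-part composition of `ℓ` belonging to `ε_r`. -/
def firstPart (ℓ r : ℕ) : ℕ := if Odd r then ℓ - r else r

/-- `ε = ε_1 + … + ε_{ℓ-1}`. -/
def epsSum (q : K) (ℓ : ℕ) : Hecke q ℓ :=
  ∑ r ∈ Finset.Icc 1 (ℓ - 1), eps q ℓ r

/-- `d` is a distinguished double coset representative with `ε_r T_d ε_{r+1} ≠ 0`. -/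
def IsArrowRep (q : K) (ℓ r : ℕ) (d : Equiv.Perm (Fin ℓ)) : Prop :=
  d ∈ doubleReps ℓ (firstPart ℓ r) (firstPart ℓ (r + 1)) ∧
    eps q ℓ r * T q d * eps q ℓ (r + 1) ≠ 0

/-- The distinguished double coset representative `d` with `ε_r T_d ε_{r+1} ≠ 0`. -/
def arrowRep (q : K) (ℓ r : ℕ) : Equiv.Perm (Fin ℓ) :=
  Classical.epsilon (IsArrowRep q ℓ r)

/-- `α_r = ε_r T_d ε_{r+1}`. -/
def alpha (q : K) (ℓ r : ℕ) : Hecke q ℓ :=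
  eps q ℓ r * T q (arrowRep q ℓ r) * eps q ℓ (r + 1)

/-- `β_r = ε_{r+1} T_{d⁻¹} ε_r`. -/
def beta (q : K) (ℓ r : ℕ) : Hecke q ℓ :=
  eps q ℓ (r + 1) * T q (arrowRep q ℓ r)⁻¹ * eps q ℓ r

/-- The element `α_r β_r` for `r ≤ ℓ - 2`, and `β_{ℓ-2} α_{ℓ-2}` for `r = ℓ - 1`. -/
def socElt (q : K) (ℓ r : ℕ) : Hecke q ℓ :=
  if r ≤ ℓ - 2 then alpha q ℓ r * beta q ℓ r else beta q ℓ (ℓ - 2) * alpha q ℓ (ℓ - 2)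

end Hecke

end HeckeBlock

end

open HeckeBlock

/-! The Hecke algebra `H` acts on the right on functions on words of length `ℓ` in two letters: a
generator multiplies a pair of equal letters by `q` (symmetric letter) or by `-1` (alternating
letter) and mixes the two orders of a pair of distinct letters. This is a tensor power of a
superspace of dimension 1|1. The words with `r` alternating letters span a submodule `degSpace`, of
dimension "ℓ choose r". It is generated by the vacuum `vac`, the word that is alternating exactly
where `ε_r` is, and `ε_r` fixes this word. Since `ε_r H` is spanned by the `ε_r T_d` with `d` a
minimal coset representative, and there are at most "ℓ choose r" of these, acting on the vacuum
identifies `ε_r H` with that submodule (`act_vac_injective`). Computations in `ε_r H ε_t` can then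
be done with words.

Upper bounds for `ε_r H ε_t` come from a Mackey-type argument (`eps_mul_T_mul_eps_eq_zero`): if a
double coset representative `d` carries two letters of one colour to two letters of the other
colour, then `T_d T_i = T_j T_d` for generators acting by the different scalars `q` and `-1` on the
two sides, so `ε_r T_d ε_t = 0`. At most one mismatch of each kind survives, and counting
alternating letters gives dimension at most 2 for `r = t`, at most 1 for neighbours, and 0
otherwise.

Lower bounds come from two operators commuting with `H`: the sum `E` of fermionic creation operators
(`raising`) and the weighted sum `F` of annihilation operators (`lowering`). They satisfy `E² = 0`
and `EF + FE = [ℓ]_{q⁻¹}`, which vanishes because `q` is a primitive `ℓ`-th root of unity. On vacua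
`α_r` acts as a nonzero multiple of `F` and `β_r` as a nonzero multiple of `E`. Hence `ω_r` acts as
a nonzero multiple of `FE`, which does not kill the vacuum and whose square is zero; so `ε_r H ε_r`
has basis `ε_r, ω_r`.

Finally, an invariant form on words shows that every nonzero `x` in `ε_r H` has `x h ε_r ≠ 0` for
some `h` (`exists_mul_mul_eps_ne_zero`). These facts are collected in `IsZigzag`, from which all the
module theory follows formally: `ω_r` lies in every nonzero submodule of `ε_r H`, and, once the
idempotents sum to one, the radical of `e_r S` is the kernel of left multiplication by `ω_r`. The
axioms pass to the corner `ε H ε`, so the same lemmas serve both algebras. -/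

noncomputable section

namespace HeckeBlock

/-! ### Inversions and length in the symmetric group -/

section Perm

variable {n : ℕ}

/-- The left letter moved by a basic transposition. -/
def lo (i : Fin (n - 1)) : Fin n := ⟨i, by omega⟩

/-- The right letter moved by a basic transposition. -/
def hi (i : Fin (n - 1)) : Fin n := ⟨i + 1, by omega⟩

theorem lo_lt_hi (i : Fin (n - 1)) : lo i < hi i := by simp [lo, hi, Fin.lt_def]

theorem simpleRefl_lo (i : Fin (n - 1)) : simpleRefl n i (lo i) = hi i :=
  Equiv.swap_apply_left _ _

theorem simpleRefl_hi (i : Fin (n - 1)) : simpleRefl n i (hi i) = lo i :=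
  Equiv.swap_apply_right _ _

theorem simpleRefl_of_ne (i : Fin (n - 1)) {x : Fin n} (h₁ : x ≠ lo i) (h₂ : x ≠ hi i) :
    simpleRefl n i x = x :=
  Equiv.swap_apply_of_ne_of_ne h₁ h₂

theorem simpleRefl_mul_self (i : Fin (n - 1)) : simpleRefl n i * simpleRefl n i = 1 :=
  Equiv.swap_mul_self _ _

theorem simpleRefl_inv (i : Fin (n - 1)) : (simpleRefl n i)⁻¹ = simpleRefl n i :=
  Equiv.swap_inv _ _

theorem simpleRefl_apply_self (i : Fin (n - 1)) (x : Fin n) :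
    simpleRefl n i (simpleRefl n i x) = x := by
  rw [← Equiv.Perm.mul_apply, simpleRefl_mul_self, Equiv.Perm.one_apply]

theorem simpleRefl_mul_cancel (i : Fin (n - 1)) (w : Equiv.Perm (Fin n)) :
    simpleRefl n i * (simpleRefl n i * w) = w := by
  rw [← mul_assoc, simpleRefl_mul_self, one_mul]

theorem mul_simpleRefl_cancel (i : Fin (n - 1)) (w : Equiv.Perm (Fin n)) :
    w * simpleRefl n i * simpleRefl n i = w := by
  rw [mul_assoc, simpleRefl_mul_self, mul_one]

theorem simpleRefl_val (i : Fin (n - 1)) (x : Fin n) :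
    (simpleRefl n i x).val =
      if x.val = i.val then i.val + 1 else if x.val = i.val + 1 then i.val else x.val := by
  simp only [simpleRefl, Equiv.swap_apply_def, Fin.ext_iff]
  split_ifs <;> rfl

theorem simpleRefl_comm {i j : Fin (n - 1)} (h : i.val + 2 ≤ j.val) :
    simpleRefl n i * simpleRefl n j = simpleRefl n j * simpleRefl n i := by
  ext x
  simp only [Equiv.Perm.mul_apply, simpleRefl_val]
  split_ifs <;> omega

theorem simpleRefl_braid {i j : Fin (n - 1)} (h : j.val = i.val + 1) :
    simpleRefl n i * simpleRefl n j * simpleRefl n i =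
      simpleRefl n j * simpleRefl n i * simpleRefl n j := by
  have hj : simpleRefl n j = Equiv.swap (hi i) (hi j) := by
    simp only [simpleRefl, hi, h]
  have hi' : simpleRefl n i = Equiv.swap (lo i) (hi i) := rfl
  have h₁ : lo i ≠ hi i := (lo_lt_hi i).ne
  have h₂ : lo i ≠ hi j := by simp [lo, hi]; omega
  have h₃ : hi i ≠ hi j := by simp [hi]; omega
  rw [hj, hi', Equiv.swap_mul_swap_mul_swap h₁ h₂, Equiv.swap_comm (lo i) (hi i),
    Equiv.swap_comm (hi i) (hi j), Equiv.swap_mul_swap_mul_swap h₃.symm h₂.symm, Equiv.swap_comm]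

theorem simpleRefl_lt (i : Fin (n - 1)) {x y : Fin n} (h : x < y) (hne : ¬ (x = lo i ∧ y = hi i)) :
    simpleRefl n i x < simpleRefl n i y := by
  simp only [lo, hi, Fin.ext_iff, Fin.lt_def, simpleRefl_val] at *
  split_ifs <;> omega

/-- The inversions of a permutation. -/
def inversions (w : Equiv.Perm (Fin n)) : Finset (Fin n × Fin n) :=
  {p | p.1 < p.2 ∧ w p.2 < w p.1}

theorem mem_inversions {w : Equiv.Perm (Fin n)} {p : Fin n × Fin n} :
    p ∈ inversions w ↔ p.1 < p.2 ∧ w p.2 < w p.1 := by simp [inversions]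

/-- Applying `s_i` to both entries carries the inversions of `w` to those of `w s_i` other than the
one new pair `(i, i+1)`, the only pair whose order `s_i` reverses. -/
theorem card_inversions_mul {w : Equiv.Perm (Fin n)} {i : Fin (n - 1)} (h : w (lo i) < w (hi i)) :
    (inversions (w * simpleRefl n i)).card = (inversions w).card + 1 := by
  have key : inversions (w * simpleRefl n i) = insert (lo i, hi i)
      ((inversions w).map ((simpleRefl n i).prodCongr (simpleRefl n i)).toEmbedding) := by
    ext ⟨x, y⟩
    simp only [mem_inversions, Equiv.Perm.mul_apply, Finset.mem_insert, Prod.mk.injEq,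
      Finset.mem_map_equiv, Equiv.prodCongr_symm, Equiv.prodCongr_apply, Prod.map_apply]
    have hs : (simpleRefl n i).symm = simpleRefl n i := simpleRefl_inv i
    rw [hs]
    by_cases hxy : x = lo i ∧ y = hi i
    · obtain ⟨rfl, rfl⟩ := hxy
      simp [simpleRefl_lo, simpleRefl_hi, lo_lt_hi, h]
    · simp only [hxy, false_or]
      refine and_congr_left fun hw => ⟨fun hlt => simpleRefl_lt i hlt hxy, fun hlt => ?_⟩
      have := simpleRefl_lt i hlt (by
        rintro ⟨h₁, h₂⟩
        rw [h₁, h₂] at hw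
        exact lt_asymm h hw)
      rwa [simpleRefl_apply_self, simpleRefl_apply_self] at this
  rw [key, Finset.card_insert_of_notMem, Finset.card_map]
  simp only [Finset.mem_map_equiv, mem_inversions]
  rintro ⟨h₁, -⟩
  have h₂ : ((simpleRefl n i).prodCongr (simpleRefl n i)).symm (lo i, hi i) = (hi i, lo i) := by
    rw [Equiv.symm_apply_eq]
    simp [simpleRefl_lo, simpleRefl_hi]
  rw [h₂] at h₁
  exact lt_asymm h₁ (lo_lt_hi i)

theorem card_inversions_mul' {w : Equiv.Perm (Fin n)} {i : Fin (n - 1)} (h : w (hi i) < w (lo i)) :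
    (inversions (w * simpleRefl n i)).card + 1 = (inversions w).card := by
  have := card_inversions_mul (w := w * simpleRefl n i) (i := i)
    (by simpa [simpleRefl_lo, simpleRefl_hi] using h)
  rw [mul_simpleRefl_cancel] at this
  exact this.symm

theorem inversions_one : inversions (1 : Equiv.Perm (Fin n)) = ∅ := by
  ext p
  simp only [mem_inversions, Equiv.Perm.one_apply, Finset.notMem_empty, iff_false]
  exact fun h => lt_asymm h.1 h.2

theorem lo_ne_hi_apply (w : Equiv.Perm (Fin n)) (i : Fin (n - 1)) :
    w (lo i) < w (hi i) ∨ w (hi i) < w (lo i) :=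
  lt_or_gt_of_ne fun h => (lo_lt_hi i).ne (w.injective h)

/-- Without descents `w` is strictly increasing, and the only order automorphism of a finite chain
is the identity. -/
theorem exists_descent {w : Equiv.Perm (Fin n)} (hw : w ≠ 1) : ∃ i, w (hi i) < w (lo i) := by
  by_contra! hcon
  apply hw
  have hlt : ∀ i, w (lo i) < w (hi i) := fun i =>
    lt_of_le_of_ne (hcon i) fun h => (lo_lt_hi i).ne (w.injective h)
  have hmono : StrictMono w := by
    cases n with
    | zero => exact fun x => x.elim0
    | succ m => exact Fin.strictMono_iff_lt_succ.mpr fun i => hlt i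
  ext x
  have : (hmono.orderIsoOfSurjective w w.surjective) = OrderIso.refl _ := Subsingleton.elim _ _
  exact congrArg Fin.val (DFunLike.congr_fun this x)

theorem wordPerm_append (ω ω' : List (Fin (n - 1))) :
    wordPerm n (ω ++ ω') = wordPerm n ω * wordPerm n ω' := by simp [wordPerm]

theorem wordPerm_cons (i : Fin (n - 1)) (ω : List (Fin (n - 1))) :
    wordPerm n (i :: ω) = simpleRefl n i * wordPerm n ω := by simp [wordPerm]

theorem wordPerm_reverse (ω : List (Fin (n - 1))) :
    wordPerm n ω.reverse = (wordPerm n ω)⁻¹ := by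
  induction ω with
  | nil => simp [wordPerm]
  | cons i ω ih =>
    rw [List.reverse_cons, wordPerm_append, ih, wordPerm_cons i ω, mul_inv_rev, simpleRefl_inv]
    simp [wordPerm]

theorem card_inversions_wordPerm_le (ω : List (Fin (n - 1))) :
    (inversions (wordPerm n ω)).card ≤ ω.length := by
  induction ω using List.reverseRecOn with
  | nil => simp [wordPerm, inversions_one]
  | append_singleton ω i ih =>
    have hi : wordPerm n (ω ++ [i]) = wordPerm n ω * simpleRefl n i := by simp [wordPerm]
    rw [hi, List.length_append, List.length_singleton]
    rcases lo_ne_hi_apply (wordPerm n ω) i with h | h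
    · rw [card_inversions_mul h]; omega
    · have := card_inversions_mul' h; omega

theorem len_le_of_wordPerm {w : Equiv.Perm (Fin n)} {ω : List (Fin (n - 1))}
    (h : wordPerm n ω = w) : len w ≤ ω.length :=
  Nat.sInf_le ⟨ω, h, rfl⟩

theorem exists_word_card_inversions (w : Equiv.Perm (Fin n)) :
    ∃ ω, wordPerm n ω = w ∧ ω.length = (inversions w).card := by
  induction hk : (inversions w).card generalizing w with
  | zero =>
    by_cases hw : w = 1
    · exact ⟨[], by simp [wordPerm, hw], rfl⟩
    · obtain ⟨i, h⟩ := exists_descent hw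
      have := card_inversions_mul' h
      omega
  | succ k ih =>
    have hw : w ≠ 1 := by
      rintro rfl
      simp [inversions_one] at hk
    obtain ⟨i, h⟩ := exists_descent hw
    obtain ⟨ω, h₁, h₂⟩ := ih (w * simpleRefl n i) (by have := card_inversions_mul' h; omega)
    refine ⟨ω ++ [i], ?_, by simp [h₂]⟩
    rw [wordPerm_append, h₁, wordPerm_cons, ← mul_assoc, mul_simpleRefl_cancel]
    simp [wordPerm]

/-- A generator changes the inversion number by exactly one, which bounds the length from below;
removing descents one at a time produces a word attaining the bound. Length questions thereby become
comparisons of two values of a permutation. -/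
theorem len_eq_card_inversions (w : Equiv.Perm (Fin n)) : len w = (inversions w).card := by
  apply le_antisymm
  · obtain ⟨ω, h₁, h₂⟩ := exists_word_card_inversions w
    exact h₂ ▸ len_le_of_wordPerm h₁
  · obtain ⟨ω, rfl, h₂⟩ := exists_reducedWord w
    rw [← h₂]
    exact card_inversions_wordPerm_le ω

theorem len_one : len (1 : Equiv.Perm (Fin n)) = 0 := by
  rw [len_eq_card_inversions, inversions_one, Finset.card_empty]

theorem len_inv (w : Equiv.Perm (Fin n)) : len w⁻¹ = len w := by
  have key : ∀ w : Equiv.Perm (Fin n), len w⁻¹ ≤ len w := fun w => by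
    obtain ⟨ω, rfl, h₂⟩ := exists_reducedWord w
    rw [← h₂, ← wordPerm_reverse, ← List.length_reverse]
    exact len_le_of_wordPerm rfl
  exact le_antisymm (key w) (by simpa using key w⁻¹)

theorem len_mul_of_lt {w : Equiv.Perm (Fin n)} {i : Fin (n - 1)} (h : w (lo i) < w (hi i)) :
    len (w * simpleRefl n i) = len w + 1 := by
  simpa only [len_eq_card_inversions] using card_inversions_mul h

theorem len_mul_of_gt {w : Equiv.Perm (Fin n)} {i : Fin (n - 1)} (h : w (hi i) < w (lo i)) :
    len (w * simpleRefl n i) + 1 = len w := by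
  simpa only [len_eq_card_inversions] using card_inversions_mul' h

theorem len_mul_left (w : Equiv.Perm (Fin n)) (i : Fin (n - 1)) :
    len (simpleRefl n i * w) = len (w⁻¹ * simpleRefl n i) := by
  rw [← len_inv, mul_inv_rev, simpleRefl_inv]

theorem len_left_of_lt {w : Equiv.Perm (Fin n)} {i : Fin (n - 1)} (h : w⁻¹ (lo i) < w⁻¹ (hi i)) :
    len (simpleRefl n i * w) = len w + 1 := by
  rw [len_mul_left, len_mul_of_lt h, len_inv]

theorem len_left_of_gt {w : Equiv.Perm (Fin n)} {i : Fin (n - 1)} (h : w⁻¹ (hi i) < w⁻¹ (lo i)) :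
    len (simpleRefl n i * w) + 1 = len w := by
  rw [len_mul_left, len_mul_of_gt h, len_inv]

/-! ### Matsumoto's theorem -/

theorem left_descent_of_reduced {i : Fin (n - 1)} {u : List (Fin (n - 1))}
    (h : len (wordPerm n (i :: u)) = u.length + 1) :
    (wordPerm n (i :: u))⁻¹ (hi i) < (wordPerm n (i :: u))⁻¹ (lo i) := by
  rcases lo_ne_hi_apply (wordPerm n (i :: u))⁻¹ i with h' | h'
  · have h₁ := len_left_of_lt h'
    rw [wordPerm_cons, simpleRefl_mul_cancel, ← wordPerm_cons, h] at h₁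
    have := len_le_of_wordPerm (n := n) (ω := u) rfl
    omega
  · exact h'

theorem lo_eq_hi_of_succ {i j : Fin (n - 1)} (h : j.val = i.val + 1) : lo j = hi i := by
  simp [lo, hi, h]

section Matsumoto

variable {M : Type*} [Monoid M] (g : Fin (n - 1) → M)

/-- Both `i` and `j` are left descents of `w`, and they do not interfere, so `w = s_i s_j z` with
lengths adding. The two given words are compared, through shorter words, with `i j z` and `j i z`.
-/
theorem prod_cons_eq_of_far (comm : ∀ i j : Fin (n - 1), i.val + 2 ≤ j.val → g i * g j = g j * g i)
    {k : ℕ} (ih : ∀ ω ω' : List (Fin (n - 1)), ω.length = k → ω'.length = k →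
      len (wordPerm n ω) = k → wordPerm n ω = wordPerm n ω' → (ω.map g).prod = (ω'.map g).prod)
    {i j : Fin (n - 1)} (hij : i.val + 2 ≤ j.val) {u u' : List (Fin (n - 1))}
    (hu : u.length = k) (hu' : u'.length = k) (hl : len (wordPerm n (i :: u)) = k + 1)
    (he : wordPerm n (i :: u) = wordPerm n (j :: u')) :
    ((i :: u).map g).prod = ((j :: u').map g).prod := by
  have di := left_descent_of_reduced (hu ▸ hl)
  have dj := left_descent_of_reduced (hu' ▸ he ▸ hl)
  rw [← he] at dj
  set w := wordPerm n (i :: u) with hw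
  have hwi : wordPerm n u = simpleRefl n i * w := by
    rw [hw, wordPerm_cons, simpleRefl_mul_cancel]
  have hwj : wordPerm n u' = simpleRefl n j * w := by
    rw [he, wordPerm_cons, simpleRefl_mul_cancel]
  have l₁ := len_left_of_gt di
  have l₁' := len_left_of_gt dj
  have d₂ : (simpleRefl n i * w)⁻¹ (hi j) < (simpleRefl n i * w)⁻¹ (lo j) := by
    rw [mul_inv_rev, simpleRefl_inv, Equiv.Perm.mul_apply, Equiv.Perm.mul_apply,
      simpleRefl_of_ne, simpleRefl_of_ne]
    · exact dj
    all_goals simp only [lo, hi, ne_eq, Fin.mk.injEq]; omega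
  have l₂ := len_left_of_gt d₂
  obtain ⟨z, hz, hzl⟩ := exists_reducedWord (simpleRefl n j * (simpleRefl n i * w))
  have e₁ := ih u (j :: z) hu (by simp; omega) (by rw [hwi]; omega)
    (by rw [wordPerm_cons, hz, simpleRefl_mul_cancel, hwi])
  have e₂ := ih u' (i :: z) hu' (by simp; omega) (by rw [hwj]; omega)
    (by rw [wordPerm_cons, hz, ← mul_assoc (simpleRefl n j), ← simpleRefl_comm hij, mul_assoc,
      simpleRefl_mul_cancel, hwj])
  simp only [List.map_cons, List.prod_cons] at e₁ e₂ ⊢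
  rw [e₁, e₂, ← mul_assoc, ← mul_assoc, comm i j hij]

/-- Two adjacent left descents force `w⁻¹` to reverse three consecutive letters, so `w = s_i s_j s_i
z` with lengths adding. The given words are compared with `i j i z` and `j i j z`, which differ by
the braid relation. -/
theorem prod_cons_eq_of_adjacent
    (braid : ∀ i j : Fin (n - 1), j.val = i.val + 1 → g i * g j * g i = g j * g i * g j)
    {k : ℕ} (ih : ∀ ω ω' : List (Fin (n - 1)), ω.length = k → ω'.length = k →
      len (wordPerm n ω) = k → wordPerm n ω = wordPerm n ω' → (ω.map g).prod = (ω'.map g).prod)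
    {i j : Fin (n - 1)} (hij : j.val = i.val + 1) {u u' : List (Fin (n - 1))}
    (hu : u.length = k) (hu' : u'.length = k) (hl : len (wordPerm n (i :: u)) = k + 1)
    (he : wordPerm n (i :: u) = wordPerm n (j :: u')) :
    ((i :: u).map g).prod = ((j :: u').map g).prod := by
  have di := left_descent_of_reduced (hu ▸ hl)
  have dj := left_descent_of_reduced (hu' ▸ he ▸ hl)
  rw [← he] at dj
  set w := wordPerm n (i :: u) with hw
  have hwi : wordPerm n u = simpleRefl n i * w := by
    rw [hw, wordPerm_cons, simpleRefl_mul_cancel]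
  have hwj : wordPerm n u' = simpleRefl n j * w := by
    rw [he, wordPerm_cons, simpleRefl_mul_cancel]
  have hlh := lo_eq_hi_of_succ hij
  have s₁ : simpleRefl n i (hi j) = hi j :=
    simpleRefl_of_ne i (by simp [lo, hi]; omega) (by simp [hi]; omega)
  have s₂ : simpleRefl n j (lo i) = lo i :=
    simpleRefl_of_ne j (by simp [lo]; omega) (by simp [lo, hi]; omega)
  have s₃ : simpleRefl n i (lo j) = lo i := by rw [hlh, simpleRefl_hi]
  have s₄ : simpleRefl n j (hi i) = hi j := by rw [← hlh, simpleRefl_lo]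
  have l₁ := len_left_of_gt di
  have l₁' := len_left_of_gt dj
  have l₂ : len (simpleRefl n j * (simpleRefl n i * w)) + 1 = len (simpleRefl n i * w) := by
    apply len_left_of_gt
    simp only [mul_inv_rev, simpleRefl_inv, Equiv.Perm.mul_apply, s₁, s₃]
    exact dj.trans (hlh ▸ di)
  have l₃ : len (simpleRefl n i * (simpleRefl n j * (simpleRefl n i * w))) + 1 =
      len (simpleRefl n j * (simpleRefl n i * w)) := by
    apply len_left_of_gt
    simp only [mul_inv_rev, simpleRefl_inv, Equiv.Perm.mul_apply, s₂, s₄, s₁, simpleRefl_lo]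
    exact hlh ▸ dj
  obtain ⟨z, hz, hzl⟩ := exists_reducedWord (simpleRefl n i * (simpleRefl n j * (simpleRefl n i * w)))
  have e₁ := ih u (j :: i :: z) hu (by simp; omega) (by rw [hwi]; omega)
    (by rw [wordPerm_cons, wordPerm_cons, hz, simpleRefl_mul_cancel, simpleRefl_mul_cancel, hwi])
  have hbr : simpleRefl n i * (simpleRefl n j * (simpleRefl n i * w)) =
      simpleRefl n j * (simpleRefl n i * (simpleRefl n j * w)) := by
    simpa only [mul_assoc] using congrArg (· * w) (simpleRefl_braid hij)
  have e₂ := ih u' (i :: j :: z) hu' (by simp; omega) (by rw [hwj]; omega)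
    (by rw [wordPerm_cons, wordPerm_cons, hz, hbr, simpleRefl_mul_cancel, simpleRefl_mul_cancel,
      hwj])
  simp only [List.map_cons, List.prod_cons] at e₁ e₂ ⊢
  rw [e₁, e₂]
  simpa only [mul_assoc] using congrArg (· * (z.map g).prod) (braid i j hij)

/-- Reduced expressions of the same permutation have the same product in every monoid with
generators satisfying the braid relations. -/
theorem prod_map_eq_of_reduced
    (braid : ∀ i j : Fin (n - 1), j.val = i.val + 1 → g i * g j * g i = g j * g i * g j)
    (comm : ∀ i j : Fin (n - 1), i.val + 2 ≤ j.val → g i * g j = g j * g i) (k : ℕ) :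
    ∀ ω ω' : List (Fin (n - 1)), ω.length = k → ω'.length = k →
      len (wordPerm n ω) = k → wordPerm n ω = wordPerm n ω' →
      (ω.map g).prod = (ω'.map g).prod := by
  induction k with
  | zero =>
    intro ω ω' h h' _ _
    rw [List.length_eq_zero_iff.mp h, List.length_eq_zero_iff.mp h']
  | succ k ih =>
    intro ω ω' h h' hl he
    obtain ⟨i, u, rfl⟩ := List.exists_cons_of_length_eq_add_one h
    obtain ⟨j, u', rfl⟩ := List.exists_cons_of_length_eq_add_one h'
    have hu : u.length = k := by simpa using h
    have hu' : u'.length = k := by simpa using h'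
    rcases lt_trichotomy i.val j.val with hij | hij | hij
    · rcases Nat.lt_or_ge j.val (i.val + 2) with h2 | h2
      · exact prod_cons_eq_of_adjacent g braid ih (by omega) hu hu' hl he
      · exact prod_cons_eq_of_far g comm ih h2 hu hu' hl he
    · obtain rfl := Fin.ext hij
      rw [wordPerm_cons, wordPerm_cons] at he
      have he' := mul_left_cancel he
      have hlu : len (wordPerm n u) = k := by
        have d := left_descent_of_reduced (hu ▸ hl)
        have := len_left_of_gt d
        rw [wordPerm_cons, simpleRefl_mul_cancel, ← wordPerm_cons] at this
        omega
      simp only [List.map_cons, List.prod_cons]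
      rw [ih u u' hu hu' hlu he']
    · rw [he] at hl
      rcases Nat.lt_or_ge i.val (j.val + 2) with h2 | h2
      · exact (prod_cons_eq_of_adjacent g braid ih (by omega) hu' hu hl he.symm).symm
      · exact (prod_cons_eq_of_far g comm ih h2 hu' hu hl he.symm).symm

end Matsumoto

end Perm

/-! ### Multiplication in the Hecke algebra -/

section Multiplication

variable {K : Type*} [Field K] {q : K} {n : ℕ}

theorem gen_braid (i j : Fin (n - 1)) (h : j.val = i.val + 1) :
    gen q n i * gen q n j * gen q n i = gen q n j * gen q n i * gen q n j := by
  have := RingQuot.mkAlgHom_rel K (HeckeRel.braid (q := q) i j h)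
  simp only [map_mul] at this
  exact this

theorem gen_comm (i j : Fin (n - 1)) (h : i.val + 2 ≤ j.val) :
    gen q n i * gen q n j = gen q n j * gen q n i := by
  have := RingQuot.mkAlgHom_rel K (HeckeRel.comm (q := q) i j h)
  simp only [map_mul] at this
  exact this

theorem gen_quad (i : Fin (n - 1)) :
    gen q n i * gen q n i = (q - 1) • gen q n i + algebraMap K (Hecke q n) q := by
  have := RingQuot.mkAlgHom_rel K (HeckeRel.quad (q := q) (n := n) i)
  rw [map_mul, map_add, map_smul, AlgHom.commutes] at this
  exact this

/-- By Matsumoto's theorem the choice of reduced word in the definition of `T` is immaterial. -/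
theorem T_wordPerm {ω : List (Fin (n - 1))} (h : len (wordPerm n ω) = ω.length) :
    T q (wordPerm n ω) = (ω.map (gen q n)).prod := by
  obtain ⟨h₁, h₂⟩ := (exists_reducedWord (wordPerm n ω)).choose_spec
  exact prod_map_eq_of_reduced (gen q n) gen_braid gen_comm ω.length _ _
    (h₂.trans h) rfl ((congrArg len h₁).trans h) h₁

theorem T_one : T q (1 : Equiv.Perm (Fin n)) = 1 :=
  T_wordPerm (ω := []) (by simp [wordPerm, len_one])

theorem gen_mul_T_of_lt {w : Equiv.Perm (Fin n)} {i : Fin (n - 1)}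
    (h : w⁻¹ (lo i) < w⁻¹ (hi i)) : gen q n i * T q w = T q (simpleRefl n i * w) := by
  have hl := len_left_of_lt h
  obtain ⟨ω, rfl, hω⟩ := exists_reducedWord w
  rw [← wordPerm_cons] at hl ⊢
  rw [T_wordPerm hω.symm, T_wordPerm (by rw [hl, List.length_cons, hω]), List.map_cons,
    List.prod_cons]

theorem T_mul_gen_of_lt {w : Equiv.Perm (Fin n)} {i : Fin (n - 1)}
    (h : w (lo i) < w (hi i)) : T q w * gen q n i = T q (w * simpleRefl n i) := by
  have hl := len_mul_of_lt h
  obtain ⟨ω, rfl, hω⟩ := exists_reducedWord w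
  have hi : wordPerm n ω * simpleRefl n i = wordPerm n (ω ++ [i]) := by simp [wordPerm]
  rw [hi] at hl ⊢
  rw [T_wordPerm hω.symm, T_wordPerm (by rw [hl, List.length_append, hω]; rfl), List.map_append,
    List.prod_append]
  simp

theorem gen_mul_T_of_gt {w : Equiv.Perm (Fin n)} {i : Fin (n - 1)}
    (h : w⁻¹ (hi i) < w⁻¹ (lo i)) :
    gen q n i * T q w = (q - 1) • T q w + q • T q (simpleRefl n i * w) := by
  have h' : gen q n i * T q (simpleRefl n i * w) = T q w := by
    rw [gen_mul_T_of_lt, simpleRefl_mul_cancel]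
    simpa [mul_inv_rev, simpleRefl_inv, simpleRefl_lo, simpleRefl_hi] using h
  rw [← h', ← mul_assoc, gen_quad, add_mul, smul_mul_assoc, Algebra.smul_def q]

theorem T_mul_gen_of_gt {w : Equiv.Perm (Fin n)} {i : Fin (n - 1)}
    (h : w (hi i) < w (lo i)) :
    T q w * gen q n i = (q - 1) • T q w + q • T q (w * simpleRefl n i) := by
  have h' : T q (w * simpleRefl n i) * gen q n i = T q w := by
    rw [T_mul_gen_of_lt, mul_simpleRefl_cancel]
    simpa [simpleRefl_lo, simpleRefl_hi] using h
  rw [← h', mul_assoc, gen_quad, mul_add, mul_smul_comm, Algebra.smul_def q, Algebra.commutes]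

/-- Algebra homomorphisms out of the Hecke algebra. -/
def heckeLift {A : Type*} [Ring A] [Algebra K A] (g : Fin (n - 1) → A)
    (braid : ∀ i j : Fin (n - 1), j.val = i.val + 1 → g i * g j * g i = g j * g i * g j)
    (comm : ∀ i j : Fin (n - 1), i.val + 2 ≤ j.val → g i * g j = g j * g i)
    (quad : ∀ i, g i * g i = (q - 1) • g i + algebraMap K A q) : Hecke q n →ₐ[K] A :=
  RingQuot.liftAlgHom K ⟨FreeAlgebra.lift K g, by
    intro x y h
    cases h with
    | braid i j h => simpa using braid i j h
    | comm i j h => simpa using comm i j h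
    | quad i => simpa using quad i⟩

theorem heckeLift_gen {A : Type*} [Ring A] [Algebra K A] (g : Fin (n - 1) → A)
    (braid comm quad) (i : Fin (n - 1)) :
    heckeLift (q := q) g braid comm quad (gen q n i) = g i := by
  unfold heckeLift gen
  erw [RingQuot.liftAlgHom_mkAlgHom_apply]
  simp

theorem hecke_induction {p : Hecke q n → Prop} (h : Hecke q n)
    (scalar : ∀ a : K, p (algebraMap K _ a)) (gens : ∀ i, p (gen q n i))
    (add : ∀ a b, p a → p b → p (a + b)) (mul : ∀ a b, p a → p b → p (a * b)) : p h := by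
  obtain ⟨x, rfl⟩ := RingQuot.mkAlgHom_surjective K (HeckeRel q n) h
  induction x using FreeAlgebra.induction with
  | grade0 r => rw [AlgHom.commutes]; exact scalar r
  | grade1 i => exact gens i
  | add a b ha hb => rw [map_add]; exact add _ _ ha hb
  | mul a b ha hb => rw [map_mul]; exact mul _ _ ha hb

/-- The span contains `1` and is stable under right multiplication by generators. Only spanning is
used in what follows; the lower bounds on dimensions come from the action on words. -/
theorem span_T : Submodule.span K (Set.range (T q (n := n))) = ⊤ := by
  rw [eq_top_iff]
  have hmul : ∀ i, ∀ x ∈ Submodule.span K (Set.range (T q (n := n))),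
      x * gen q n i ∈ Submodule.span K (Set.range (T q (n := n))) := by
    intro i x hx
    induction hx using Submodule.span_induction with
    | mem x hx =>
      obtain ⟨w, rfl⟩ := hx
      rcases lo_ne_hi_apply w i with h | h
      · rw [T_mul_gen_of_lt h]
        exact Submodule.subset_span ⟨_, rfl⟩
      · rw [T_mul_gen_of_gt h]
        exact add_mem (Submodule.smul_mem _ _ (Submodule.subset_span ⟨_, rfl⟩))
          (Submodule.smul_mem _ _ (Submodule.subset_span ⟨_, rfl⟩))
    | zero => simp
    | add x y _ _ hx hy => rw [add_mul]; exact add_mem hx hy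
    | smul a x _ hx => rw [smul_mul_assoc]; exact Submodule.smul_mem _ _ hx
  have key : ∀ h : Hecke q n, ∀ x ∈ Submodule.span K (Set.range (T q (n := n))),
      x * h ∈ Submodule.span K (Set.range (T q (n := n))) := by
    intro h
    refine hecke_induction
      (p := fun h => ∀ x ∈ Submodule.span K (Set.range (T q (n := n))),
        x * h ∈ Submodule.span K (Set.range (T q (n := n)))) h ?_ hmul ?_ ?_
    · intro a x hx
      rw [← Algebra.commutes, ← Algebra.smul_def]
      exact Submodule.smul_mem _ _ hx
    · intro a b ha hb x hx
      rw [mul_add]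
      exact add_mem (ha x hx) (hb x hx)
    · intro a b ha hb x hx
      rw [← mul_assoc]
      exact hb _ (ha x hx)
  intro h _
  simpa using key h 1 (T_one (q := q) (n := n) ▸ Submodule.subset_span ⟨1, rfl⟩)

/-- The anti-automorphism of the Hecke algebra fixing the generators. -/
def flipHom (q : K) (n : ℕ) : Hecke q n →ₐ[K] (Hecke q n)ᵐᵒᵖ :=
  heckeLift (fun i => MulOpposite.op (gen q n i))
    (fun i j h => by
      simp only [← MulOpposite.op_mul]
      rw [← mul_assoc, ← mul_assoc, gen_braid i j h])
    (fun i j h => by simp only [← MulOpposite.op_mul, gen_comm i j h])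
    (fun i => by
      rw [← MulOpposite.op_mul, gen_quad, MulOpposite.op_add, MulOpposite.op_smul]
      rfl)

/-- The anti-automorphism of the Hecke algebra fixing the generators, as a linear map. -/
def flip (h : Hecke q n) : Hecke q n := (flipHom q n h).unop

theorem flip_gen (i : Fin (n - 1)) : flip (gen q n i) = gen q n i := by
  simp [flip, flipHom, heckeLift_gen]

theorem flip_mul (a b : Hecke q n) : flip (a * b) = flip b * flip a := by simp [flip]

theorem flip_add (a b : Hecke q n) : flip (a + b) = flip a + flip b := by simp [flip]

theorem flip_smul (c : K) (a : Hecke q n) : flip (c • a) = c • flip a := by simp [flip]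

theorem flip_algebraMap (c : K) : flip (algebraMap K (Hecke q n) c) = algebraMap K _ c := by
  simp [flip]

theorem flip_sum {ι : Type*} (s : Finset ι) (f : ι → Hecke q n) :
    flip (∑ i ∈ s, f i) = ∑ i ∈ s, flip (f i) := by simp [flip]

theorem flip_flip (a : Hecke q n) : flip (flip a) = a := by
  refine hecke_induction (p := fun a => flip (flip a) = a) a ?_ ?_ ?_ ?_
  · intro a; rw [flip_algebraMap, flip_algebraMap]
  · intro i; rw [flip_gen, flip_gen]
  · intro a b ha hb; rw [flip_add, flip_add, ha, hb]
  · intro a b ha hb; rw [flip_mul, flip_mul, ha, hb]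

theorem flip_T (w : Equiv.Perm (Fin n)) : flip (T q w) = T q w⁻¹ := by
  have hlen := len_inv w
  obtain ⟨ω, rfl, hω⟩ := exists_reducedWord w
  rw [← wordPerm_reverse] at hlen ⊢
  rw [T_wordPerm hω.symm, T_wordPerm (by rw [hlen, List.length_reverse, hω])]
  clear hω hlen
  induction ω with
  | nil => simp [flip]
  | cons i ω ih => simp [flip_mul, ih, flip_gen]

end Multiplication

end HeckeBlock

end

noncomputable section

namespace HeckeBlock

/-! ### Parabolic subgroups of intervals -/

section Interval

variable {n a b : ℕ}

theorem mem_intervalGroup {w : Equiv.Perm (Fin n)} :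
    w ∈ intervalGroup n a b ↔ ∀ k : Fin n, ¬ (a ≤ k.val + 1 ∧ k.val + 1 ≤ b) → w k = k := by
  simp [intervalGroup]

theorem one_mem_intervalGroup : (1 : Equiv.Perm (Fin n)) ∈ intervalGroup n a b :=
  mem_intervalGroup.mpr fun _ _ => rfl

theorem mul_mem_intervalGroup {v w : Equiv.Perm (Fin n)} (hv : v ∈ intervalGroup n a b)
    (hw : w ∈ intervalGroup n a b) : v * w ∈ intervalGroup n a b := by
  rw [mem_intervalGroup] at *
  intro k hk
  rw [Equiv.Perm.mul_apply, hw k hk, hv k hk]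

theorem inv_mem_intervalGroup {w : Equiv.Perm (Fin n)} (hw : w ∈ intervalGroup n a b) :
    w⁻¹ ∈ intervalGroup n a b := by
  rw [mem_intervalGroup] at *
  intro k hk
  rw [Equiv.Perm.inv_eq_iff_eq, hw k hk]

theorem simpleRefl_mem_intervalGroup {i : Fin (n - 1)} (hi : a ≤ i.val + 1 ∧ i.val + 2 ≤ b) :
    simpleRefl n i ∈ intervalGroup n a b := by
  rw [mem_intervalGroup]
  intro k hk
  apply simpleRefl_of_ne <;> simp only [lo, HeckeBlock.hi, ne_eq, Fin.ext_iff] <;> omega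

theorem val_mem_of_mem_intervalGroup {w : Equiv.Perm (Fin n)} (hw : w ∈ intervalGroup n a b)
    {k : Fin n} (hk : a ≤ k.val + 1 ∧ k.val + 1 ≤ b) :
    a ≤ (w k).val + 1 ∧ (w k).val + 1 ≤ b := by
  by_contra hcon
  have h := mem_intervalGroup.mp hw _ hcon
  rw [w.injective h] at hcon
  exact hcon hk

theorem descent_mem_interval {w : Equiv.Perm (Fin n)} (hw : w ∈ intervalGroup n a b)
    {i : Fin (n - 1)} (h : w (hi i) < w (lo i)) : a ≤ i.val + 1 ∧ i.val + 2 ≤ b := by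
  have h₁ := mem_intervalGroup.mp hw (lo i)
  have h₂ := mem_intervalGroup.mp hw (hi i)
  have h₃ := fun hk => val_mem_of_mem_intervalGroup hw (k := lo i) hk
  have h₄ := fun hk => val_mem_of_mem_intervalGroup hw (k := hi i) hk
  simp only [Fin.ext_iff, Fin.lt_def, lo, hi] at *
  omega

/-- A descent of an element of the interval group lies inside the interval, so removing left
descents never leaves the group. -/
theorem interval_induction {p : Equiv.Perm (Fin n) → Prop} (one : p 1)
    (step : ∀ i : Fin (n - 1), a ≤ i.val + 1 ∧ i.val + 2 ≤ b → ∀ w ∈ intervalGroup n a b,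
      w⁻¹ (lo i) < w⁻¹ (hi i) → p w → p (simpleRefl n i * w))
    {w : Equiv.Perm (Fin n)} (hw : w ∈ intervalGroup n a b) : p w := by
  induction hk : len w using Nat.strong_induction_on generalizing w with
  | _ k ih =>
    by_cases h1 : w = 1
    · exact h1 ▸ one
    · obtain ⟨i, hd⟩ := exists_descent (inv_ne_one.mpr h1)
      have hi := descent_mem_interval (inv_mem_intervalGroup hw) hd
      have hmem := mul_mem_intervalGroup (simpleRefl_mem_intervalGroup hi) hw
      have hl := len_left_of_gt hd
      rw [← simpleRefl_mul_cancel i w]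
      refine step i hi _ hmem ?_ (ih _ (by omega) hmem rfl)
      simpa [mul_inv_rev, simpleRefl_inv, simpleRefl_lo, simpleRefl_hi] using hd

theorem intervalGroup_eq_one (h : b ≤ a) : intervalGroup n a b = {1} := by
  ext w
  rw [Finset.mem_singleton]
  refine ⟨fun hw => ?_, fun h => h ▸ one_mem_intervalGroup⟩
  by_contra h1
  obtain ⟨i, hd⟩ := exists_descent h1
  have := descent_mem_interval hw hd
  omega

/-- The group is sliced by the image of its last letter, at zero-based position `b`. Left
multiplication by the transposition of `b-k-1` and `b-k` carries one slice to the next and lengthens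
each element by one, because the preimage of `b-k` is the last letter of the interval. -/
theorem sum_fiber_succ {K : Type*} [Field K] (u : K) (hb : b < n) {k : ℕ} (hk : k + a ≤ b) (ha : 1 ≤ a) :
    ∑ w ∈ intervalGroup n a (b + 1) with b - (w ⟨b, hb⟩).val = k + 1, u ^ len w =
      u * ∑ w ∈ intervalGroup n a (b + 1) with b - (w ⟨b, hb⟩).val = k, u ^ len w := by
  obtain ⟨i, hi⟩ : ∃ i : Fin (n - 1), i.val = b - k - 1 := ⟨⟨b - k - 1, by omega⟩, rfl⟩
  have hs : simpleRefl n i ∈ intervalGroup n a (b + 1) :=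
    simpleRefl_mem_intervalGroup (by omega)
  have hin : a ≤ (⟨b, hb⟩ : Fin n).val + 1 ∧ (⟨b, hb⟩ : Fin n).val + 1 ≤ b + 1 := by
    simp only; omega
  rw [Finset.mul_sum]
  symm
  refine Finset.sum_nbij' (fun w => simpleRefl n i * w) (fun w => simpleRefl n i * w) ?_ ?_ ?_ ?_ ?_
  · intro w hw
    rw [Finset.mem_filter] at *
    refine ⟨mul_mem_intervalGroup hs hw.1, ?_⟩
    have := val_mem_of_mem_intervalGroup hw.1 hin
    rw [Equiv.Perm.mul_apply, simpleRefl_val]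
    split_ifs <;> omega
  · intro w hw
    rw [Finset.mem_filter] at *
    refine ⟨mul_mem_intervalGroup hs hw.1, ?_⟩
    have := val_mem_of_mem_intervalGroup hw.1 hin
    rw [Equiv.Perm.mul_apply, simpleRefl_val]
    split_ifs <;> omega
  · intro w _; exact simpleRefl_mul_cancel i w
  · intro w _; exact simpleRefl_mul_cancel i w
  · intro w hw
    rw [Finset.mem_filter] at hw
    have h1 : w ⟨b, hb⟩ = HeckeBlock.hi i := by
      have := val_mem_of_mem_intervalGroup hw.1 hin
      ext
      simp only [HeckeBlock.hi]
      omega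
    have h2 : w⁻¹ (lo i) < w⁻¹ (HeckeBlock.hi i) := by
      rw [← h1, show w⁻¹ (w ⟨b, hb⟩) = ⟨b, hb⟩ from w.symm_apply_apply _]
      have h3 := val_mem_of_mem_intervalGroup (inv_mem_intervalGroup hw.1) (k := lo i)
        (by simp only [lo]; omega)
      have h4 : w⁻¹ (lo i) ≠ ⟨b, hb⟩ := by
        rw [ne_eq, Equiv.Perm.inv_eq_iff_eq, h1]
        exact (lo_lt_hi i).ne
      rw [Fin.lt_def]
      rw [ne_eq, Fin.ext_iff] at h4
      simp only at h4 ⊢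
      omega
    rw [len_left_of_lt h2, pow_succ, mul_comm]

/-- The Poincaré polynomial of a symmetric group on `m` letters, by induction on `m`: the slices by
the image of the last letter contribute `1, u, u², …` times the polynomial of the subgroup fixing
that letter. -/
theorem sum_pow_len_intervalGroup {K : Type*} [Field K] (u : K) (ha : 1 ≤ a) {m : ℕ}
    (h : a + m ≤ n + 1) :
    ∑ w ∈ intervalGroup n a (a + m - 1), u ^ len w = qFactorial u m := by
  induction m with
  | zero =>
    rw [intervalGroup_eq_one (by omega)]
    simp [qFactorial, len_one]
  | succ m ih =>
    obtain ⟨b, hb⟩ : ∃ b, b = a + m - 1 := ⟨_, rfl⟩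
    have hbn : b < n := by omega
    have hb' : a + (m + 1) - 1 = b + 1 := by omega
    specialize ih (by omega)
    rw [← hb] at ih
    rw [hb']
    have hmaps : ∀ w ∈ intervalGroup n a (b + 1), b - (w ⟨b, hbn⟩).val ∈ Finset.range (m + 1) := by
      intro w hw
      have := val_mem_of_mem_intervalGroup hw (k := ⟨b, hbn⟩) (by simp only; omega)
      rw [Finset.mem_range]
      omega
    rw [← Finset.sum_fiberwise_of_maps_to hmaps]
    have key : ∀ k, k ≤ m → ∑ w ∈ intervalGroup n a (b + 1) with b - (w ⟨b, hbn⟩).val = k,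
        u ^ len w = u ^ k * qFactorial u m := by
      intro k hk
      induction k with
      | zero =>
        rw [pow_zero, one_mul, ← ih]
        refine Finset.sum_congr ?_ fun _ _ => rfl
        ext w
        rw [Finset.mem_filter]
        constructor
        · rintro ⟨hw, h0⟩
          have := val_mem_of_mem_intervalGroup hw (k := ⟨b, hbn⟩) (by simp only; omega)
          rw [mem_intervalGroup] at hw ⊢
          intro k hk
          by_cases hkb : k.val = b
          · obtain rfl : k = ⟨b, hbn⟩ := Fin.ext hkb
            ext
            simp only
            omega
          · exact hw k (by omega)
        · intro hw
          rw [mem_intervalGroup] at hw ⊢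
          refine ⟨fun k hk => hw k (by omega), ?_⟩
          rw [hw ⟨b, hbn⟩ (by simp only; omega)]
          simp
      | succ k ihk =>
        rw [sum_fiber_succ u hbn (by omega) ha, ihk (by omega)]
        ring
    rw [Finset.sum_congr rfl fun k hk => key k (by rw [Finset.mem_range] at hk; omega),
      ← Finset.sum_mul, qFactorial, qFactorial, Finset.prod_Icc_succ_top (by omega), mul_comm]

end Interval

/-! ### Parabolic symmetrizers -/

section Symmetrizer

variable {K : Type*} [Field K] {q κ : K} {n a b : ℕ}

/-- The sum of the `κ ^ l(w) T_w` over the parabolic subgroup of an interval. -/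
def symmetrizer (q κ : K) (n a b : ℕ) : Hecke q n :=
  ∑ w ∈ intervalGroup n a b, κ ^ len w • T q w

theorem xElt_eq : xElt q n a b = symmetrizer q 1 n a b := by
  simp [xElt, symmetrizer]

theorem yElt_eq : yElt q n a b = symmetrizer q (-q)⁻¹ n a b := by
  simp only [yElt, symmetrizer, inv_pow]

/-- The condition on `κ` has the roots `1` and `-q⁻¹`, giving the elements `x` and `y` with
eigenvalues `q` and `-1`. -/
theorem gen_mul_symmetrizer (hκ : (1 - κ) * (1 + κ * q) = 0) {i : Fin (n - 1)}
    (hi : a ≤ i.val + 1 ∧ i.val + 2 ≤ b) :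
    gen q n i * symmetrizer q κ n a b = (κ * q) • symmetrizer q κ n a b := by
  have hs := simpleRefl_mem_intervalGroup (n := n) hi
  rw [← sub_eq_zero, symmetrizer, Finset.mul_sum, Finset.smul_sum, ← Finset.sum_sub_distrib]
  -- The terms of `w` and `s_i w` add up to a multiple of `(1 - κ)(1 + κ q)`, so the difference
  -- cancels along the involution `w ↦ s_i w`.
  have key : ∀ w : Equiv.Perm (Fin n), w⁻¹ (lo i) < w⁻¹ (HeckeBlock.hi i) →
      (gen q n i * κ ^ len w • T q w - (κ * q) • κ ^ len w • T q w) +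
      (gen q n i * κ ^ len (simpleRefl n i * w) • T q (simpleRefl n i * w) -
        (κ * q) • κ ^ len (simpleRefl n i * w) • T q (simpleRefl n i * w)) = 0 := by
    intro w h
    have h' : (simpleRefl n i * w)⁻¹ (HeckeBlock.hi i) < (simpleRefl n i * w)⁻¹ (lo i) := by
      simpa [mul_inv_rev, simpleRefl_inv, simpleRefl_lo, simpleRefl_hi] using h
    rw [mul_smul_comm, mul_smul_comm, gen_mul_T_of_lt h, gen_mul_T_of_gt h',
      simpleRefl_mul_cancel, len_left_of_lt h]
    have h0 : (κ ^ len w * ((1 - κ) * (1 + κ * q))) • T q (simpleRefl n i * w) = 0 := by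
      rw [hκ, mul_zero, zero_smul]
    rw [← h0]
    module
  refine Finset.sum_involution (fun w _ => simpleRefl n i * w) ?_ ?_ ?_ ?_
  · intro w _
    rcases lo_ne_hi_apply w⁻¹ i with h | h
    · exact key w h
    · have := key (simpleRefl n i * w)
        (by simpa [mul_inv_rev, simpleRefl_inv, simpleRefl_lo, simpleRefl_hi] using h)
      rw [simpleRefl_mul_cancel] at this
      rw [add_comm]
      exact this
  · intro w _ _ h
    have h1 : simpleRefl n i = 1 := by simpa using h
    have := simpleRefl_lo i
    rw [h1] at this
    exact (lo_lt_hi i).ne this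
  · intro w hw
    exact mul_mem_intervalGroup hs hw
  · intro w _
    exact simpleRefl_mul_cancel i w

theorem flip_symmetrizer : flip (symmetrizer q κ n a b) = symmetrizer q κ n a b := by
  rw [symmetrizer, flip_sum]
  refine Finset.sum_nbij' (fun w => w⁻¹) (fun w => w⁻¹) (fun _ => inv_mem_intervalGroup)
    (fun _ => inv_mem_intervalGroup) (by simp) (by simp) ?_
  intro w _
  rw [flip_smul, flip_T, len_inv]

theorem commute_symmetrizer {h : Hecke q n}
    (hc : ∀ i : Fin (n - 1), a ≤ i.val + 1 ∧ i.val + 2 ≤ b → Commute h (gen q n i)) :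
    Commute h (symmetrizer q κ n a b) := by
  refine Commute.sum_right _ _ _ fun w hw => Commute.smul_right ?_ _
  refine interval_induction (p := fun w => Commute h (T q w)) ?_ ?_ hw
  · rw [T_one]; exact Commute.one_right h
  · intro i hi w _ hlt ih
    rw [← gen_mul_T_of_lt hlt]
    exact (hc i hi).mul_right ih

theorem gen_commute_of_far {i j : Fin (n - 1)} (h : i.val + 2 ≤ j.val ∨ j.val + 2 ≤ i.val) :
    Commute (gen q n i) (gen q n j) := by
  rcases h with h | h
  · exact gen_comm i j h
  · exact (gen_comm j i h).symm

theorem symmetrizer_commute {κ' : K} {c : ℕ} (h : b < a) :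
    Commute (symmetrizer q κ n c b) (symmetrizer q κ' n a n) :=
  commute_symmetrizer fun i hi => (commute_symmetrizer fun j hj =>
    gen_commute_of_far (by omega)).symm

section Action

variable {V : Type*} [AddCommGroup V] [Module K V] {act : V →ₗ[K] Hecke q n →ₗ[K] V}

/-- If the generators of the interval act on `v` by `θ`, then `T_w` acts by `θ ^ len w`, and the sum
is the Poincaré polynomial at `κ θ`. -/
theorem act_symmetrizer (act_one : ∀ v, act v 1 = v)
    (act_mul : ∀ v g h, act (act v g) h = act v (g * h)) {v : V} {θ : K}
    (hv : ∀ i : Fin (n - 1), a ≤ i.val + 1 ∧ i.val + 2 ≤ b → act v (gen q n i) = θ • v)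
    (ha : 1 ≤ a) {m : ℕ} (hm : a + m ≤ n + 1) (hb : b = a + m - 1) :
    act v (symmetrizer q κ n a b) = qFactorial (κ * θ) m • v := by
  have hT : ∀ w ∈ intervalGroup n a b, act v (T q w) = θ ^ len w • v := by
    intro w hw
    refine interval_induction (p := fun w => act v (T q w) = θ ^ len w • v) ?_ ?_ hw
    · rw [T_one, act_one, len_one, pow_zero, one_smul]
    · intro i hi w _ hlt ih
      rw [← gen_mul_T_of_lt hlt, ← act_mul, hv i hi, map_smul, LinearMap.smul_apply, ih,
        len_left_of_lt hlt, pow_succ', mul_smul]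
  rw [symmetrizer, map_sum, ← sum_pow_len_intervalGroup (κ * θ) ha hm, Finset.sum_smul, ← hb]
  refine Finset.sum_congr rfl fun w hw => ?_
  rw [map_smul, hT w hw, mul_pow, mul_smul]

end Action

end Symmetrizer

/-! ### The idempotents -/

section Idempotent

variable {K : Type*} [Field K] {q : K} {ℓ r : ℕ}

/-- The letters on which `ε_r` is alternating; it is symmetric on the others. -/
def color (ℓ r : ℕ) (k : Fin ℓ) : Bool :=
  if Odd r then decide (ℓ - r ≤ k.val) else decide (k.val < r)

theorem color_odd (h : Odd r) (k : Fin ℓ) : color ℓ r k = decide (ℓ - r ≤ k.val) := if_pos h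

theorem color_even (h : ¬ Odd r) (k : Fin ℓ) : color ℓ r k = decide (k.val < r) := if_neg h

/-- The eigenvalue of a generator attached to a colour. -/
def chi (q : K) (b : Bool) : K := if b then -1 else q

theorem chi_decide (q : K) (p : Prop) [Decidable p] : chi q (decide p) = if p then -1 else q := by
  by_cases h : p <;> simp [chi, h]

theorem q_ne_zero (hℓ : 3 ≤ ℓ) (hq : IsPrimitiveRoot q ℓ) : q ≠ 0 := hq.ne_zero (by omega)

/-- Here `ℓ ≥ 3` matters: it keeps the two eigenvalues `q` and `-1` of a generator distinct. -/
theorem q_add_one_ne_zero (hℓ : 3 ≤ ℓ) (hq : IsPrimitiveRoot q ℓ) : q + 1 ≠ 0 := by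
  intro h
  have h1 : q = -1 := eq_neg_of_add_eq_zero_left h
  have := hq.dvd_of_pow_eq_one 2 (by rw [h1]; ring)
  exact absurd (Nat.le_of_dvd (by norm_num) this) (by omega)

theorem qFactorial_ne_zero {u : K} (hu : IsPrimitiveRoot u ℓ) {m : ℕ} (hm : m < ℓ) :
    qFactorial u m ≠ 0 := by
  rw [qFactorial, Finset.prod_ne_zero_iff]
  intro k hk h
  rw [Finset.mem_Icc] at hk
  have h1 := geom_sum_mul u k
  rw [h, zero_mul] at h1
  exact absurd (Nat.le_of_dvd (by omega) (hu.dvd_of_pow_eq_one k (sub_eq_zero.mp h1.symm)))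
    (by omega)

theorem y_cond (hq0 : q ≠ 0) : (1 - (-q)⁻¹) * (1 + (-q)⁻¹ * q) = 0 := by
  have : (-q)⁻¹ * q = -1 := by field_simp
  rw [this]; ring

theorem flip_eps : flip (eps q ℓ r) = eps q ℓ r := by
  rw [eps, flip_smul, xElt_eq, xElt_eq, yElt_eq, yElt_eq]
  split_ifs
  · rw [flip_mul, flip_symmetrizer, flip_symmetrizer, (symmetrizer_commute (by omega)).eq]
  · rw [flip_mul, flip_symmetrizer, flip_symmetrizer, (symmetrizer_commute (by omega)).eq]

/-- Equal colours at `i` and `i+1` mean that `s_i` lies in the Young subgroup. The generator is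
absorbed by the symmetrizer of its own block and commutes with the other one. -/
theorem gen_mul_eps (hq0 : q ≠ 0) (hr : r ≤ ℓ) {i : Fin (ℓ - 1)}
    (hi : color ℓ r (lo i) = color ℓ r (hi i)) :
    gen q ℓ i * eps q ℓ r = chi q (color ℓ r (lo i)) • eps q ℓ r := by
  have hil := i.2
  have hx : (1 - (1 : K)) * (1 + 1 * q) = 0 := by ring
  have hy := y_cond hq0
  have hyq : (-q)⁻¹ * q = -1 := by field_simp
  rw [eps, mul_smul_comm, smul_comm, xElt_eq, xElt_eq, yElt_eq, yElt_eq]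
  congr 1
  by_cases hodd : Odd r
  · simp only [color_odd hodd, lo, HeckeBlock.hi, decide_eq_decide, chi_decide] at hi ⊢
    rw [if_pos hodd]
    by_cases h : ℓ - r ≤ i.val
    · have hc : Commute (gen q ℓ i) (symmetrizer q 1 ℓ 1 (ℓ - r)) :=
        commute_symmetrizer fun j hj => gen_commute_of_far (by omega)
      rw [← mul_assoc, hc.eq, mul_assoc, gen_mul_symmetrizer hy (by omega), mul_smul_comm, hyq]
      simp [h]
    · rw [← mul_assoc, gen_mul_symmetrizer hx (by omega), smul_mul_assoc]
      simp [h]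
  · simp only [color_even hodd, lo, HeckeBlock.hi, decide_eq_decide, chi_decide] at hi ⊢
    rw [if_neg hodd]
    by_cases h : i.val < r
    · rw [← mul_assoc, gen_mul_symmetrizer hy (by omega), smul_mul_assoc, hyq]
      simp [h]
    · have hc : Commute (gen q ℓ i) (symmetrizer q (-q)⁻¹ ℓ 1 r) :=
        commute_symmetrizer fun j hj => gen_commute_of_far (by omega)
      rw [← mul_assoc, hc.eq, mul_assoc, gen_mul_symmetrizer hx (by omega), mul_smul_comm]
      simp [h]

theorem eps_mul_gen (hq0 : q ≠ 0) (hr : r ≤ ℓ) {i : Fin (ℓ - 1)}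
    (hi : color ℓ r (lo i) = color ℓ r (hi i)) :
    eps q ℓ r * gen q ℓ i = chi q (color ℓ r (lo i)) • eps q ℓ r := by
  have := congrArg flip (gen_mul_eps hq0 hr hi)
  rwa [flip_mul, flip_smul, flip_eps, flip_gen] at this

/-- The scalar `c_r` cancels the two Poincaré polynomials, taken at `q` on the symmetric block and
at `(-q)⁻¹ · (-1) = q⁻¹` on the alternating one. The action is kept abstract because the lemma
serves both for `H` acting on itself, where it yields idempotence, and for the vacuum. -/
theorem act_eps (hℓ : 3 ≤ ℓ) (hq : IsPrimitiveRoot q ℓ) (hr : 1 ≤ r) (hr' : r ≤ ℓ - 1)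
    {V : Type*} [AddCommGroup V] [Module K V] {act : V →ₗ[K] Hecke q ℓ →ₗ[K] V}
    (act_one : ∀ v, act v 1 = v) (act_mul : ∀ v g h, act (act v g) h = act v (g * h)) {v : V}
    (hv : ∀ i : Fin (ℓ - 1), color ℓ r (lo i) = color ℓ r (hi i) →
      act v (gen q ℓ i) = chi q (color ℓ r (lo i)) • v) :
    act v (eps q ℓ r) = v := by
  have hc : qFactorial q (ℓ - r) * qFactorial q⁻¹ r ≠ 0 :=
    mul_ne_zero (qFactorial_ne_zero hq (by omega)) (qFactorial_ne_zero hq.inv (by omega))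
  have hq0 := q_ne_zero hℓ hq
  have hyq : (-q)⁻¹ * (-1) = q⁻¹ := by field_simp
  rw [eps, map_smul, xElt_eq, xElt_eq, yElt_eq, yElt_eq]
  by_cases hodd : Odd r
  · have h₁ : act v (symmetrizer q 1 ℓ 1 (ℓ - r)) = qFactorial q (ℓ - r) • v := by
      have := act_symmetrizer (κ := 1) (a := 1) (b := ℓ - r) (m := ℓ - r) act_one act_mul (v := v)
        (θ := q) (fun i hi => by
          have := hv i
          simp only [color_odd hodd, lo, HeckeBlock.hi, decide_eq_decide, chi_decide] at this
          rw [this (by omega), if_neg (by omega)]) le_rfl (by omega) (by omega)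
      rwa [one_mul] at this
    have h₂ : act v (symmetrizer q (-q)⁻¹ ℓ (ℓ - r + 1) ℓ) = qFactorial q⁻¹ r • v := by
      have := act_symmetrizer (κ := (-q)⁻¹) (a := ℓ - r + 1) (b := ℓ) (m := r) act_one act_mul
        (v := v) (θ := -1) (fun i hi => by
          have := hv i
          simp only [color_odd hodd, lo, HeckeBlock.hi, decide_eq_decide, chi_decide] at this
          rw [this (by omega), if_pos (by omega)]) (by omega) (by omega) (by omega)
      rwa [hyq] at this
    rw [if_pos hodd, ← act_mul, h₁, map_smul, LinearMap.smul_apply, h₂, smul_smul, smul_smul,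
      mul_assoc, inv_mul_cancel₀ hc, one_smul]
  · have h₁ : act v (symmetrizer q 1 ℓ (r + 1) ℓ) = qFactorial q (ℓ - r) • v := by
      have := act_symmetrizer (κ := 1) (a := r + 1) (b := ℓ) (m := ℓ - r) act_one act_mul (v := v)
        (θ := q) (fun i hi => by
          have := hv i
          simp only [color_even hodd, lo, HeckeBlock.hi, decide_eq_decide, chi_decide] at this
          rw [this (by omega), if_neg (by omega)]) (by omega) (by omega) (by omega)
      rwa [one_mul] at this
    have h₂ : act v (symmetrizer q (-q)⁻¹ ℓ 1 r) = qFactorial q⁻¹ r • v := by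
      have := act_symmetrizer (κ := (-q)⁻¹) (a := 1) (b := r) (m := r) act_one act_mul
        (v := v) (θ := -1) (fun i hi => by
          have := hv i
          simp only [color_even hodd, lo, HeckeBlock.hi, decide_eq_decide, chi_decide] at this
          rw [this (by omega), if_pos (by omega)]) (by omega) (by omega) (by omega)
      rwa [hyq] at this
    rw [if_neg hodd, ← act_mul, h₂, map_smul, LinearMap.smul_apply, h₁, smul_smul, smul_smul,
      mul_assoc, mul_comm (qFactorial q⁻¹ r), inv_mul_cancel₀ hc, one_smul]

theorem eps_mul_self (hℓ : 3 ≤ ℓ) (hq : IsPrimitiveRoot q ℓ) (hr : 1 ≤ r) (hr' : r ≤ ℓ - 1) :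
    eps q ℓ r * eps q ℓ r = eps q ℓ r :=
  act_eps hℓ hq hr hr' (act := LinearMap.mul K (Hecke q ℓ)) (by simp) (by simp [mul_assoc])
    fun i hi => eps_mul_gen (q_ne_zero hℓ hq) (by omega) hi

theorem chi_injective (hq1 : q + 1 ≠ 0) {b c : Bool} (h : b ≠ c) : chi q b ≠ chi q c := by
  have h₁ : q ≠ -1 := fun h => hq1 (by rw [h]; ring)
  cases b <;> cases c <;> simp [chi] at h ⊢
  · exact h₁
  · exact h₁.symm

/-- The alternating block is final for odd indices and initial for even ones. For opposite parities
the blocks face each other; for equal parities they differ by at least two letters. Either way two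
adjacent positions are symmetric for one index and alternating for the other. -/
theorem exists_color_mismatch (hℓ : 3 ≤ ℓ) {r t : ℕ} (hr : 1 ≤ r) (hr' : r ≤ ℓ - 1) (ht : 1 ≤ t)
    (ht' : t ≤ ℓ - 1) (hrt : r ≠ t) : ∃ i : Fin (ℓ - 1), color ℓ r (lo i) = color ℓ r (hi i) ∧
      color ℓ t (lo i) = color ℓ t (hi i) ∧ color ℓ r (lo i) ≠ color ℓ t (lo i) := by
  have key : ∀ r t : ℕ, 1 ≤ r → r ≤ ℓ - 1 → 1 ≤ t → t ≤ ℓ - 1 → r ≠ t →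
      (Odd r ∧ ¬ Odd t ∨ (Odd r ↔ Odd t) ∧ r < t) →
      ∃ i : Fin (ℓ - 1), color ℓ r (lo i) = color ℓ r (hi i) ∧
      color ℓ t (lo i) = color ℓ t (hi i) ∧ color ℓ r (lo i) ≠ color ℓ t (lo i) := by
    rintro r t hr hr' ht ht' hrt (⟨h₁, h₂⟩ | ⟨h, hlt⟩)
    · have h₁' := Nat.odd_iff.mp h₁
      have h₂' := Nat.not_odd_iff.mp h₂
      -- Positions 0 and 1 are alternating for the even index `t ≥ 2` and symmetric for `r`, unless
      -- `r` leaves only one symmetric letter; then positions `t` and `t + 1` are used.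
      by_cases h3 : r = ℓ - 1
      · refine ⟨⟨t, by omega⟩, ?_⟩
        simp only [color_odd h₁, color_even h₂, lo, hi, decide_eq_decide, ne_eq]
        omega
      · refine ⟨⟨0, by omega⟩, ?_⟩
        simp only [color_odd h₁, color_even h₂, lo, hi, decide_eq_decide, ne_eq]
        omega
    · by_cases h₂ : Odd t
      · have h₁ := h.mpr h₂
        have h₁' := Nat.odd_iff.mp h₁
        have h₂' := Nat.odd_iff.mp h₂
        refine ⟨⟨ℓ - t, by omega⟩, ?_⟩
        simp only [color_odd h₁, color_odd h₂, lo, hi, decide_eq_decide, ne_eq]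
        omega
      · have h₁ := fun h' => h₂ (h.mp h')
        have h₁' := Nat.not_odd_iff.mp h₁
        have h₂' := Nat.not_odd_iff.mp h₂
        refine ⟨⟨r, by omega⟩, ?_⟩
        simp only [color_even h₁, color_even h₂, lo, hi, decide_eq_decide, ne_eq]
        omega
  by_cases hc : Odd r ∧ ¬ Odd t ∨ (Odd r ↔ Odd t) ∧ r < t
  · exact key r t hr hr' ht ht' hrt hc
  · obtain ⟨i, h₁, h₂, h₃⟩ := key t r ht ht' hr hr' hrt.symm (by
      rcases lt_trichotomy r t with h | h | h
      · tauto
      · exact absurd h hrt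
      · tauto)
    exact ⟨i, h₂, h₁, h₃.symm⟩

/-- A generator placed between the two idempotents is absorbed as `q` from one side and as `-1` from
the other. -/
theorem eps_mul_eps_of_ne (hℓ : 3 ≤ ℓ) (hq : IsPrimitiveRoot q ℓ) {r t : ℕ} (hr : 1 ≤ r)
    (hr' : r ≤ ℓ - 1) (ht : 1 ≤ t) (ht' : t ≤ ℓ - 1) (hrt : r ≠ t) :
    eps q ℓ r * eps q ℓ t = 0 := by
  obtain ⟨i, h₁, h₂, h₃⟩ := exists_color_mismatch hℓ hr hr' ht ht' hrt
  have hq0 := q_ne_zero hℓ hq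
  have e₁ : eps q ℓ r * gen q ℓ i * eps q ℓ t =
      chi q (color ℓ r (lo i)) • (eps q ℓ r * eps q ℓ t) := by
    rw [eps_mul_gen hq0 (by omega) h₁, smul_mul_assoc]
  have e₂ : eps q ℓ r * gen q ℓ i * eps q ℓ t =
      chi q (color ℓ t (lo i)) • (eps q ℓ r * eps q ℓ t) := by
    rw [mul_assoc, gen_mul_eps hq0 (by omega) h₂, mul_smul_comm]
  have h4 := e₁.symm.trans e₂
  rw [← sub_eq_zero, ← sub_smul] at h4
  exact (smul_eq_zero.mp h4).resolve_left
    (sub_ne_zero.mpr (chi_injective (q_add_one_ne_zero hℓ hq) h₃))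

end Idempotent

end HeckeBlock

end

noncomputable section

namespace HeckeBlock

/-! ### Coset representatives -/

section Color

variable {ℓ r t : ℕ}

theorem color_convex {x y z : Fin ℓ} (hxz : x ≤ z) (hzy : z ≤ y)
    (h : color ℓ r x = color ℓ r y) : color ℓ r z = color ℓ r x := by
  rw [Fin.le_def] at hxz hzy
  by_cases hodd : Odd r
  · simp only [color_odd hodd, decide_eq_decide] at *; omega
  · simp only [color_even hodd, decide_eq_decide] at *; omega

/-- The colour classes are an initial and a final segment, so increasing steps can change colour in
one direction only. -/
theorem color_direction {u v u' v' : Fin ℓ} (h : u < v) (h' : u' < v')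
    (hc : color ℓ r u = color ℓ r v') :
    color ℓ r v = color ℓ r u ∨ color ℓ r u' = color ℓ r u := by
  rw [Fin.lt_def] at h h'
  by_cases hodd : Odd r
  · simp only [color_odd hodd, decide_eq_decide] at *; omega
  · simp only [color_even hodd, decide_eq_decide] at *; omega

theorem mem_youngSet (hr : r ≤ ℓ) {w : Equiv.Perm (Fin ℓ)} :
    w ∈ youngSet ℓ (firstPart ℓ r) ↔ ∀ k, color ℓ r (w k) = color ℓ r k := by
  refine forall_congr' fun k => ?_
  by_cases hodd : Odd r
  · simp only [firstPart, hodd, if_true, color_odd hodd, decide_eq_decide]; omega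
  · simp only [firstPart, hodd, if_false, color_even hodd, decide_eq_decide]

theorem simpleRefl_mem_youngSet (hr : r ≤ ℓ) {i : Fin (ℓ - 1)}
    (hi : color ℓ r (lo i) = color ℓ r (hi i)) :
    simpleRefl ℓ i ∈ youngSet ℓ (firstPart ℓ r) := by
  rw [mem_youngSet hr]
  intro k
  by_cases h₁ : k = lo i
  · rw [h₁, simpleRefl_lo, hi]
  by_cases h₂ : k = HeckeBlock.hi i
  · rw [h₂, simpleRefl_hi, hi]
  rw [simpleRefl_of_ne i h₁ h₂]

/-- A map on letters which is increasing on the letters of each colour. -/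
def ColorMono (ℓ r : ℕ) (f : Fin ℓ → Fin ℓ) : Prop :=
  ∀ x y, x < y → color ℓ r x = color ℓ r y → f x < f y

theorem colorMono_of_adjacent {f : Fin ℓ → Fin ℓ}
    (h : ∀ i : Fin (ℓ - 1), color ℓ r (lo i) = color ℓ r (hi i) → f (lo i) < f (hi i)) :
    ColorMono ℓ r f := by
  intro x y hxy hc
  obtain ⟨k, hk⟩ : ∃ k, y.val = x.val + k + 1 := ⟨y.val - x.val - 1, by
    rw [Fin.lt_def] at hxy; omega⟩
  induction k generalizing y with
  | zero =>
    obtain ⟨i, rfl, rfl⟩ : ∃ i : Fin (ℓ - 1), x = lo i ∧ y = hi i :=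
      ⟨⟨x, by omega⟩, rfl, Fin.ext hk⟩
    exact h i hc
  | succ k ih =>
    obtain ⟨i, hz, rfl⟩ : ∃ i : Fin (ℓ - 1), (lo i).val = x.val + k + 1 ∧ y = hi i :=
      ⟨⟨x + k + 1, by omega⟩, rfl, Fin.ext (by simp only [hi]; omega)⟩
    have hcz := color_convex (z := lo i) (by rw [Fin.le_def]; omega) (lo_lt_hi i).le hc
    exact (ih (lo i) (by rw [Fin.lt_def]; omega) hcz.symm hz).trans (h i (hcz.trans hc))

/-- Left descents of `w` are removed one by one. As `w` preserves colours, such a descent stays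
within one block, where `d⁻¹` is increasing, so it is also a left descent of `w d`. -/
theorem len_young_mul (hr : r ≤ ℓ) {d : Equiv.Perm (Fin ℓ)} (hd : ColorMono ℓ r ⇑d⁻¹)
    {w : Equiv.Perm (Fin ℓ)} (hw : w ∈ youngSet ℓ (firstPart ℓ r)) :
    len (w * d) = len w + len d := by
  induction hk : len w using Nat.strong_induction_on generalizing w with
  | _ k ih =>
    by_cases h1 : w = 1
    · rw [← hk, h1, one_mul, len_one, zero_add]
    · obtain ⟨i, hi⟩ := exists_descent (inv_ne_one.mpr h1)
      have hw' := (mem_youngSet hr).mp hw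
      have hinv : ∀ x, color ℓ r (w⁻¹ x) = color ℓ r x := fun x => by
        rw [← hw' (w⁻¹ x)]
        exact congrArg _ (w.apply_symm_apply x)
      have hc : color ℓ r (lo i) = color ℓ r (HeckeBlock.hi i) := by
        rcases Bool.eq_or_eq_not (color ℓ r (lo i)) (color ℓ r (HeckeBlock.hi i)) with h | h
        · exact h
        · rcases color_direction (r := r) (lo_lt_hi i) hi (by rw [hinv]) with h' | h'
          · exact h'.symm
          · rw [hinv] at h'
            exact h'.symm
      have l₁ := len_left_of_gt hi
      have l₂ : len (simpleRefl ℓ i * (w * d)) + 1 = len (w * d) := by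
        apply len_left_of_gt
        rw [mul_inv_rev, Equiv.Perm.mul_apply, Equiv.Perm.mul_apply]
        exact hd _ _ hi (by rw [hinv, hinv, hc])
      have hmem : simpleRefl ℓ i * w ∈ youngSet ℓ (firstPart ℓ r) := by
        rw [mem_youngSet hr]
        intro k
        rw [Equiv.Perm.mul_apply, (mem_youngSet hr).mp (simpleRefl_mem_youngSet hr hc), hw']
      have := ih (len (simpleRefl ℓ i * w)) (by omega) hmem rfl
      rw [mul_assoc] at this
      omega

theorem len_pos {w : Equiv.Perm (Fin ℓ)} (hw : w ≠ 1) : 0 < len w := by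
  obtain ⟨i, hi⟩ := exists_descent hw
  have := len_mul_of_gt hi
  omega

theorem mem_rightReps (hr : r ≤ ℓ) {d : Equiv.Perm (Fin ℓ)} :
    d ∈ rightReps ℓ (firstPart ℓ r) ↔ ColorMono ℓ r ⇑d⁻¹ := by
  constructor
  · intro hd
    refine colorMono_of_adjacent fun i hi => ?_
    have h1 : simpleRefl ℓ i ≠ 1 := fun h => (lo_lt_hi i).ne' (by
      rw [← simpleRefl_lo, h, Equiv.Perm.one_apply])
    have := hd _ (simpleRefl_mem_youngSet hr hi) h1
    rcases lo_ne_hi_apply d⁻¹ i with h | h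
    · exact h
    · have := len_left_of_gt h
      omega
  · intro hd w hw h1
    rw [len_young_mul hr hd hw]
    have := len_pos h1
    omega

theorem mem_doubleReps (hr : r ≤ ℓ) (ht : t ≤ ℓ) {d : Equiv.Perm (Fin ℓ)} :
    d ∈ doubleReps ℓ (firstPart ℓ r) (firstPart ℓ t) ↔ ColorMono ℓ r ⇑d⁻¹ ∧ ColorMono ℓ t ⇑d := by
  rw [doubleReps, Set.mem_ofPred_eq, mem_rightReps hr, mem_rightReps ht, inv_inv]

/-- Equal colour patterns mean equal cosets, and two different minimal representatives of one coset
would each be strictly shorter than the other. -/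
theorem eq_of_color_eq (hr : r ≤ ℓ) {d d' : Equiv.Perm (Fin ℓ)}
    (hd : d ∈ rightReps ℓ (firstPart ℓ r)) (hd' : d' ∈ rightReps ℓ (firstPart ℓ r))
    (h : ∀ x, color ℓ r (d x) = color ℓ r (d' x)) : d = d' := by
  have key : ∀ d d' : Equiv.Perm (Fin ℓ), d ∈ rightReps ℓ (firstPart ℓ r) →
      (∀ x, color ℓ r (d x) = color ℓ r (d' x)) → d' * d⁻¹ ≠ 1 → len d < len d' := by
    intro d d' hd h h1
    have := hd (d' * d⁻¹) ((mem_youngSet hr).mpr fun k => by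
      rw [Equiv.Perm.mul_apply, ← h]
      exact congrArg _ (d.apply_symm_apply k)) h1
    rwa [inv_mul_cancel_right] at this
  by_contra hne
  have h₁ := key d d' hd h fun h => hne (mul_inv_eq_one.mp h).symm
  have h₂ := key d' d hd' (fun x => (h x).symm) fun h => hne (mul_inv_eq_one.mp h)
  omega

theorem card_color (hr : r ≤ ℓ) : (Finset.univ.filter fun x => color ℓ r x = true).card = r := by
  by_cases hodd : Odd r
  · have h₁ : (Finset.univ.filter fun x => color ℓ r x = true) =
        (Finset.univ.filter fun x : Fin ℓ => x.val < ℓ - r)ᶜ := by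
      ext x
      simp [color_odd hodd]
    rw [h₁, Finset.card_compl, Fintype.card_fin, Fin.card_filter_val_lt]
    omega
  · have h₁ : (Finset.univ.filter fun x => color ℓ r x = true) =
        (Finset.univ.filter fun x : Fin ℓ => x.val < r) := by
      ext x
      simp [color_even hodd]
    rw [h₁, Fin.card_filter_val_lt]
    omega

end Color

section Spanning

variable {K : Type*} [Field K] {q : K} {ℓ r t : ℕ}

theorem eps_mul_T_mem_span (hq0 : q ≠ 0) (hr : r ≤ ℓ) (w : Equiv.Perm (Fin ℓ)) :
    eps q ℓ r * T q w ∈ Submodule.span K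
      ((fun d => eps q ℓ r * T q d) '' rightReps ℓ (firstPart ℓ r)) := by
  induction hk : len w using Nat.strong_induction_on generalizing w with
  | _ k ih =>
    by_cases hw : w ∈ rightReps ℓ (firstPart ℓ r)
    · exact Submodule.subset_span ⟨w, hw, rfl⟩
    · rw [mem_rightReps hr] at hw
      obtain ⟨i, hi, hlt⟩ : ∃ i : Fin (ℓ - 1), color ℓ r (lo i) = color ℓ r (hi i) ∧
          w⁻¹ (HeckeBlock.hi i) < w⁻¹ (lo i) := by
        by_contra! hcon
        refine hw (colorMono_of_adjacent fun i hi => ?_)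
        exact (lo_ne_hi_apply w⁻¹ i).resolve_right (hcon i hi).not_gt
      have hl := len_left_of_gt hlt
      have hT : T q w = gen q ℓ i * T q (simpleRefl ℓ i * w) := by
        rw [gen_mul_T_of_lt, simpleRefl_mul_cancel]
        simpa [mul_inv_rev, simpleRefl_inv, simpleRefl_lo, simpleRefl_hi] using hlt
      rw [hT, ← mul_assoc, eps_mul_gen hq0 hr hi, smul_mul_assoc]
      exact Submodule.smul_mem _ _ (ih _ (by omega) _ rfl)

theorem eps_mul_T_mul_eps_mem_span (hq0 : q ≠ 0) (hr : r ≤ ℓ) (ht : t ≤ ℓ)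
    (w : Equiv.Perm (Fin ℓ)) :
    eps q ℓ r * T q w * eps q ℓ t ∈ Submodule.span K
      ((fun d => eps q ℓ r * T q d * eps q ℓ t) ''
        doubleReps ℓ (firstPart ℓ r) (firstPart ℓ t)) := by
  induction hk : len w using Nat.strong_induction_on generalizing w with
  | _ k ih =>
    by_cases hw : ColorMono ℓ r ⇑w⁻¹
    · by_cases hw' : ColorMono ℓ t ⇑w
      · exact Submodule.subset_span ⟨w, (mem_doubleReps hr ht).mpr ⟨hw, hw'⟩, rfl⟩
      · obtain ⟨i, hi, hlt⟩ : ∃ i : Fin (ℓ - 1), color ℓ t (lo i) = color ℓ t (hi i) ∧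
            w (HeckeBlock.hi i) < w (lo i) := by
          by_contra! hcon
          refine hw' (colorMono_of_adjacent fun i hi => ?_)
          exact (lo_ne_hi_apply w i).resolve_right (hcon i hi).not_gt
        have hl := len_mul_of_gt hlt
        have hT : T q w = T q (w * simpleRefl ℓ i) * gen q ℓ i := by
          rw [T_mul_gen_of_lt, mul_simpleRefl_cancel]
          simpa [simpleRefl_lo, simpleRefl_hi] using hlt
        rw [hT, mul_assoc, mul_assoc, gen_mul_eps hq0 ht hi, mul_smul_comm, mul_smul_comm,
          ← mul_assoc]
        exact Submodule.smul_mem _ _ (ih _ (by omega) _ rfl)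
    · obtain ⟨i, hi, hlt⟩ : ∃ i : Fin (ℓ - 1), color ℓ r (lo i) = color ℓ r (hi i) ∧
          w⁻¹ (HeckeBlock.hi i) < w⁻¹ (lo i) := by
        by_contra! hcon
        refine hw (colorMono_of_adjacent fun i hi => ?_)
        exact (lo_ne_hi_apply w⁻¹ i).resolve_right (hcon i hi).not_gt
      have hl := len_left_of_gt hlt
      have hT : T q w = gen q ℓ i * T q (simpleRefl ℓ i * w) := by
        rw [gen_mul_T_of_lt, simpleRefl_mul_cancel]
        simpa [mul_inv_rev, simpleRefl_inv, simpleRefl_lo, simpleRefl_hi] using hlt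
      rw [hT, ← mul_assoc, eps_mul_gen hq0 hr hi, smul_mul_assoc, smul_mul_assoc]
      exact Submodule.smul_mem _ _ (ih _ (by omega) _ rfl)

theorem eps_mul_mem_span (hq0 : q ≠ 0) (hr : r ≤ ℓ) (h : Hecke q ℓ) :
    eps q ℓ r * h ∈ Submodule.span K
      ((fun d => eps q ℓ r * T q d) '' rightReps ℓ (firstPart ℓ r)) := by
  have hh : h ∈ Submodule.span K (Set.range (T q (n := ℓ))) := span_T (K := K) (q := q) ▸ Submodule.mem_top
  induction hh using Submodule.span_induction with
  | mem x hx =>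
    obtain ⟨w, rfl⟩ := hx
    exact eps_mul_T_mem_span hq0 hr w
  | zero => simp
  | add x y _ _ hx hy => rw [mul_add]; exact add_mem hx hy
  | smul a x _ hx => rw [mul_smul_comm]; exact Submodule.smul_mem _ _ hx

/-- Bounds for `ε_r H ε_t` reduce to the distinguished double coset representatives that act
nontrivially; the target `S` will be zero, a line or a plane. -/
theorem eps_mul_mul_eps_mem {S : Submodule K (Hecke q ℓ)} (hq0 : q ≠ 0) (hr : r ≤ ℓ) (ht : t ≤ ℓ)
    (hS : ∀ d ∈ doubleReps ℓ (firstPart ℓ r) (firstPart ℓ t),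
      eps q ℓ r * T q d * eps q ℓ t ≠ 0 → eps q ℓ r * T q d * eps q ℓ t ∈ S) (h : Hecke q ℓ) :
    eps q ℓ r * h * eps q ℓ t ∈ S := by
  have hh : h ∈ Submodule.span K (Set.range (T q (n := ℓ))) := span_T (K := K) (q := q) ▸ Submodule.mem_top
  induction hh using Submodule.span_induction with
  | mem x hx =>
    obtain ⟨w, rfl⟩ := hx
    refine Submodule.span_le.mpr ?_ (eps_mul_T_mul_eps_mem_span hq0 hr ht w)
    rintro _ ⟨d, hd, rfl⟩
    by_cases h0 : eps q ℓ r * T q d * eps q ℓ t = 0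
    · simp [h0]
    · exact hS d hd h0
  | zero => simp
  | add x y _ _ hx hy => rw [mul_add, add_mul]; exact add_mem hx hy
  | smul a x _ hx => rw [mul_smul_comm, smul_mul_assoc]; exact Submodule.smul_mem _ _ hx

/-! ### Double coset representatives acting nontrivially -/

/-- The Mackey-type vanishing: `d` conjugates a generator of one Young subgroup into a generator of
the other, and the two idempotents assign it different eigenvalues. -/
theorem eps_mul_T_mul_eps_eq_zero (hℓ : 3 ≤ ℓ) (hq : IsPrimitiveRoot q ℓ) (hr : r ≤ ℓ) (ht : t ≤ ℓ)
    {d : Equiv.Perm (Fin ℓ)} (hd : d ∈ doubleReps ℓ (firstPart ℓ r) (firstPart ℓ t))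
    {x y : Fin ℓ} (hxy : x < y) (hct : color ℓ t x = color ℓ t y)
    (hcr : color ℓ r (d x) = color ℓ r (d y)) (hne : color ℓ r (d x) ≠ color ℓ t x) :
    eps q ℓ r * T q d * eps q ℓ t = 0 := by
  have hq0 := q_ne_zero hℓ hq
  rw [mem_doubleReps hr ht] at hd
  -- By convexity of colour classes and monotonicity of `d`, the pair `x < y` may be replaced by `x`
  -- and its successor.
  obtain ⟨i, rfl⟩ : ∃ i : Fin (ℓ - 1), x = lo i :=
    ⟨⟨x, by have := y.2; rw [Fin.lt_def] at hxy; omega⟩, rfl⟩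
  have hzy : hi i ≤ y := hxy
  have hci := color_convex (lo_lt_hi i).le hzy hct
  have hlt : d (lo i) < d (hi i) := hd.2 _ _ (lo_lt_hi i) hci.symm
  have hcd : color ℓ r (d (hi i)) = color ℓ r (d (lo i)) := by
    refine color_convex hlt.le ?_ hcr
    rcases hzy.lt_or_eq with h | h
    · exact (hd.2 _ _ h (hci.trans hct)).le
    · rw [h]
  obtain ⟨j, hj₁⟩ : ∃ j : Fin (ℓ - 1), d (lo i) = lo j :=
    ⟨⟨d (lo i), by have := (d (hi i)).2; rw [Fin.lt_def] at hlt; omega⟩, rfl⟩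
  have hinv : ∀ x, d⁻¹ (d x) = x := d.symm_apply_apply
  -- The images are adjacent as well: the preimage of a letter strictly between them would lie
  -- strictly between `i` and `i+1`, since `d⁻¹` is increasing on a colour class.
  have hj₂ : d (hi i) = hi j := by
    by_contra hne'
    have h₁ : hi j < d (hi i) :=
      lt_of_le_of_ne (show (hi j).val ≤ _ from by
        rw [hj₁, Fin.lt_def] at hlt; exact hlt) (Ne.symm hne')
    have h₂ := color_convex (r := r) (lo_lt_hi j).le h₁.le (by rw [← hj₁]; exact hcd.symm)
    have h₃ := hd.1 _ _ (lo_lt_hi j) h₂.symm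
    have h₄ := hd.1 _ _ h₁ (by rw [h₂, hcd, hj₁])
    rw [hinv] at h₄
    rw [← hj₁, hinv] at h₃
    simp only [Fin.lt_def, lo, hi] at h₃ h₄
    omega
  have hcomm : d * simpleRefl ℓ i = simpleRefl ℓ j * d := by
    have : simpleRefl ℓ j = Equiv.swap (d (lo i)) (d (hi i)) := by rw [hj₁, hj₂]; rfl
    rw [this]
    exact Equiv.mul_swap_eq_swap_mul d _ _
  have hT : T q d * gen q ℓ i = gen q ℓ j * T q d := by
    rw [T_mul_gen_of_lt hlt, gen_mul_T_of_lt, hcomm]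
    rw [← hj₁, ← hj₂, hinv, hinv]
    exact lo_lt_hi i
  have e₁ : eps q ℓ r * (T q d * gen q ℓ i) * eps q ℓ t =
      chi q (color ℓ r (d (lo i))) • (eps q ℓ r * T q d * eps q ℓ t) := by
    rw [hT, ← mul_assoc, eps_mul_gen hq0 hr (by rw [← hj₁, ← hj₂, hcd]), smul_mul_assoc,
      smul_mul_assoc, hj₁]
  have e₂ : eps q ℓ r * (T q d * gen q ℓ i) * eps q ℓ t =
      chi q (color ℓ t (lo i)) • (eps q ℓ r * T q d * eps q ℓ t) := by
    rw [mul_assoc, mul_assoc, gen_mul_eps hq0 ht hci.symm, mul_smul_comm, mul_smul_comm, mul_assoc]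
  have h4 := e₁.symm.trans e₂
  rw [← sub_eq_zero, ← sub_smul] at h4
  exact (smul_eq_zero.mp h4).resolve_left
    (sub_ne_zero.mpr (chi_injective (q_add_one_ne_zero hℓ hq) hne))

/-- The positions of colour `b` which are moved by `d` to a letter of the other colour. -/
def mismatches (ℓ r t : ℕ) (d : Equiv.Perm (Fin ℓ)) (b : Bool) : Finset (Fin ℓ) :=
  {x | color ℓ t x = b ∧ color ℓ r (d x) = !b}

theorem mem_mismatches {d : Equiv.Perm (Fin ℓ)} {b : Bool} {x : Fin ℓ} :
    x ∈ mismatches ℓ r t d b ↔ color ℓ t x = b ∧ color ℓ r (d x) = !b := by simp [mismatches]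

/-- A distinguished double coset representative `d` with `ε_r T_d ε_t ≠ 0`. -/
def IsHomRep (q : K) (ℓ r t : ℕ) (d : Equiv.Perm (Fin ℓ)) : Prop :=
  d ∈ doubleReps ℓ (firstPart ℓ r) (firstPart ℓ t) ∧ eps q ℓ r * T q d * eps q ℓ t ≠ 0

namespace IsHomRep

variable {d d' : Equiv.Perm (Fin ℓ)}

theorem not_lt (hℓ : 3 ≤ ℓ) (hq : IsPrimitiveRoot q ℓ) (hr : r ≤ ℓ) (ht : t ≤ ℓ)
    (hd : IsHomRep q ℓ r t d) {b : Bool} {x y : Fin ℓ} (hx : x ∈ mismatches ℓ r t d b)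
    (hy : y ∈ mismatches ℓ r t d b) : ¬ x < y := by
  intro hxy
  rw [mem_mismatches] at hx hy
  refine hd.2 (eps_mul_T_mul_eps_eq_zero hℓ hq hr ht hd.1 hxy (hx.1.trans hy.1.symm)
    (hx.2.trans hy.2.symm) ?_)
  rw [hx.1, hx.2]
  simp

theorem card_mismatches_le (hℓ : 3 ≤ ℓ) (hq : IsPrimitiveRoot q ℓ) (hr : r ≤ ℓ) (ht : t ≤ ℓ)
    (hd : IsHomRep q ℓ r t d) (b : Bool) : (mismatches ℓ r t d b).card ≤ 1 := by
  rw [Finset.card_le_one]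
  intro x hx y hy
  exact le_antisymm (le_of_not_gt (hd.not_lt hℓ hq hr ht hy hx))
    (le_of_not_gt (hd.not_lt hℓ hq hr ht hx hy))

/-- The positions alternating both for `t` and, after applying `d`, for `r` are counted in two ways.
-/
theorem card_add (hr : r ≤ ℓ) (ht : t ≤ ℓ) (d : Equiv.Perm (Fin ℓ)) :
    r + (mismatches ℓ r t d true).card = t + (mismatches ℓ r t d false).card := by
  have h₁ : (Finset.univ.filter fun x => color ℓ r (d x) = true).card = r := by
    conv_rhs => rw [← card_color hr]
    refine Finset.card_bij (fun x _ => d x) (by simp) (by simp) ?_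
    intro y hy
    exact ⟨d.symm y, by simpa using hy, by simp⟩
  have h₂ : (Finset.univ.filter fun x => color ℓ t x = true).card = t := card_color ht
  have h₃ := Finset.card_filter_add_card_filter_not (s := Finset.univ.filter fun x =>
    color ℓ r (d x) = true) (fun x => color ℓ t x = true)
  have h₄ := Finset.card_filter_add_card_filter_not (s := Finset.univ.filter fun x =>
    color ℓ t x = true) (fun x => color ℓ r (d x) = true)
  rw [Finset.filter_filter, Finset.filter_filter] at h₃ h₄
  have h₅ : (Finset.univ.filter fun x => color ℓ r (d x) = true ∧ ¬ color ℓ t x = true) =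
      mismatches ℓ r t d false := by
    ext x
    simp [mem_mismatches, and_comm]
  have h₆ : (Finset.univ.filter fun x => color ℓ t x = true ∧ ¬ color ℓ r (d x) = true) =
      mismatches ℓ r t d true := by
    ext x
    simp [mem_mismatches]
  have h₇ : (Finset.univ.filter fun x => color ℓ r (d x) = true ∧ color ℓ t x = true) =
      (Finset.univ.filter fun x => color ℓ t x = true ∧ color ℓ r (d x) = true) := by
    simp only [and_comm]
  rw [h₅, h₁, h₇] at h₃
  rw [h₆, h₂] at h₄
  omega

/-- Mismatches of two different representatives sit at the same position. Both maps are increasing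
on `x < y`, so by `color_direction` either `y` is a second mismatch of `d` or `x` is a second
mismatch of `d'`, and neither can happen. -/
theorem not_lt_of_mem (hℓ : 3 ≤ ℓ) (hq : IsPrimitiveRoot q ℓ) (hr : r ≤ ℓ) (ht : t ≤ ℓ)
    (hd : IsHomRep q ℓ r t d) (hd' : IsHomRep q ℓ r t d') {b : Bool} {x y : Fin ℓ}
    (hx : x ∈ mismatches ℓ r t d b) (hy : y ∈ mismatches ℓ r t d' b) : ¬ x < y := by
  intro hxy
  have hx' := mem_mismatches.mp hx
  have hy' := mem_mismatches.mp hy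
  have hc := hx'.1.trans hy'.1.symm
  have h₁ := ((mem_doubleReps hr ht).mp hd.1).2 _ _ hxy hc
  have h₂ := ((mem_doubleReps hr ht).mp hd'.1).2 _ _ hxy hc
  rcases color_direction (r := r) h₁ h₂ (hx'.2.trans hy'.2.symm) with h | h
  · exact hd.not_lt hℓ hq hr ht hx (mem_mismatches.mpr ⟨hy'.1, h.trans hx'.2⟩) hxy
  · exact hd'.not_lt hℓ hq hr ht (mem_mismatches.mpr ⟨hx'.1, h.trans hx'.2⟩) hy hxy

/-- The number of mismatches of one colour fixes that of the other by `card_add`; positions of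
mismatches do not depend on the representative, so the colour pattern, and hence the coset, is
determined. -/
theorem eq_of_card_eq (hℓ : 3 ≤ ℓ) (hq : IsPrimitiveRoot q ℓ) (hr : r ≤ ℓ) (ht : t ≤ ℓ)
    (hd : IsHomRep q ℓ r t d) (hd' : IsHomRep q ℓ r t d')
    (h : (mismatches ℓ r t d false).card = (mismatches ℓ r t d' false).card) : d = d' := by
  have hcard : ∀ b, (mismatches ℓ r t d b).card = (mismatches ℓ r t d' b).card := by
    intro b
    cases b with
    | false => exact h
    | true =>
      have h₁ := card_add hr ht d
      have h₂ := card_add hr ht d'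
      omega
  have key : ∀ d d' : Equiv.Perm (Fin ℓ), IsHomRep q ℓ r t d → IsHomRep q ℓ r t d' →
      (∀ b, (mismatches ℓ r t d b).card = (mismatches ℓ r t d' b).card) →
      ∀ b x, x ∈ mismatches ℓ r t d b → x ∈ mismatches ℓ r t d' b := by
    intro d d' hd hd' hcard b x hx
    obtain ⟨y, hy⟩ := Finset.card_pos.mp (hcard b ▸ Finset.card_pos.mpr ⟨x, hx⟩)
    have hxy : x = y := le_antisymm (le_of_not_gt (not_lt_of_mem hℓ hq hr ht hd' hd hy hx))
      (le_of_not_gt (not_lt_of_mem hℓ hq hr ht hd hd' hx hy))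
    exact hxy ▸ hy
  refine eq_of_color_eq hr hd.1.1 hd'.1.1 fun x => ?_
  have h₁ := key d d' hd hd' hcard (color ℓ t x) x
  have h₂ := key d' d hd' hd (fun b => (hcard b).symm) (color ℓ t x) x
  simp only [mem_mismatches, true_and] at h₁ h₂
  revert h₁ h₂
  cases color ℓ t x <;> cases color ℓ r (d x) <;> cases color ℓ r (d' x) <;> simp

end IsHomRep

/-- The difference `r - t` equals a difference of two mismatch numbers, each at most one. -/
theorem eps_mul_mul_eps_eq_zero (hℓ : 3 ≤ ℓ) (hq : IsPrimitiveRoot q ℓ) (hr : r ≤ ℓ) (ht : t ≤ ℓ)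
    (hrt : r + 2 ≤ t ∨ t + 2 ≤ r) (h : Hecke q ℓ) : eps q ℓ r * h * eps q ℓ t = 0 := by
  rw [← Submodule.mem_bot K]
  refine eps_mul_mul_eps_mem (q_ne_zero hℓ hq) hr ht (fun d hd h0 => ?_) h
  have hd' : IsHomRep q ℓ r t d := ⟨hd, h0⟩
  have h₁ := hd'.card_mismatches_le hℓ hq hr ht true
  have h₂ := hd'.card_mismatches_le hℓ hq hr ht false
  have h₃ := IsHomRep.card_add hr ht d
  omega

theorem IsHomRep.unique (hℓ : 3 ≤ ℓ) (hq : IsPrimitiveRoot q ℓ) (hr : r ≤ ℓ) (ht : t ≤ ℓ)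
    (hrt : t = r + 1 ∨ r = t + 1) {d d' : Equiv.Perm (Fin ℓ)} (hd : IsHomRep q ℓ r t d)
    (hd' : IsHomRep q ℓ r t d') : d = d' := by
  apply hd.eq_of_card_eq hℓ hq hr ht hd'
  have h₁ := hd.card_mismatches_le hℓ hq hr ht true
  have h₂ := hd.card_mismatches_le hℓ hq hr ht false
  have h₃ := IsHomRep.card_add hr ht d
  have h₁' := hd'.card_mismatches_le hℓ hq hr ht true
  have h₂' := hd'.card_mismatches_le hℓ hq hr ht false
  have h₃' := IsHomRep.card_add hr ht d'
  omega

theorem eps_mul_mul_eps_mem_span (hℓ : 3 ≤ ℓ) (hq : IsPrimitiveRoot q ℓ) (hr : r ≤ ℓ) (ht : t ≤ ℓ)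
    (hrt : t = r + 1 ∨ r = t + 1) {d : Equiv.Perm (Fin ℓ)} (hd : IsHomRep q ℓ r t d)
    (h : Hecke q ℓ) :
    eps q ℓ r * h * eps q ℓ t ∈ Submodule.span K {eps q ℓ r * T q d * eps q ℓ t} := by
  refine eps_mul_mul_eps_mem (q_ne_zero hℓ hq) hr ht (fun d' hd' h0 => ?_) h
  rw [IsHomRep.unique hℓ hq hr ht hrt ⟨hd', h0⟩ hd]
  exact Submodule.mem_span_singleton_self _

theorem exists_isHomRep (hℓ : 3 ≤ ℓ) (hq : IsPrimitiveRoot q ℓ) (hr : r ≤ ℓ) (ht : t ≤ ℓ)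
    {h : Hecke q ℓ} (hh : eps q ℓ r * h * eps q ℓ t ≠ 0) : ∃ d, IsHomRep q ℓ r t d := by
  by_contra! hcon
  refine hh ?_
  rw [← Submodule.mem_bot K]
  exact eps_mul_mul_eps_mem (q_ne_zero hℓ hq) hr ht (fun d hd h0 => (hcon d ⟨hd, h0⟩).elim) h

/-- For `r = t` the two mismatch numbers agree: both are 0, which forces `d = 1`, or both are 1,
which leaves at most one `d`. The unspecified `z` is later replaced by `ω_r`. -/
theorem exists_eps_mul_mul_eps_self_mem_span (hℓ : 3 ≤ ℓ) (hq : IsPrimitiveRoot q ℓ) (hr : 1 ≤ r)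
    (hr' : r ≤ ℓ - 1) : ∃ z : Hecke q ℓ, ∀ h : Hecke q ℓ,
      eps q ℓ r * h * eps q ℓ r ∈ Submodule.span K {eps q ℓ r, z} := by
  have hrℓ : r ≤ ℓ := by omega
  have hone : ∀ d, IsHomRep q ℓ r r d → (mismatches ℓ r r d false).card = 0 → d = 1 := by
    intro d hd h
    have h₁ := IsHomRep.card_add hrℓ hrℓ d
    refine eq_of_color_eq hrℓ hd.1.1 ?_ fun x => ?_
    · rw [mem_rightReps hrℓ]
      intro x y hxy _
      simpa using hxy
    · have h₂ : ∀ b, x ∉ mismatches ℓ r r d b := fun b => by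
        have : (mismatches ℓ r r d b).card = 0 := by cases b <;> omega
        rw [Finset.card_eq_zero.mp this]
        simp
      have := h₂ (color ℓ r x)
      simpa [mem_mismatches] using this
  by_cases hex : ∃ d, IsHomRep q ℓ r r d ∧ (mismatches ℓ r r d false).card = 1
  · obtain ⟨d, hd, hcd⟩ := hex
    refine ⟨eps q ℓ r * T q d * eps q ℓ r, eps_mul_mul_eps_mem (q_ne_zero hℓ hq) hrℓ hrℓ ?_⟩
    intro d' hd' h0
    have h₂ := IsHomRep.card_mismatches_le hℓ hq hrℓ hrℓ ⟨hd', h0⟩ false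
    by_cases h₁ : (mismatches ℓ r r d' false).card = 1
    · rw [IsHomRep.eq_of_card_eq hℓ hq hrℓ hrℓ ⟨hd', h0⟩ hd (h₁.trans hcd.symm)]
      exact Submodule.subset_span (by simp)
    · rw [hone d' ⟨hd', h0⟩ (by omega), T_one, mul_one, eps_mul_self hℓ hq hr hr']
      exact Submodule.subset_span (by simp)
  · refine ⟨0, eps_mul_mul_eps_mem (q_ne_zero hℓ hq) hrℓ hrℓ ?_⟩
    intro d' hd' h0
    have h₂ := IsHomRep.card_mismatches_le hℓ hq hrℓ hrℓ ⟨hd', h0⟩ false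
    have h₁ : (mismatches ℓ r r d' false).card ≠ 1 := fun h => hex ⟨d', ⟨hd', h0⟩, h⟩
    rw [hone d' ⟨hd', h0⟩ (by omega), T_one, mul_one, eps_mul_self hℓ hq hr hr']
    exact Submodule.subset_span (by simp)

end Spanning

end HeckeBlock

end

noncomputable section

namespace HeckeBlock

/-! ### The fermionic module -/

section Words

variable {K : Type*} [Field K] {q : K} {n : ℕ}

/-- The diagonal coefficients of a generator on words in two letters. -/
def diagCoeff (q : K) : Bool → Bool → K
  | false, false => q
  | true, true => -1
  | false, true => 0
  | true, false => q - 1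

/-- The off-diagonal coefficients of a generator on words in two letters. -/
def offCoeff (q : K) : Bool → Bool → K
  | true, false => 1
  | false, true => q
  | _, _ => 0

/-- The operator of a generator on functions on words. -/
def heckeOp (q : K) (n : ℕ) (i : Fin (n - 1)) : Module.End K ((Fin n → Bool) → K) where
  toFun φ f := diagCoeff q (f (lo i)) (f (hi i)) * φ f +
    offCoeff q (f (lo i)) (f (hi i)) * φ (f ∘ simpleRefl n i)
  map_add' φ ψ := by ext f; simp only [Pi.add_apply]; ring
  map_smul' c φ := by ext f; simp only [Pi.smul_apply, smul_eq_mul, RingHom.id_apply]; ring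

theorem heckeOp_apply (i : Fin (n - 1)) (φ : (Fin n → Bool) → K) (f : Fin n → Bool) :
    heckeOp q n i φ f = diagCoeff q (f (lo i)) (f (hi i)) * φ f +
      offCoeff q (f (lo i)) (f (hi i)) * φ (f ∘ simpleRefl n i) := rfl

theorem comp_simpleRefl_comp (f : Fin n → Bool) (i : Fin (n - 1)) :
    (f ∘ simpleRefl n i) ∘ simpleRefl n i = f := by
  funext x
  simp [simpleRefl_apply_self]

theorem heckeOp_quad (i : Fin (n - 1)) :
    heckeOp q n i * heckeOp q n i =
      (q - 1) • heckeOp q n i + algebraMap K (Module.End K ((Fin n → Bool) → K)) q := by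
  refine LinearMap.ext fun φ => ?_
  funext f
  simp only [Module.End.mul_apply, LinearMap.add_apply, LinearMap.smul_apply, Pi.add_apply,
    Pi.smul_apply, Module.algebraMap_end_apply, heckeOp_apply, Function.comp_apply, simpleRefl_lo,
    simpleRefl_hi, comp_simpleRefl_comp, smul_eq_mul]
  cases f (lo i) <;> cases f (hi i) <;> simp only [diagCoeff, offCoeff] <;> ring

theorem heckeOp_comm {i j : Fin (n - 1)} (h : i.val + 2 ≤ j.val) :
    heckeOp q n i * heckeOp q n j = heckeOp q n j * heckeOp q n i := by
  refine LinearMap.ext fun φ => ?_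
  funext f
  have h₁ : simpleRefl n i (lo j) = lo j := by
    apply simpleRefl_of_ne <;> simp only [lo, hi, ne_eq, Fin.mk.injEq] <;> omega
  have h₂ : simpleRefl n i (hi j) = hi j := by
    apply simpleRefl_of_ne <;> simp only [lo, hi, ne_eq, Fin.mk.injEq] <;> omega
  have h₃ : simpleRefl n j (lo i) = lo i := by
    apply simpleRefl_of_ne <;> simp only [lo, hi, ne_eq, Fin.mk.injEq] <;> omega
  have h₄ : simpleRefl n j (hi i) = hi i := by
    apply simpleRefl_of_ne <;> simp only [lo, hi, ne_eq, Fin.mk.injEq] <;> omega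
  have h₅ : (f ∘ simpleRefl n i) ∘ simpleRefl n j = (f ∘ simpleRefl n j) ∘ simpleRefl n i := by
    have := simpleRefl_comm (n := n) h
    rw [Function.comp_assoc, Function.comp_assoc, ← Equiv.Perm.coe_mul, this, Equiv.Perm.coe_mul]
  simp only [Module.End.mul_apply, heckeOp_apply, Function.comp_apply, h₁, h₂, h₃, h₄, h₅]
  ring

theorem comp_simpleRefl_of_eq {f : Fin n → Bool} {i : Fin (n - 1)} (h : f (lo i) = f (hi i)) :
    f ∘ simpleRefl n i = f := by
  funext x
  rw [Function.comp_apply]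
  by_cases h₁ : x = lo i
  · rw [h₁, simpleRefl_lo, h]
  by_cases h₂ : x = hi i
  · rw [h₂, simpleRefl_hi, h]
  rw [simpleRefl_of_ne i h₁ h₂]

theorem heckeOp_braid {i j : Fin (n - 1)} (h : j.val = i.val + 1) :
    heckeOp q n i * heckeOp q n j * heckeOp q n i =
      heckeOp q n j * heckeOp q n i * heckeOp q n j := by
  refine LinearMap.ext fun φ => ?_
  funext f
  have hlh := lo_eq_hi_of_succ h
  have s₁ : simpleRefl n i (hi j) = hi j :=
    simpleRefl_of_ne i (by simp [lo, hi]; omega) (by simp [hi]; omega)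
  have s₂ : simpleRefl n j (lo i) = lo i :=
    simpleRefl_of_ne j (by simp [lo]; omega) (by simp [lo, hi]; omega)
  have s₄ : simpleRefl n j (hi i) = hi j := by rw [← hlh, simpleRefl_lo]
  have s₅ : simpleRefl n j (hi j) = hi i := by rw [simpleRefl_hi, hlh]
  have h₅ : ((f ∘ simpleRefl n i) ∘ simpleRefl n j) ∘ simpleRefl n i =
      ((f ∘ simpleRefl n j) ∘ simpleRefl n i) ∘ simpleRefl n j := by
    have := simpleRefl_braid (n := n) h
    simp only [Function.comp_assoc, ← Equiv.Perm.coe_mul]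
    rw [this]
  -- Three positions carry only two letters, so some letters coincide. These identities between
  -- rearranged words are needed in the eight cases below.
  have e₁ : f (lo i) = f (hi i) → f ∘ simpleRefl n i = f := comp_simpleRefl_of_eq
  have e₂ : f (hi i) = f (hi j) → f ∘ simpleRefl n j = f := fun he =>
    comp_simpleRefl_of_eq (hlh ▸ he)
  have e₃ : f (lo i) = f (hi j) →
      (f ∘ simpleRefl n i) ∘ simpleRefl n j = f ∘ simpleRefl n i := fun he => by
    apply comp_simpleRefl_of_eq
    rw [Function.comp_apply, Function.comp_apply, hlh, simpleRefl_hi, s₁, he]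
  have e₄ : f (lo i) = f (hi j) →
      (f ∘ simpleRefl n j) ∘ simpleRefl n i = f ∘ simpleRefl n j := fun he => by
    apply comp_simpleRefl_of_eq
    rw [Function.comp_apply, Function.comp_apply, s₂, s₄, he]
  simp only [Module.End.mul_apply, heckeOp_apply, Function.comp_apply, hlh, s₁, s₂, s₄, s₅,
    simpleRefl_lo, simpleRefl_hi, h₅, comp_simpleRefl_comp]
  generalize φ (((f ∘ simpleRefl n j) ∘ simpleRefl n i) ∘ simpleRefl n j) = p at *
  revert e₁ e₂ e₃ e₄
  cases f (lo i) <;> cases f (hi i) <;> cases f (hi j) <;> intro e₁ e₂ e₃ e₄ <;>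
    simp only [diagCoeff, offCoeff, forall_const, reduceCtorEq, false_imp_iff] at * <;>
    simp only [e₁, e₂, e₃, e₄] <;> ring

/-- The right action of the Hecke algebra on functions on words, as an algebra homomorphism. -/
def wordHom (q : K) (n : ℕ) : Hecke q n →ₐ[K] (Module.End K ((Fin n → Bool) → K))ᵐᵒᵖ :=
  heckeLift (fun i => MulOpposite.op (heckeOp q n i))
    (fun i j h => by
      simp only [← MulOpposite.op_mul]
      rw [← mul_assoc, ← mul_assoc, heckeOp_braid h])
    (fun i j h => by simp only [← MulOpposite.op_mul, heckeOp_comm h])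
    (fun i => by
      rw [← MulOpposite.op_mul, heckeOp_quad, MulOpposite.op_add, MulOpposite.op_smul]
      rfl)

/-- The right action of the Hecke algebra on functions on words. -/
def act (q : K) (n : ℕ) : ((Fin n → Bool) → K) →ₗ[K] Hecke q n →ₗ[K] ((Fin n → Bool) → K) :=
  LinearMap.mk₂ K (fun φ h => (wordHom q n h).unop φ) (by simp) (by simp) (by simp) (by simp)

theorem act_one (φ : (Fin n → Bool) → K) : act q n φ 1 = φ := by simp [act]

theorem act_mul (φ : (Fin n → Bool) → K) (g h : Hecke q n) :
    act q n (act q n φ g) h = act q n φ (g * h) := by simp [act]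

theorem act_gen (φ : (Fin n → Bool) → K) (i : Fin (n - 1)) :
    act q n φ (gen q n i) = heckeOp q n i φ := by simp [act, wordHom, heckeLift_gen]

theorem act_algebraMap (φ : (Fin n → Bool) → K) (c : K) :
    act q n φ (algebraMap K _ c) = c • φ := by
  rw [Algebra.algebraMap_eq_smul_one, map_smul, act_one]

theorem act_map {L : Module.End K ((Fin n → Bool) → K)} (hL : ∀ i, Commute L (heckeOp q n i))
    (φ : (Fin n → Bool) → K) (h : Hecke q n) : act q n (L φ) h = L (act q n φ h) := by
  refine hecke_induction (p := fun h => ∀ φ, act q n (L φ) h = L (act q n φ h)) h ?_ ?_ ?_ ?_ φ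
  · intro a φ
    rw [act_algebraMap, act_algebraMap, map_smul]
  · intro i φ
    rw [act_gen, act_gen, ← Module.End.mul_apply, ← Module.End.mul_apply, (hL i).eq]
  · intro a b ha hb φ
    rw [map_add, map_add, ha, hb, map_add]
  · intro a b ha hb φ
    rw [← act_mul, ← act_mul, ha, hb]

/-! ### Creation and annihilation operators -/

/-- The sign attached to a letter. -/
def letterSign (K : Type*) [Field K] (b : Bool) : K := if b then -1 else 1

/-- The Jordan-Wigner sign. -/
def jwSign (K : Type*) [Field K] (f : Fin n → Bool) (j : Fin n) : K :=
  ∏ k ∈ Finset.Iio j, letterSign K (f k)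

theorem jwSign_update_of_le {f : Fin n → Bool} {i j : Fin n} (h : j ≤ i) (b : Bool) :
    jwSign K (Function.update f i b) j = jwSign K f j := by
  refine Finset.prod_congr rfl fun k hk => ?_
  rw [Function.update_of_ne]
  exact ((Finset.mem_Iio.mp hk).trans_le h).ne

theorem jwSign_update_of_lt {f : Fin n → Bool} {i j : Fin n} (h : i < j) {b : Bool}
    (hb : f i = !b) : jwSign K (Function.update f i b) j = -jwSign K f j := by
  rw [jwSign, jwSign, ← Finset.mul_prod_erase _ _ (Finset.mem_Iio.mpr h),
    ← Finset.mul_prod_erase _ _ (Finset.mem_Iio.mpr h), Function.update_self, hb, ← neg_mul]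
  congr 1
  · cases b <;> simp [letterSign]
  · refine Finset.prod_congr rfl fun k hk => ?_
    rw [Function.update_of_ne (Finset.ne_of_mem_erase hk)]

theorem jwSign_mul_self (f : Fin n → Bool) (j : Fin n) : jwSign K f j * jwSign K f j = 1 := by
  rw [jwSign, ← Finset.prod_mul_distrib]
  refine Finset.prod_eq_one fun k _ => ?_
  cases f k <;> simp [letterSign]

/-- The sign sees only the collection of letters before `j`, and `s_i` preserves that set of
positions unless `j` separates the two moved ones. -/
theorem jwSign_comp {f : Fin n → Bool} {i : Fin (n - 1)} {j : Fin n} (h : j ≠ hi i) :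
    jwSign K (f ∘ simpleRefl n i) j = jwSign K f j := by
  refine Finset.prod_equiv (simpleRefl n i) (fun k => ?_) fun k _ => rfl
  simp only [Finset.mem_Iio, Fin.lt_def, simpleRefl_val, hi, ne_eq, Fin.ext_iff] at *
  split_ifs <;> omega

theorem jwSign_hi (f : Fin n → Bool) (i : Fin (n - 1)) :
    jwSign K f (hi i) = jwSign K f (lo i) * letterSign K (f (lo i)) := by
  have : Finset.Iio (hi i) = insert (lo i) (Finset.Iio (lo i)) := by
    ext k
    simp only [Finset.mem_insert, Finset.mem_Iio, Fin.lt_def, Fin.ext_iff, lo, hi]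
    omega
  rw [jwSign, this, Finset.prod_insert (by simp), mul_comm]
  rfl

/-- The creation operator at a position. -/
def creation (K : Type*) [Field K] (j : Fin n) : Module.End K ((Fin n → Bool) → K) where
  toFun φ f := if f j then jwSign K f j * φ (Function.update f j false) else 0
  map_add' φ ψ := by ext f; simp only [Pi.add_apply]; split_ifs <;> ring
  map_smul' c φ := by
    ext f; simp only [Pi.smul_apply, smul_eq_mul, RingHom.id_apply]; split_ifs <;> ring

/-- The annihilation operator at a position. -/
def annihilation (K : Type*) [Field K] (j : Fin n) : Module.End K ((Fin n → Bool) → K) where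
  toFun φ f := if f j then 0 else jwSign K f j * φ (Function.update f j true)
  map_add' φ ψ := by ext f; simp only [Pi.add_apply]; split_ifs <;> ring
  map_smul' c φ := by
    ext f; simp only [Pi.smul_apply, smul_eq_mul, RingHom.id_apply]; split_ifs <;> ring

theorem creation_apply (j : Fin n) (φ : (Fin n → Bool) → K) (f : Fin n → Bool) :
    creation K j φ f = if f j then jwSign K f j * φ (Function.update f j false) else 0 := rfl

theorem annihilation_apply (j : Fin n) (φ : (Fin n → Bool) → K) (f : Fin n → Bool) :
    annihilation K j φ f = if f j then 0 else jwSign K f j * φ (Function.update f j true) := rfl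

theorem creation_mul_self (j : Fin n) : creation K j * creation K j = 0 := by
  refine LinearMap.ext fun φ => ?_
  funext f
  simp [creation_apply]

theorem creation_anticomm {i j : Fin n} (hij : i ≠ j) :
    creation K i * creation K j + creation K j * creation K i = 0 := by
  have key : ∀ i j : Fin n, i < j →
      creation K i * creation K j + creation K j * creation K i = 0 := by
    intro i j h
    refine LinearMap.ext fun φ => ?_
    funext f
    simp only [LinearMap.add_apply, Module.End.mul_apply, Pi.add_apply, creation_apply,
      Function.update_of_ne h.ne, Function.update_of_ne h.ne', LinearMap.zero_apply, Pi.zero_apply]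
    by_cases hi : f i = true
    · by_cases hj : f j = true
      · simp only [hi, hj, if_true]
        rw [jwSign_update_of_lt h (by simp [hi]), jwSign_update_of_le h.le,
          Function.update_comm h.ne]
        ring
      · simp [hj]
    · simp [hi]
  rcases lt_or_gt_of_ne hij with h | h
  · exact key i j h
  · rw [add_comm]
    exact key j i h

theorem annihilation_creation_anticomm (i j : Fin n) :
    annihilation K i * creation K j + creation K j * annihilation K i = if i = j then 1 else 0 := by
  split_ifs with hij
  · subst hij
    refine LinearMap.ext fun φ => ?_
    funext f
    simp only [LinearMap.add_apply, Module.End.mul_apply, Pi.add_apply, creation_apply,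
      annihilation_apply, Function.update_self, Module.End.one_apply, if_true,
      Function.update_idem, Bool.false_eq_true, if_false, jwSign_update_of_le le_rfl]
    by_cases h : f i = true
    · have : Function.update f i true = f := by rw [← h, Function.update_eq_self]
      rw [if_pos h, if_pos h, this, ← mul_assoc, jwSign_mul_self]
      ring
    · have : Function.update f i false = f := by
        rw [← Bool.eq_false_of_not_eq_true h, Function.update_eq_self]
      rw [if_neg h, if_neg h, this, ← mul_assoc, jwSign_mul_self]
      ring
  · refine LinearMap.ext fun φ => ?_
    funext f
    simp only [LinearMap.add_apply, Module.End.mul_apply, Pi.add_apply, creation_apply,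
      annihilation_apply, Function.update_of_ne hij, Function.update_of_ne (Ne.symm hij),
      LinearMap.zero_apply, Pi.zero_apply]
    by_cases hi : f i = true
    · simp [hi]
    · by_cases hj : f j = true
      · have hi' : f i = !true := by simpa using hi
        simp only [hi, hj, if_true]
        rw [Function.update_comm hij]
        rcases lt_or_gt_of_ne hij with h | h
        · rw [jwSign_update_of_lt h hi', jwSign_update_of_le h.le]
          simp only [Bool.false_eq_true, if_false]
          ring
        · rw [jwSign_update_of_lt h (by simp [hj]), jwSign_update_of_le h.le]
          simp only [Bool.false_eq_true, if_false]
          ring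
      · simp [hj]

theorem update_comp_of_ne {f : Fin n → Bool} {i : Fin (n - 1)} {j : Fin n} (h₁ : j ≠ lo i)
    (h₂ : j ≠ hi i) (b : Bool) :
    Function.update f j b ∘ simpleRefl n i = Function.update (f ∘ simpleRefl n i) j b := by
  conv_lhs => rw [← simpleRefl_of_ne i h₁ h₂]
  exact Function.update_comp_eq_of_injective f (simpleRefl n i).injective j b

theorem creation_commute {i : Fin (n - 1)} {j : Fin n} (h₁ : j ≠ lo i) (h₂ : j ≠ hi i) :
    Commute (creation K j) (heckeOp q n i) := by
  refine LinearMap.ext fun φ => ?_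
  funext f
  simp only [Module.End.mul_apply, creation_apply, heckeOp_apply, Function.comp_apply,
    simpleRefl_of_ne i h₁ h₂, jwSign_comp h₂, update_comp_of_ne h₁ h₂,
    Function.update_of_ne h₁.symm, Function.update_of_ne h₂.symm]
  split_ifs <;> ring

theorem annihilation_commute {i : Fin (n - 1)} {j : Fin n} (h₁ : j ≠ lo i) (h₂ : j ≠ hi i) :
    Commute (annihilation K j) (heckeOp q n i) := by
  refine LinearMap.ext fun φ => ?_
  funext f
  simp only [Module.End.mul_apply, annihilation_apply, heckeOp_apply, Function.comp_apply,
    simpleRefl_of_ne i h₁ h₂, jwSign_comp h₂, update_comp_of_ne h₁ h₂,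
    Function.update_of_ne h₁.symm, Function.update_of_ne h₂.symm]
  split_ifs <;> ring

/-- Replace the two letters moved by a basic transposition. -/
def setPair (f : Fin n → Bool) (i : Fin (n - 1)) (x y : Bool) : Fin n → Bool :=
  Function.update (Function.update f (lo i) x) (hi i) y

section SetPair

variable (f : Fin n → Bool) (i : Fin (n - 1)) (x y : Bool)

theorem setPair_self : setPair f i (f (lo i)) (f (hi i)) = f := by
  rw [setPair, Function.update_eq_self, Function.update_eq_self]

theorem setPair_lo : setPair f i x y (lo i) = x := by
  rw [setPair, Function.update_of_ne (lo_lt_hi i).ne, Function.update_self]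

theorem setPair_hi : setPair f i x y (hi i) = y := by
  rw [setPair, Function.update_self]

theorem update_lo_setPair (b : Bool) :
    Function.update (setPair f i x y) (lo i) b = setPair f i b y := by
  rw [setPair, Function.update_comm (lo_lt_hi i).ne', Function.update_idem, setPair]

theorem update_hi_setPair (b : Bool) :
    Function.update (setPair f i x y) (hi i) b = setPair f i x b := by
  rw [setPair, Function.update_idem, setPair]

theorem setPair_comp : setPair f i x y ∘ simpleRefl n i = setPair f i y x := by
  funext k
  rw [Function.comp_apply]
  by_cases h₁ : k = lo i
  · rw [h₁, simpleRefl_lo, setPair_lo, setPair_hi]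
  by_cases h₂ : k = hi i
  · rw [h₂, simpleRefl_hi, setPair_lo, setPair_hi]
  rw [simpleRefl_of_ne i h₁ h₂, setPair, setPair, Function.update_of_ne h₂,
    Function.update_of_ne h₁, Function.update_of_ne h₂, Function.update_of_ne h₁]

theorem jwSign_lo_setPair : jwSign K (setPair f i x y) (lo i) = jwSign K f (lo i) := by
  rw [setPair, jwSign_update_of_le (lo_lt_hi i).le, jwSign_update_of_le le_rfl]

theorem jwSign_hi_setPair :
    jwSign K (setPair f i x y) (hi i) = jwSign K f (lo i) * letterSign K x := by
  rw [jwSign_hi, jwSign_lo_setPair, setPair_lo]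

end SetPair

/-- The sign from the letters to the left factors out, leaving a check on the two letters at `i` and
`i+1`. Neither creation operator need commute alone. -/
theorem creation_pair_commute (i : Fin (n - 1)) :
    Commute (creation K (lo i) + creation K (hi i)) (heckeOp q n i) := by
  refine LinearMap.ext fun φ => ?_
  funext f
  rw [← setPair_self f i]
  generalize f (lo i) = x
  generalize f (hi i) = y
  simp only [Module.End.mul_apply, LinearMap.add_apply, Pi.add_apply, creation_apply,
    heckeOp_apply, setPair_lo, setPair_hi, update_lo_setPair, update_hi_setPair, setPair_comp,
    jwSign_lo_setPair, jwSign_hi_setPair]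
  cases x <;> cases y <;> simp [diagCoeff, offCoeff, letterSign] <;> ring

/-- The relative weight `q⁻¹` of the two positions is the source of the weights in `lowering`. -/
theorem annihilation_pair_commute (hq0 : q ≠ 0) (i : Fin (n - 1)) :
    Commute (annihilation K (lo i) + q⁻¹ • annihilation K (hi i)) (heckeOp q n i) := by
  refine LinearMap.ext fun φ => ?_
  funext f
  rw [← setPair_self f i]
  generalize f (lo i) = x
  generalize f (hi i) = y
  simp only [Module.End.mul_apply, LinearMap.add_apply, Pi.add_apply, annihilation_apply,
    LinearMap.smul_apply, Pi.smul_apply, smul_eq_mul,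
    heckeOp_apply, setPair_lo, setPair_hi, update_lo_setPair, update_hi_setPair, setPair_comp,
    jwSign_lo_setPair, jwSign_hi_setPair]
  cases x <;> cases y <;> simp [diagCoeff, offCoeff, letterSign] <;> field_simp <;> ring

/-- The raising operator. -/
def raising (K : Type*) [Field K] (n : ℕ) : Module.End K ((Fin n → Bool) → K) :=
  ∑ j, creation K j

/-- The lowering operator. -/
def lowering (q : K) (n : ℕ) : Module.End K ((Fin n → Bool) → K) :=
  ∑ j : Fin n, q⁻¹ ^ j.val • annihilation K j

theorem sum_eq_pair_add {M : Type*} [AddCommMonoid M] (g : Fin n → M) (i : Fin (n - 1)) :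
    ∑ j, g j = (g (lo i) + g (hi i)) + ∑ j ∈ (Finset.univ.erase (lo i)).erase (hi i), g j := by
  rw [← Finset.add_sum_erase _ g (Finset.mem_univ (lo i)),
    ← Finset.add_sum_erase (Finset.univ.erase (lo i)) g
      (Finset.mem_erase.mpr ⟨(lo_lt_hi i).ne', Finset.mem_univ (hi i)⟩), add_assoc]

theorem raising_commute (i : Fin (n - 1)) : Commute (raising K n) (heckeOp q n i) := by
  rw [raising, sum_eq_pair_add _ i]
  refine (creation_pair_commute i).add_left (Commute.sum_left _ _ _ fun j hj => ?_)
  simp only [Finset.mem_erase] at hj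
  exact creation_commute hj.2.1 hj.1

theorem lowering_commute (hq0 : q ≠ 0) (i : Fin (n - 1)) :
    Commute (lowering q n) (heckeOp q n i) := by
  rw [lowering, sum_eq_pair_add _ i]
  refine Commute.add_left ?_ (Commute.sum_left _ _ _ fun j hj => ?_)
  · have : q⁻¹ ^ (lo i).val • annihilation K (lo i) + q⁻¹ ^ (hi i).val • annihilation K (hi i) =
        q⁻¹ ^ i.val • (annihilation K (lo i) + q⁻¹ • annihilation K (hi i)) := by
      rw [smul_add, smul_smul, ← pow_succ]
      rfl
    rw [this]
    exact (annihilation_pair_commute hq0 i).smul_left _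
  · simp only [Finset.mem_erase] at hj
    exact (annihilation_commute hj.2.1 hj.1).smul_left _

theorem creation_raising (i : Fin n) :
    creation K i * raising K n + raising K n * creation K i = 0 := by
  rw [raising, Finset.mul_sum, Finset.sum_mul, ← Finset.sum_add_distrib]
  refine Finset.sum_eq_zero fun j _ => ?_
  by_cases h : i = j
  · rw [h, creation_mul_self, add_zero]
  · exact creation_anticomm h

theorem annihilation_raising (i : Fin n) :
    annihilation K i * raising K n + raising K n * annihilation K i = 1 := by
  rw [raising, Finset.mul_sum, Finset.sum_mul, ← Finset.sum_add_distrib]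
  simp_rw [annihilation_creation_anticomm]
  simp

theorem lowering_creation (j : Fin n) :
    lowering q n * creation K j + creation K j * lowering q n = q⁻¹ ^ j.val • 1 := by
  rw [lowering, Finset.mul_sum, Finset.sum_mul, ← Finset.sum_add_distrib]
  simp_rw [smul_mul_assoc, mul_smul_comm, ← smul_add, annihilation_creation_anticomm]
  simp

theorem raising_mul_self : raising K n * raising K n = 0 := by
  -- Summing the anticommutators directly would give only twice the square; induction over subsets
  -- works in characteristic two as well.
  have key : ∀ s : Finset (Fin n), (∑ j ∈ s, creation K j) * ∑ j ∈ s, creation K j = 0 := by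
    intro s
    induction s using Finset.induction_on with
    | empty => simp
    | insert i s hi ih =>
      rw [Finset.sum_insert hi, add_mul, mul_add, mul_add, ih, creation_mul_self, zero_add,
        add_zero, Finset.mul_sum, Finset.sum_mul, ← Finset.sum_add_distrib]
      refine Finset.sum_eq_zero fun j hj => creation_anticomm ?_
      rintro rfl
      exact hi hj
  exact key _

/-- The scalar is the quantum integer of `n` at `q⁻¹`, which vanishes when `n = ℓ`. -/
theorem lowering_raising :
    lowering q n * raising K n + raising K n * lowering q n =
      (∑ j ∈ Finset.range n, q⁻¹ ^ j) • 1 := by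
  rw [lowering, Finset.sum_mul, Finset.mul_sum, ← Finset.sum_add_distrib,
    ← Fin.sum_univ_eq_sum_range, Finset.sum_smul]
  refine Finset.sum_congr rfl fun j _ => ?_
  rw [smul_mul_assoc, mul_smul_comm, ← smul_add, annihilation_raising]

/-! ### The invariant form -/

/-- The weights of the invariant form. -/
def wordWeight (q : K) (f : Fin n → Bool) : K := ∏ j : Fin n, if f j then 1 else q ^ j.val

theorem wordWeight_ne_zero (hq0 : q ≠ 0) (f : Fin n → Bool) : wordWeight q f ≠ 0 := by
  refine Finset.prod_ne_zero_iff.mpr fun j _ => ?_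
  split_ifs
  · exact one_ne_zero
  · exact pow_ne_zero _ hq0

/-- Moving a symmetric letter one place to the right multiplies the weight by `q`, which balances
the off-diagonal coefficients `1` and `q` and makes every generator self-adjoint. -/
theorem wordWeight_comp (f : Fin n → Bool) (i : Fin (n - 1)) :
    wordWeight q (f ∘ simpleRefl n i) * offCoeff q (f (hi i)) (f (lo i)) =
      wordWeight q f * offCoeff q (f (lo i)) (f (hi i)) := by
  have key : ∀ g : Fin n → Bool, wordWeight q g = (if g (lo i) then 1 else q ^ i.val) *
      (if g (hi i) then 1 else q ^ (i.val + 1)) *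
      ∏ j ∈ (Finset.univ.erase (lo i)).erase (hi i), if g j then 1 else q ^ j.val := by
    intro g
    rw [wordWeight, ← Finset.mul_prod_erase _ _ (Finset.mem_univ (lo i)),
      ← Finset.mul_prod_erase (Finset.univ.erase (lo i)) _
      (Finset.mem_erase.mpr ⟨(lo_lt_hi i).ne', Finset.mem_univ (hi i)⟩), mul_assoc]
    rfl
  have hrest : ∏ j ∈ (Finset.univ.erase (lo i)).erase (hi i),
      (if (f ∘ simpleRefl n i) j then 1 else q ^ j.val) =
      ∏ j ∈ (Finset.univ.erase (lo i)).erase (hi i), if f j then 1 else q ^ j.val := by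
    refine Finset.prod_congr rfl fun j hj => ?_
    simp only [Finset.mem_erase] at hj
    rw [Function.comp_apply, simpleRefl_of_ne i hj.2.1 hj.1]
  rw [key, key, hrest]
  simp only [Function.comp_apply, simpleRefl_lo, simpleRefl_hi]
  cases f (lo i) <;> cases f (hi i) <;> simp [offCoeff] <;> ring

/-- The invariant form. -/
def pairing (q : K) (φ ψ : (Fin n → Bool) → K) : K := ∑ f, wordWeight q f * φ f * ψ f

theorem pairing_heckeOp (i : Fin (n - 1)) (φ ψ : (Fin n → Bool) → K) :
    pairing q (heckeOp q n i φ) ψ = pairing q φ (heckeOp q n i ψ) := by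
  have key : ∑ f, wordWeight q f * offCoeff q (f (lo i)) (f (hi i)) * φ (f ∘ simpleRefl n i) * ψ f =
      ∑ f, wordWeight q f * offCoeff q (f (lo i)) (f (hi i)) * φ f * ψ (f ∘ simpleRefl n i) := by
    refine Finset.sum_nbij' (fun f => f ∘ simpleRefl n i) (fun f => f ∘ simpleRefl n i)
      (by simp) (by simp) (fun f _ => comp_simpleRefl_comp f i)
      (fun f _ => comp_simpleRefl_comp f i) fun f _ => ?_
    rw [comp_simpleRefl_comp, Function.comp_apply, Function.comp_apply, simpleRefl_lo,
      simpleRefl_hi, wordWeight_comp]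
  simp only [pairing, heckeOp_apply, mul_add, add_mul, Finset.sum_add_distrib]
  congr 1
  · refine Finset.sum_congr rfl fun f _ => ?_
    ring
  · calc _ = ∑ f, wordWeight q f * offCoeff q (f (lo i)) (f (hi i)) *
          φ (f ∘ simpleRefl n i) * ψ f := Finset.sum_congr rfl fun f _ => by ring
      _ = _ := key
      _ = _ := Finset.sum_congr rfl fun f _ => by ring

theorem pairing_add_left (φ φ' ψ : (Fin n → Bool) → K) :
    pairing q (φ + φ') ψ = pairing q φ ψ + pairing q φ' ψ := by
  simp only [pairing, Pi.add_apply, mul_add, add_mul, Finset.sum_add_distrib]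

theorem pairing_add_right (φ ψ ψ' : (Fin n → Bool) → K) :
    pairing q φ (ψ + ψ') = pairing q φ ψ + pairing q φ ψ' := by
  simp only [pairing, Pi.add_apply, mul_add, Finset.sum_add_distrib]

theorem pairing_smul (c : K) (φ ψ : (Fin n → Bool) → K) :
    pairing q (c • φ) ψ = pairing q φ (c • ψ) := by
  refine Finset.sum_congr rfl fun f _ => ?_
  simp only [Pi.smul_apply, smul_eq_mul]
  ring

theorem pairing_single (φ : (Fin n → Bool) → K) (f : Fin n → Bool) :
    pairing q φ (Pi.single f 1) = wordWeight q f * φ f := by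
  rw [pairing, Finset.sum_eq_single f]
  · simp
  · intro g _ h
    simp [h]
  · simp

theorem pairing_act (φ ψ : (Fin n → Bool) → K) (h : Hecke q n) :
    pairing q (act q n φ h) ψ = pairing q φ (act q n ψ (flip h)) := by
  refine hecke_induction (p := fun h => ∀ φ ψ : (Fin n → Bool) → K,
    pairing q (act q n φ h) ψ = pairing q φ (act q n ψ (flip h))) h ?_ ?_ ?_ ?_ φ ψ
  · intro a φ ψ
    rw [flip_algebraMap, act_algebraMap, act_algebraMap, pairing_smul]
  · intro i φ ψ
    rw [flip_gen, act_gen, act_gen, pairing_heckeOp]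
  · intro a b ha hb φ ψ
    rw [map_add, flip_add, map_add, pairing_add_left, pairing_add_right, ha, hb]
  · intro a b ha hb φ ψ
    rw [← act_mul, hb, ha, act_mul, flip_mul]

end Words

end HeckeBlock

end

noncomputable section

namespace HeckeBlock

/-! ### The cyclic generators of the fermionic module -/

section Degree

variable {K : Type*} [Field K] {q : K} {n r : ℕ}

/-- The number of alternating letters of a word. -/
def wordDeg (f : Fin n → Bool) : ℕ := (Finset.univ.filter fun x => f x = true).card

theorem wordDeg_comp (f : Fin n → Bool) (w : Equiv.Perm (Fin n)) : wordDeg (f ∘ w) = wordDeg f := by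
  refine Finset.card_bij (fun x _ => w x) (by simp) (by simp) fun y hy => ?_
  exact ⟨w.symm y, by simpa using hy, by simp⟩

theorem wordDeg_update_false {f : Fin n → Bool} {j : Fin n} (h : f j = true) :
    wordDeg (Function.update f j false) + 1 = wordDeg f := by
  have : (Finset.univ.filter fun x => Function.update f j false x = true) =
      (Finset.univ.filter fun x => f x = true).erase j := by
    ext x
    by_cases hx : x = j
    · simp [hx]
    · simp [hx]
  rw [wordDeg, wordDeg, this, Finset.card_erase_add_one (by simpa using h)]

theorem wordDeg_update_true {f : Fin n → Bool} {j : Fin n} (h : f j = false) :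
    wordDeg (Function.update f j true) = wordDeg f + 1 := by
  rw [← wordDeg_update_false (f := Function.update f j true) (j := j) (by simp),
    Function.update_idem, ← h, Function.update_eq_self]

/-- The functions supported on the words with a given number of alternating letters. -/
def degSpace (K : Type*) [Field K] (n r : ℕ) : Submodule K ((Fin n → Bool) → K) where
  carrier := {φ | ∀ f, φ f ≠ 0 → wordDeg f = r}
  zero_mem' := fun f h => (h rfl).elim
  add_mem' := fun {φ ψ} hφ hψ f h => by
    by_cases h0 : φ f = 0
    · exact hψ f fun h1 => h (by rw [Pi.add_apply, h0, h1, add_zero])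
    · exact hφ f h0
  smul_mem' := fun c φ hφ f h => hφ f fun h0 => h (by rw [Pi.smul_apply, h0, smul_zero])

theorem mem_degSpace {φ : (Fin n → Bool) → K} :
    φ ∈ degSpace K n r ↔ ∀ f, φ f ≠ 0 → wordDeg f = r := Iff.rfl

theorem single_mem_degSpace {f : Fin n → Bool} (h : wordDeg f = r) :
    Pi.single f (1 : K) ∈ degSpace K n r := by
  rw [mem_degSpace]
  intro g hg
  by_cases hgf : g = f
  · rw [hgf, h]
  · simp [hgf] at hg

theorem raising_mem_degSpace {φ : (Fin n → Bool) → K} (hφ : φ ∈ degSpace K n r) :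
    raising K n φ ∈ degSpace K n (r + 1) := by
  rw [raising, LinearMap.sum_apply]
  refine Submodule.sum_mem _ fun j _ f hf => ?_
  rw [creation_apply] at hf
  split_ifs at hf with h
  · rw [← wordDeg_update_false h, hφ _ (right_ne_zero_of_mul hf)]
  · exact (hf rfl).elim

theorem lowering_mem_degSpace {φ : (Fin n → Bool) → K} (hφ : φ ∈ degSpace K n (r + 1)) :
    lowering q n φ ∈ degSpace K n r := by
  rw [lowering, LinearMap.sum_apply]
  refine Submodule.sum_mem _ fun j _ => ?_
  rw [LinearMap.smul_apply]
  refine Submodule.smul_mem _ _ fun f hf => ?_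
  rw [annihilation_apply] at hf
  split_ifs at hf with h
  · exact (hf rfl).elim
  · have := hφ _ (right_ne_zero_of_mul hf)
    rw [wordDeg_update_true (by simpa using h)] at this
    omega

theorem heckeOp_mem_degSpace {φ : (Fin n → Bool) → K} (hφ : φ ∈ degSpace K n r)
    (i : Fin (n - 1)) : heckeOp q n i φ ∈ degSpace K n r := by
  intro f hf
  rw [heckeOp_apply] at hf
  by_cases h0 : φ f = 0
  · have h1 : φ (f ∘ simpleRefl n i) ≠ 0 := fun h1 => hf (by rw [h0, h1]; ring)
    rw [← hφ _ h1, wordDeg_comp]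
  · exact hφ f h0

theorem act_mem_degSpace {φ : (Fin n → Bool) → K} (hφ : φ ∈ degSpace K n r) (h : Hecke q n) :
    act q n φ h ∈ degSpace K n r := by
  refine hecke_induction (p := fun h => ∀ φ ∈ degSpace K n r, act q n φ h ∈ degSpace K n r)
    h ?_ ?_ ?_ ?_ φ hφ
  · intro a φ hφ
    rw [act_algebraMap]
    exact Submodule.smul_mem _ _ hφ
  · intro i φ hφ
    rw [act_gen]
    exact heckeOp_mem_degSpace hφ i
  · intro a b ha hb φ hφ
    rw [map_add]
    exact add_mem (ha φ hφ) (hb φ hφ)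
  · intro a b ha hb φ hφ
    rw [← act_mul]
    exact hb _ (ha φ hφ)

theorem heckeOp_single (f : Fin n → Bool) (i : Fin (n - 1)) :
    heckeOp q n i (Pi.single f 1) = diagCoeff q (f (lo i)) (f (hi i)) • Pi.single f (1 : K) +
      offCoeff q (f (hi i)) (f (lo i)) • Pi.single (f ∘ simpleRefl n i) (1 : K) := by
  funext g
  have hg : g ∘ simpleRefl n i = f ↔ g = f ∘ simpleRefl n i := by
    constructor
    · rintro rfl; rw [comp_simpleRefl_comp]
    · rintro rfl; rw [comp_simpleRefl_comp]
  rw [heckeOp_apply, Pi.add_apply, Pi.smul_apply, Pi.smul_apply]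
  simp only [Pi.single_apply, hg, smul_eq_mul, mul_ite, mul_one, mul_zero]
  congr 1
  · split_ifs with h
    · rw [h]
    · rfl
  · split_ifs with h
    · rw [h, Function.comp_apply, Function.comp_apply, simpleRefl_lo, simpleRefl_hi]
    · rfl

theorem heckeOp_single_of_eq {f : Fin n → Bool} {i : Fin (n - 1)} (h : f (lo i) = f (hi i)) :
    heckeOp q n i (Pi.single f 1) = chi q (f (lo i)) • Pi.single f (1 : K) := by
  rw [heckeOp_single, h]
  cases f (hi i) <;> simp [diagCoeff, offCoeff, chi]

theorem creation_single {f : Fin n → Bool} {j : Fin n} (h : f j = true) :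
    creation K j (Pi.single f 1) = 0 := by
  funext g
  rw [creation_apply]
  split_ifs with hg
  · have : Function.update g j false ≠ f := fun h' => by
      rw [← h', Function.update_self] at h
      exact absurd h (by simp)
    simp [this]
  · rfl

theorem annihilation_single {f : Fin n → Bool} {j : Fin n} (h : f j = false) :
    annihilation K j (Pi.single f 1) = 0 := by
  funext g
  rw [annihilation_apply]
  split_ifs with hg
  · rfl
  · have : Function.update g j true ≠ f := fun h' => by
      rw [← h', Function.update_self] at h
      exact absurd h (by simp)
    simp [this]

/-- Annihilation at `j` kills `f`, so by the anticommutation relation it sends the raised vector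
back to `f`. -/
theorem raising_single_ne_zero {f : Fin n → Bool} {j : Fin n} (h : f j = false) :
    raising K n (Pi.single f 1) ≠ 0 := by
  intro h0
  have := LinearMap.congr_fun (annihilation_raising (K := K) j) (Pi.single f 1)
  rw [LinearMap.add_apply, Module.End.mul_apply, Module.End.mul_apply, annihilation_single h, h0,
    map_zero, map_zero, add_zero, Module.End.one_apply] at this
  simpa using congrFun this f

theorem lowering_creation_apply (φ : (Fin n → Bool) → K) (j : Fin n) :
    lowering q n (creation K j φ) + creation K j (lowering q n φ) = q⁻¹ ^ j.val • φ :=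
  LinearMap.congr_fun (lowering_creation (q := q) j) φ

theorem lowering_single_ne_zero (hq0 : q ≠ 0) {f : Fin n → Bool} {j : Fin n} (h : f j = true) :
    lowering q n (Pi.single f 1) ≠ 0 := by
  intro h0
  have := lowering_creation_apply (q := q) (Pi.single f 1) j
  rw [creation_single h, h0, map_zero, map_zero, add_zero] at this
  exact smul_ne_zero (pow_ne_zero _ (inv_ne_zero hq0)) (by simp) this.symm

/-- Creation at `j` kills `f`, hence kills `E f` by anticommutation with `E`. If `F E f` vanished,
the anticommutator of `F` with creation at `j` would give `q⁻ʲ E f = 0`. -/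
theorem lowering_raising_single_ne_zero (hq0 : q ≠ 0) {f : Fin n → Bool} {i j : Fin n}
    (hi : f i = false) (hj : f j = true) : lowering q n (raising K n (Pi.single f 1)) ≠ 0 := by
  intro h0
  have h1 := lowering_creation_apply (q := q) (raising K n (Pi.single f 1)) j
  have h2 := LinearMap.congr_fun (creation_raising (K := K) j) (Pi.single f 1)
  rw [LinearMap.add_apply, Module.End.mul_apply, Module.End.mul_apply, creation_single hj,
    map_zero, add_zero, LinearMap.zero_apply] at h2
  rw [h0, h2, map_zero, map_zero, add_zero] at h1
  have h3 : q⁻¹ ^ j.val ≠ 0 := pow_ne_zero _ (inv_ne_zero hq0)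
  exact raising_single_ne_zero hi ((smul_eq_zero.mp h1.symm).resolve_left h3)

theorem exists_perm_comp {f g : Fin n → Bool} (h : wordDeg f = wordDeg g) :
    ∃ w : Equiv.Perm (Fin n), g ∘ w = f := by
  have hc : Fintype.card {x // f x = true} = Fintype.card {x // g x = true} := by
    rw [Fintype.card_subtype, Fintype.card_subtype]
    exact h
  refine ⟨(Fintype.equivOfCardEq hc).extendSubtype, funext fun x => ?_⟩
  rw [Function.comp_apply]
  by_cases hx : f x = true
  · rw [hx]
    exact Equiv.extendSubtype_mem (Fintype.equivOfCardEq hc) x hx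
  · rw [Bool.eq_false_of_not_eq_true hx]
    exact Bool.eq_false_of_not_eq_true 
      (Equiv.extendSubtype_not_mem (Fintype.equivOfCardEq hc) x hx)

/-- Words with equally many alternating letters are linked by adjacent swaps. A swap of distinct
letters is realised by a generator minus its diagonal part, divided by an off-diagonal coefficient
that is nonzero because `q ≠ 0`. -/
theorem exists_act_single_eq (hq0 : q ≠ 0) {f g : Fin n → Bool} (h : wordDeg f = wordDeg g) :
    ∃ x : Hecke q n, act q n (Pi.single g 1) x = Pi.single f 1 := by
  obtain ⟨w, rfl⟩ := exists_perm_comp h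
  obtain ⟨ω, rfl⟩ := exists_wordPerm n w
  clear h
  induction ω using List.reverseRecOn with
  | nil => exact ⟨1, act_one _⟩
  | append_singleton ω i ih =>
    obtain ⟨x, hx⟩ := ih
    have hw : wordPerm n (ω ++ [i]) = wordPerm n ω * simpleRefl n i := by simp [wordPerm]
    rw [hw, Equiv.Perm.coe_mul, ← Function.comp_assoc]
    generalize g ∘ wordPerm n ω = f at hx
    by_cases hf : f (lo i) = f (hi i)
    · exact ⟨x, by rw [comp_simpleRefl_of_eq hf, hx]⟩
    · have hb : offCoeff q (f (hi i)) (f (lo i)) ≠ 0 := by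
        revert hf
        cases f (lo i) <;> cases f (hi i) <;> simp [offCoeff, hq0]
      refine ⟨(offCoeff q (f (hi i)) (f (lo i)))⁻¹ •
        (x * gen q n i - diagCoeff q (f (lo i)) (f (hi i)) • x), ?_⟩
      rw [map_smul, map_sub, map_smul, ← act_mul, hx, act_gen, heckeOp_single, add_sub_cancel_left,
        smul_smul, inv_mul_cancel₀ hb, one_smul]

theorem exists_act_single_eq_of_mem (hq0 : q ≠ 0) {g : Fin n → Bool} {φ : (Fin n → Bool) → K}
    (h : φ ∈ degSpace K n (wordDeg g)) : ∃ x : Hecke q n, act q n (Pi.single g 1) x = φ := by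
  have hφ : φ = ∑ f, φ f • Pi.single f (1 : K) := by
    funext f
    simp [Finset.sum_apply, Pi.single_apply]
  have : ∀ f, ∃ x : Hecke q n, act q n (Pi.single g 1) x = φ f • Pi.single f (1 : K) := by
    intro f
    by_cases h0 : φ f = 0
    · exact ⟨0, by rw [h0, map_zero, zero_smul]⟩
    · obtain ⟨x, hx⟩ := exists_act_single_eq (q := q) hq0 (h f h0)
      exact ⟨φ f • x, by rw [map_smul, hx]⟩
  choose x hx using this
  exact ⟨∑ f, x f, by rw [map_sum, Finset.sum_congr rfl fun f _ => hx f, ← hφ]⟩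

end Degree

/-! ### Faithfulness of the vacuum and nondegeneracy of `ε_r H` -/

section Vacuum

variable {K : Type*} [Field K] {q : K} {ℓ r : ℕ}

/-- The vector on which `ε_r` acts as the identity. -/
def vac (K : Type*) [Field K] (ℓ r : ℕ) : (Fin ℓ → Bool) → K := Pi.single (color ℓ r) 1

theorem wordDeg_color (hr : r ≤ ℓ) : wordDeg (color ℓ r) = r := card_color hr

theorem vac_mem (hr : r ≤ ℓ) : vac K ℓ r ∈ degSpace K ℓ r :=
  single_mem_degSpace (wordDeg_color hr)

theorem act_vac_eps (hℓ : 3 ≤ ℓ) (hq : IsPrimitiveRoot q ℓ) (hr : 1 ≤ r) (hr' : r ≤ ℓ - 1) :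
    act q ℓ (vac K ℓ r) (eps q ℓ r) = vac K ℓ r :=
  act_eps hℓ hq hr hr' act_one act_mul fun i hi => by
    rw [act_gen]
    exact heckeOp_single_of_eq hi

theorem exists_act_vac_eq (hq0 : q ≠ 0) (hr : r ≤ ℓ) {φ : (Fin ℓ → Bool) → K}
    (h : φ ∈ degSpace K ℓ r) : ∃ x : Hecke q ℓ, act q ℓ (vac K ℓ r) x = φ :=
  exists_act_single_eq_of_mem hq0 (by rwa [wordDeg_color hr])

/-- A dimension squeeze: `ε_r H` is spanned by as many elements as there are coset representatives,
these inject into the words of degree `r` by their colour patterns, and acting on the vacuum reaches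
all these words. -/
theorem act_vac_injective (hℓ : 3 ≤ ℓ) (hq : IsPrimitiveRoot q ℓ) (hr : 1 ≤ r) (hr' : r ≤ ℓ - 1)
    {x : Hecke q ℓ} (hx : eps q ℓ r * x = x) (h0 : act q ℓ (vac K ℓ r) x = 0) : x = 0 := by
  classical
  have hq0 := q_ne_zero hℓ hq
  have hrℓ : r ≤ ℓ := by omega
  let S : Submodule K (Hecke q ℓ) := LinearMap.range (LinearMap.mulLeft K (eps q ℓ r))
  let D : Finset (Equiv.Perm (Fin ℓ)) := Finset.univ.filter (· ∈ rightReps ℓ (firstPart ℓ r))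
  let B : Finset (Hecke q ℓ) := D.image fun d => eps q ℓ r * T q d
  let W : Finset (Fin ℓ → Bool) := Finset.univ.filter fun f => wordDeg f = r
  have hS : S ≤ Submodule.span K (B : Set (Hecke q ℓ)) := by
    rintro _ ⟨h, rfl⟩
    have := eps_mul_mem_span hq0 hrℓ h
    simpa [B, D] using this
  have : FiniteDimensional K S := Submodule.finiteDimensional_of_le hS
  have hDW : D.card ≤ W.card := by
    refine Finset.card_le_card_of_injOn (fun d => color ℓ r ∘ d) ?_ ?_
    · intro d _
      simp [W, wordDeg_comp, wordDeg_color hrℓ]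
    · intro d hd d' hd' h
      simp only [D, Finset.coe_filter, Finset.mem_univ, true_and] at hd hd'
      exact eq_of_color_eq hrℓ hd hd' fun x => congrFun h x
  have hfin : Module.finrank K S ≤ W.card :=
    ((Submodule.finrank_mono hS).trans (finrank_span_finset_le_card B)).trans
      (Finset.card_image_le.trans hDW)
  let L : S →ₗ[K] ((Fin ℓ → Bool) → K) := (act q ℓ (vac K ℓ r)).domRestrict S
  have hli : LinearIndependent K fun f : W => (Pi.single f.1 1 : (Fin ℓ → Bool) → K) := by
    have := (Pi.basisFun K (Fin ℓ → Bool)).linearIndependent.comp (fun f : W => f.1)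
      Subtype.val_injective
    convert this using 2 with f
    simp
  have hrange : Submodule.span K (Set.range fun f : W => (Pi.single f.1 1 : (Fin ℓ → Bool) → K)) ≤
      LinearMap.range L := by
    rw [Submodule.span_le]
    rintro _ ⟨f, rfl⟩
    have hf : wordDeg f.1 = r := (Finset.mem_filter.mp f.2).2
    obtain ⟨y, hy⟩ := exists_act_vac_eq hq0 hrℓ (single_mem_degSpace (K := K) hf)
    refine ⟨⟨eps q ℓ r * y, ⟨y, rfl⟩⟩, ?_⟩
    change act q ℓ (vac K ℓ r) (eps q ℓ r * y) = _
    rw [← act_mul, act_vac_eps hℓ hq hr hr', hy]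
  have hcard := finrank_span_eq_card hli
  rw [Fintype.card_coe] at hcard
  have h1 := Submodule.finrank_mono hrange
  have h2 := LinearMap.finrank_range_add_finrank_ker L
  have h3 : Module.finrank K (LinearMap.ker L) = 0 := by omega
  have h4 := Submodule.finrank_eq_zero.mp h3
  have h5 : (⟨x, ⟨x, hx⟩⟩ : S) ∈ LinearMap.ker L := h0
  rw [h4, Submodule.mem_bot] at h5
  exact congrArg Subtype.val h5

/-- Every nonzero element of `ε_r H` generates a right ideal meeting `H ε_r`. -/
theorem exists_mul_mul_eps_ne_zero (hℓ : 3 ≤ ℓ) (hq : IsPrimitiveRoot q ℓ) (hr : 1 ≤ r)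
    (hr' : r ≤ ℓ - 1) {x : Hecke q ℓ} (hx : eps q ℓ r * x = x) (h0 : x ≠ 0) :
    ∃ h, x * h * eps q ℓ r ≠ 0 := by
  have hq0 := q_ne_zero hℓ hq
  have hrℓ : r ≤ ℓ := by omega
  have h1 : act q ℓ (vac K ℓ r) x ≠ 0 := fun h => h0 (act_vac_injective hℓ hq hr hr' hx h)
  -- A word `f` occurring in `vac · x` is `vac · g` for some `g`. Invariance of the form gives `⟨vac
  -- · x · flip g · ε_r, vac⟩ = ⟨vac · x, f⟩`, a nonzero multiple of the coefficient of `f`.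
  obtain ⟨f, hf⟩ := Function.ne_iff.mp h1
  have hdeg : wordDeg f = r := act_mem_degSpace (vac_mem hrℓ) x f hf
  obtain ⟨g, hg⟩ := exists_act_vac_eq hq0 hrℓ (single_mem_degSpace (K := K) hdeg)
  refine ⟨flip g, fun hz => ?_⟩
  have h2 := pairing_single (q := q) (act q ℓ (vac K ℓ r) x) f
  have h3 : pairing q (act q ℓ (vac K ℓ r) (x * flip g * eps q ℓ r)) (vac K ℓ r) =
      pairing q (act q ℓ (vac K ℓ r) x) (Pi.single f 1) := by
    rw [← act_mul, pairing_act, flip_eps, act_vac_eps hℓ hq hr hr', ← act_mul, pairing_act,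
      flip_flip, hg]
  rw [← h3, hz, map_zero] at h2
  have h4 : pairing q (0 : (Fin ℓ → Bool) → K) (vac K ℓ r) = 0 := by simp [pairing]
  rw [h4] at h2
  exact mul_ne_zero (wordWeight_ne_zero hq0 f) hf h2.symm

theorem exists_color_true (hr : 1 ≤ r) (hr' : r ≤ ℓ - 1) : ∃ j, color ℓ r j = true := by
  by_contra! hcon
  have := card_color (ℓ := ℓ) (r := r) (by omega)
  rw [Finset.filter_false_of_mem fun x _ => hcon x, Finset.card_empty] at this
  omega

theorem exists_color_false (hr : 1 ≤ r) (hr' : r ≤ ℓ - 1) : ∃ j, color ℓ r j = false := by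
  by_contra! hcon
  have := card_color (ℓ := ℓ) (r := r) (by omega)
  rw [Finset.filter_true_of_mem fun x _ => by simpa using hcon x, Finset.card_univ,
    Fintype.card_fin] at this
  omega

/-- The root of unity enters here: the quantum integer of `ℓ` at `q⁻¹` is zero, so the two operators
anticommute. -/
theorem lowering_raising_apply (hℓ : 3 ≤ ℓ) (hq : IsPrimitiveRoot q ℓ)
    (φ : (Fin ℓ → Bool) → K) :
    raising K ℓ (lowering q ℓ φ) = -lowering q ℓ (raising K ℓ φ) := by
  have h := LinearMap.congr_fun (lowering_raising (q := q) (n := ℓ)) φ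
  rw [hq.inv.geom_sum_eq_zero (by omega), zero_smul] at h
  exact eq_neg_of_add_eq_zero_right h

end Vacuum

/-! ### The arrows -/

section Arrows

variable {K : Type*} [Field K] {q : K} {ℓ r : ℕ}

theorem act_lowering (hq0 : q ≠ 0) (φ : (Fin ℓ → Bool) → K) (h : Hecke q ℓ) :
    act q ℓ (lowering q ℓ φ) h = lowering q ℓ (act q ℓ φ h) :=
  act_map (lowering_commute hq0) φ h

theorem act_raising (φ : (Fin ℓ → Bool) → K) (h : Hecke q ℓ) :
    act q ℓ (raising K ℓ φ) h = raising K ℓ (act q ℓ φ h) :=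
  act_map raising_commute φ h

/-- The lowered vacuum of `r + 1` has degree `r`, so some `h` produces it from the vacuum of `r`. It
is fixed by `ε_{r+1}` because lowering commutes with `H`. -/
theorem exists_act_eq_lowering (hℓ : 3 ≤ ℓ) (hq : IsPrimitiveRoot q ℓ) (hr : 1 ≤ r)
    (hr' : r ≤ ℓ - 2) : ∃ h, act q ℓ (vac K ℓ r) (eps q ℓ r * h * eps q ℓ (r + 1)) =
      lowering q ℓ (vac K ℓ (r + 1)) := by
  have hq0 := q_ne_zero hℓ hq
  obtain ⟨h, hh⟩ := exists_act_vac_eq (q := q) hq0 (r := r) (ℓ := ℓ) (by omega)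
    (lowering_mem_degSpace (q := q) (vac_mem (K := K) (ℓ := ℓ) (r := r + 1) (by omega)))
  refine ⟨h, ?_⟩
  rw [← act_mul, ← act_mul, act_vac_eps hℓ hq hr (by omega), hh, act_lowering hq0,
    act_vac_eps hℓ hq (by omega) (by omega)]

theorem exists_act_eq_raising (hℓ : 3 ≤ ℓ) (hq : IsPrimitiveRoot q ℓ) (hr : 1 ≤ r)
    (hr' : r ≤ ℓ - 2) : ∃ h, act q ℓ (vac K ℓ (r + 1)) (eps q ℓ (r + 1) * h * eps q ℓ r) =
      raising K ℓ (vac K ℓ r) := by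
  have hq0 := q_ne_zero hℓ hq
  obtain ⟨h, hh⟩ := exists_act_vac_eq (q := q) hq0 (r := r + 1) (ℓ := ℓ) (by omega)
    (raising_mem_degSpace (vac_mem (K := K) (ℓ := ℓ) (r := r) (by omega)))
  refine ⟨h, ?_⟩
  rw [← act_mul, ← act_mul, act_vac_eps hℓ hq (by omega) (by omega), hh, act_raising,
    act_vac_eps hℓ hq hr (by omega)]

theorem lowering_vac_ne_zero (hq0 : q ≠ 0) (hr : 1 ≤ r) (hr' : r ≤ ℓ - 1) :
    lowering q ℓ (vac K ℓ r) ≠ 0 := by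
  obtain ⟨j, hj⟩ := exists_color_true hr hr'
  exact lowering_single_ne_zero hq0 hj

theorem raising_vac_ne_zero (hr : 1 ≤ r) (hr' : r ≤ ℓ - 1) : raising K ℓ (vac K ℓ r) ≠ 0 := by
  obtain ⟨j, hj⟩ := exists_color_false hr hr'
  exact raising_single_ne_zero hj

theorem lowering_raising_vac_ne_zero (hq0 : q ≠ 0) (hr : 1 ≤ r) (hr' : r ≤ ℓ - 1) :
    lowering q ℓ (raising K ℓ (vac K ℓ r)) ≠ 0 := by
  obtain ⟨i, hi⟩ := exists_color_false hr hr'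
  obtain ⟨j, hj⟩ := exists_color_true hr hr'
  exact lowering_raising_single_ne_zero hq0 hi hj

theorem existsUnique_isArrowRep (hℓ : 3 ≤ ℓ) (hq : IsPrimitiveRoot q ℓ) (hr : 1 ≤ r)
    (hr' : r ≤ ℓ - 2) : ∃! d, IsArrowRep q ℓ r d := by
  obtain ⟨h, hh⟩ := exists_act_eq_lowering hℓ hq hr hr'
  have h0 : eps q ℓ r * h * eps q ℓ (r + 1) ≠ 0 := by
    intro h0
    rw [h0, map_zero] at hh
    exact lowering_vac_ne_zero (q_ne_zero hℓ hq) (by omega) (by omega) hh.symm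
  obtain ⟨d, hd⟩ := exists_isHomRep hℓ hq (by omega) (by omega) h0
  exact ⟨d, hd, fun d' hd' =>
    IsHomRep.unique hℓ hq (by omega) (by omega) (Or.inl rfl) hd' hd⟩

theorem isHomRep_arrowRep (hℓ : 3 ≤ ℓ) (hq : IsPrimitiveRoot q ℓ) (hr : 1 ≤ r)
    (hr' : r ≤ ℓ - 2) : IsHomRep q ℓ r (r + 1) (arrowRep q ℓ r) :=
  Classical.epsilon_spec (existsUnique_isArrowRep hℓ hq hr hr').exists

theorem flip_alpha : flip (alpha q ℓ r) = beta q ℓ r := by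
  rw [alpha, beta, flip_mul, flip_mul, flip_eps, flip_eps, flip_T, mul_assoc]

theorem mem_span_alpha (hℓ : 3 ≤ ℓ) (hq : IsPrimitiveRoot q ℓ) (hr : 1 ≤ r) (hr' : r ≤ ℓ - 2)
    (h : Hecke q ℓ) : eps q ℓ r * h * eps q ℓ (r + 1) ∈ Submodule.span K {alpha q ℓ r} :=
  eps_mul_mul_eps_mem_span hℓ hq (by omega) (by omega) (Or.inl rfl)
    (isHomRep_arrowRep hℓ hq hr hr') h

theorem mem_span_beta (hℓ : 3 ≤ ℓ) (hq : IsPrimitiveRoot q ℓ) (hr : 1 ≤ r) (hr' : r ≤ ℓ - 2)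
    (h : Hecke q ℓ) : eps q ℓ (r + 1) * h * eps q ℓ r ∈ Submodule.span K {beta q ℓ r} := by
  obtain ⟨c, hc⟩ := Submodule.mem_span_singleton.mp (mem_span_alpha hℓ hq hr hr' (flip h))
  refine Submodule.mem_span_singleton.mpr ⟨c, ?_⟩
  have := congrArg flip hc
  rwa [flip_smul, flip_alpha, flip_mul, flip_mul, flip_flip, flip_eps, flip_eps, ← mul_assoc]
    at this

/-- The element acting as lowering lies on the line spanned by `α_r` and is nonzero, so `α_r` is a
nonzero multiple of it; `d` need not be known explicitly. -/
theorem exists_act_alpha (hℓ : 3 ≤ ℓ) (hq : IsPrimitiveRoot q ℓ) (hr : 1 ≤ r) (hr' : r ≤ ℓ - 2) :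
    ∃ a : K, a ≠ 0 ∧ act q ℓ (vac K ℓ r) (alpha q ℓ r) = a • lowering q ℓ (vac K ℓ (r + 1)) := by
  obtain ⟨h, hh⟩ := exists_act_eq_lowering hℓ hq hr hr'
  obtain ⟨c, hc⟩ := Submodule.mem_span_singleton.mp (mem_span_alpha hℓ hq hr hr' h)
  rw [← hc, map_smul] at hh
  have hc0 : c ≠ 0 := by
    rintro rfl
    rw [zero_smul] at hh
    exact lowering_vac_ne_zero (q_ne_zero hℓ hq) (by omega) (by omega) hh.symm
  exact ⟨c⁻¹, inv_ne_zero hc0, by rw [← hh, smul_smul, inv_mul_cancel₀ hc0, one_smul]⟩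

theorem exists_act_beta (hℓ : 3 ≤ ℓ) (hq : IsPrimitiveRoot q ℓ) (hr : 1 ≤ r) (hr' : r ≤ ℓ - 2) :
    ∃ b : K, b ≠ 0 ∧ act q ℓ (vac K ℓ (r + 1)) (beta q ℓ r) = b • raising K ℓ (vac K ℓ r) := by
  obtain ⟨h, hh⟩ := exists_act_eq_raising hℓ hq hr hr'
  obtain ⟨c, hc⟩ := Submodule.mem_span_singleton.mp (mem_span_beta hℓ hq hr hr' h)
  rw [← hc, map_smul] at hh
  have hc0 : c ≠ 0 := by
    rintro rfl
    rw [zero_smul] at hh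
    exact raising_vac_ne_zero (by omega) (by omega) hh.symm
  exact ⟨c⁻¹, inv_ne_zero hc0, by rw [← hh, smul_smul, inv_mul_cancel₀ hc0, one_smul]⟩

theorem exists_act_alpha_beta (hℓ : 3 ≤ ℓ) (hq : IsPrimitiveRoot q ℓ) (hr : 1 ≤ r)
    (hr' : r ≤ ℓ - 2) : ∃ c : K, c ≠ 0 ∧ act q ℓ (vac K ℓ r) (alpha q ℓ r * beta q ℓ r) =
      c • lowering q ℓ (raising K ℓ (vac K ℓ r)) := by
  obtain ⟨a, ha, hα⟩ := exists_act_alpha hℓ hq hr hr'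
  obtain ⟨b, hb, hβ⟩ := exists_act_beta hℓ hq hr hr'
  refine ⟨a * b, mul_ne_zero ha hb, ?_⟩
  rw [← act_mul, hα, map_smul, LinearMap.smul_apply, act_lowering (q_ne_zero hℓ hq), hβ, map_smul,
    smul_smul]

theorem exists_act_beta_alpha (hℓ : 3 ≤ ℓ) (hq : IsPrimitiveRoot q ℓ) (hr : 1 ≤ r)
    (hr' : r ≤ ℓ - 2) : ∃ c : K, c ≠ 0 ∧ act q ℓ (vac K ℓ (r + 1)) (beta q ℓ r * alpha q ℓ r) =
      c • lowering q ℓ (raising K ℓ (vac K ℓ (r + 1))) := by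
  obtain ⟨a, ha, hα⟩ := exists_act_alpha hℓ hq hr hr'
  obtain ⟨b, hb, hβ⟩ := exists_act_beta hℓ hq hr hr'
  refine ⟨-(b * a), neg_ne_zero.mpr (mul_ne_zero hb ha), ?_⟩
  rw [← act_mul, hβ, map_smul, LinearMap.smul_apply, act_raising, hα, map_smul,
    lowering_raising_apply hℓ hq, smul_smul, smul_neg, neg_smul]

theorem eps_mul_alpha (hℓ : 3 ≤ ℓ) (hq : IsPrimitiveRoot q ℓ) (hr : 1 ≤ r) (hr' : r ≤ ℓ - 1) :
    eps q ℓ r * alpha q ℓ r = alpha q ℓ r := by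
  rw [alpha, ← mul_assoc, ← mul_assoc, eps_mul_self hℓ hq hr hr']

theorem alpha_mul_eps (hℓ : 3 ≤ ℓ) (hq : IsPrimitiveRoot q ℓ) (hr' : r ≤ ℓ - 2) :
    alpha q ℓ r * eps q ℓ (r + 1) = alpha q ℓ r := by
  rw [alpha, mul_assoc, eps_mul_self hℓ hq (by omega) (by omega)]

theorem eps_mul_beta (hℓ : 3 ≤ ℓ) (hq : IsPrimitiveRoot q ℓ) (hr' : r ≤ ℓ - 2) :
    eps q ℓ (r + 1) * beta q ℓ r = beta q ℓ r := by
  rw [beta, ← mul_assoc, ← mul_assoc, eps_mul_self hℓ hq (by omega) (by omega)]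

theorem beta_mul_eps (hℓ : 3 ≤ ℓ) (hq : IsPrimitiveRoot q ℓ) (hr : 1 ≤ r) (hr' : r ≤ ℓ - 1) :
    beta q ℓ r * eps q ℓ r = beta q ℓ r := by
  rw [beta, mul_assoc, eps_mul_self hℓ hq hr hr']

theorem exists_act_socElt (hℓ : 3 ≤ ℓ) (hq : IsPrimitiveRoot q ℓ) (hr : 1 ≤ r)
    (hr' : r ≤ ℓ - 1) : ∃ c : K, c ≠ 0 ∧ act q ℓ (vac K ℓ r) (socElt q ℓ r) =
      c • lowering q ℓ (raising K ℓ (vac K ℓ r)) := by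
  by_cases h : r ≤ ℓ - 2
  · rw [socElt, if_pos h]
    exact exists_act_alpha_beta hℓ hq hr h
  · obtain rfl : r = ℓ - 2 + 1 := by omega
    rw [socElt, if_neg h]
    exact exists_act_beta_alpha hℓ hq (by omega) le_rfl

theorem eps_mul_socElt (hℓ : 3 ≤ ℓ) (hq : IsPrimitiveRoot q ℓ) (hr : 1 ≤ r) (hr' : r ≤ ℓ - 1) :
    eps q ℓ r * socElt q ℓ r = socElt q ℓ r := by
  by_cases h : r ≤ ℓ - 2
  · rw [socElt, if_pos h, ← mul_assoc, eps_mul_alpha hℓ hq hr hr']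
  · obtain rfl : r = ℓ - 2 + 1 := by omega
    rw [socElt, if_neg h, ← mul_assoc, eps_mul_beta hℓ hq le_rfl]

theorem socElt_mul_eps (hℓ : 3 ≤ ℓ) (hq : IsPrimitiveRoot q ℓ) (hr : 1 ≤ r) (hr' : r ≤ ℓ - 1) :
    socElt q ℓ r * eps q ℓ r = socElt q ℓ r := by
  by_cases h : r ≤ ℓ - 2
  · rw [socElt, if_pos h, mul_assoc, beta_mul_eps hℓ hq hr hr']
  · obtain rfl : r = ℓ - 2 + 1 := by omega
    rw [socElt, if_neg h, mul_assoc, alpha_mul_eps hℓ hq le_rfl]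

theorem socElt_ne_zero (hℓ : 3 ≤ ℓ) (hq : IsPrimitiveRoot q ℓ) (hr : 1 ≤ r) (hr' : r ≤ ℓ - 1) :
    socElt q ℓ r ≠ 0 := by
  intro h0
  obtain ⟨c, hc, h⟩ := exists_act_socElt hℓ hq hr hr'
  rw [h0, map_zero] at h
  exact smul_ne_zero hc (lowering_raising_vac_ne_zero (q_ne_zero hℓ hq) hr hr') h.symm

/-- On the vacuum this is a multiple of `FEFE = -FFEE = 0`. -/
theorem socElt_mul_self (hℓ : 3 ≤ ℓ) (hq : IsPrimitiveRoot q ℓ) (hr : 1 ≤ r) (hr' : r ≤ ℓ - 1) :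
    socElt q ℓ r * socElt q ℓ r = 0 := by
  obtain ⟨c, -, h⟩ := exists_act_socElt hℓ hq hr hr'
  refine act_vac_injective hℓ hq hr hr' (by rw [← mul_assoc, eps_mul_socElt hℓ hq hr hr']) ?_
  have hE : ∀ φ : (Fin ℓ → Bool) → K, raising K ℓ (raising K ℓ φ) = 0 := fun φ =>
    LinearMap.congr_fun raising_mul_self φ
  rw [← act_mul, h, map_smul, LinearMap.smul_apply, act_lowering (q_ne_zero hℓ hq), act_raising, h,
    map_smul, map_smul, lowering_raising_apply hℓ hq, hE, map_zero, neg_zero, map_zero, smul_zero,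
    smul_zero]

theorem linearIndependent_eps_socElt (hℓ : 3 ≤ ℓ) (hq : IsPrimitiveRoot q ℓ) (hr : 1 ≤ r)
    (hr' : r ≤ ℓ - 1) : LinearIndependent K ![eps q ℓ r, socElt q ℓ r] := by
  rw [LinearIndependent.pair_iff]
  intro a b h
  have h1 := congrArg (· * socElt q ℓ r) h
  simp only [add_mul, smul_mul_assoc, eps_mul_socElt hℓ hq hr hr', socElt_mul_self hℓ hq hr hr',
    smul_zero, add_zero, zero_mul] at h1
  have ha := (smul_eq_zero.mp h1).resolve_right (socElt_ne_zero hℓ hq hr hr')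
  rw [ha, zero_smul, zero_add] at h
  exact ⟨ha, (smul_eq_zero.mp h).resolve_right (socElt_ne_zero hℓ hq hr hr')⟩

/-- The space `ε_r H ε_r` lies in the span of `ε_r` and `z`, of dimension at most two, and contains
the independent pair `ε_r, ω_r`, which must therefore span it. -/
theorem mem_span_eps_socElt (hℓ : 3 ≤ ℓ) (hq : IsPrimitiveRoot q ℓ) (hr : 1 ≤ r)
    (hr' : r ≤ ℓ - 1) (h : Hecke q ℓ) :
    eps q ℓ r * h * eps q ℓ r ∈ Submodule.span K {eps q ℓ r, socElt q ℓ r} := by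
  classical
  obtain ⟨z, hz⟩ := exists_eps_mul_mul_eps_self_mem_span hℓ hq hr hr'
  have hle : Submodule.span K {eps q ℓ r, socElt q ℓ r} ≤ Submodule.span K {eps q ℓ r, z} := by
    rw [Submodule.span_le, Set.insert_subset_iff, Set.singleton_subset_iff]
    refine ⟨Submodule.subset_span (by simp), ?_⟩
    have := hz (socElt q ℓ r)
    rwa [eps_mul_socElt hℓ hq hr hr', socElt_mul_eps hℓ hq hr hr'] at this
  have h2 : Module.finrank K (Submodule.span K {eps q ℓ r, socElt q ℓ r}) = 2 := by
    have := finrank_span_eq_card (linearIndependent_eps_socElt hℓ hq hr hr')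
    rwa [Matrix.range_cons, Matrix.range_cons, Matrix.range_empty, Set.union_empty,
      Set.singleton_union, Fintype.card_fin] at this
  have h3 : Module.finrank K (Submodule.span K {eps q ℓ r, z}) ≤ 2 := by
    have := finrank_span_finset_le_card (R := K) ({eps q ℓ r, z} : Finset (Hecke q ℓ))
    rw [Finset.coe_pair] at this
    exact this.trans Finset.card_le_two
  have : FiniteDimensional K (Submodule.span K {eps q ℓ r, z}) :=
    FiniteDimensional.span_of_finite K (by simp)
  rw [Submodule.eq_of_le_of_finrank_le hle (by omega)]
  exact hz h

end Arrows

end HeckeBlock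

end

noncomputable section

namespace HeckeBlock

/-! ### Modules with a smallest nonzero submodule -/

section Module

variable {S M : Type*} [Ring S] [AddCommGroup M] [Module S M]

theorem isAtom_span_of_forall_mem {w : M} (hw : w ≠ 0)
    (h : ∀ x ∈ Submodule.span S {w}, x ≠ 0 → w ∈ Submodule.span S {x}) :
    IsAtom (Submodule.span S {w}) := by
  refine ⟨by simpa using hw, fun b hb => ?_⟩
  by_contra hne
  obtain ⟨x, hx, hx0⟩ := Submodule.exists_mem_ne_zero_of_ne_bot hne
  refine hb.not_ge ?_
  rw [Submodule.span_singleton_le_iff_mem]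
  exact (Submodule.span_singleton_le_iff_mem x b).mpr hx (h x (hb.le hx) hx0)

/-- The hypothesis says that `w` lies in every nonzero submodule, so the submodule it generates is
the only simple one. -/
theorem socle_eq_span {w : M} (hw : w ≠ 0) (h : ∀ x : M, x ≠ 0 → w ∈ Submodule.span S {x}) :
    socle S M = Submodule.span S {w} := by
  have hatom := isAtom_span_of_forall_mem hw fun x _ => h x
  refine le_antisymm (sSup_le fun N hN => ?_) (le_sSup (isSimpleModule_iff_isAtom.mpr hatom))
  have hN' : IsAtom N := isSimpleModule_iff_isAtom.mp hN
  obtain ⟨x, hx, hx0⟩ := Submodule.exists_mem_ne_zero_of_ne_bot hN'.1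
  have hle : Submodule.span S {w} ≤ N := (Submodule.span_singleton_le_iff_mem w N).mpr
    ((Submodule.span_singleton_le_iff_mem x N).mpr hx (h x hx0))
  rcases hN'.le_iff.mp hle with h' | h'
  · exact (hatom.1 h').elim
  · exact h'.ge

theorem isSimpleModule_socle {w : M} (hw : w ≠ 0)
    (h : ∀ x : M, x ≠ 0 → w ∈ Submodule.span S {x}) : IsSimpleModule S (socle S M) := by
  rw [socle_eq_span hw h]
  exact isSimpleModule_iff_isAtom.mpr (isAtom_span_of_forall_mem hw fun x _ => h x)

theorem isIndecomposable_of_forall_mem {w : M} (hw : w ≠ 0)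
    (h : ∀ x : M, x ≠ 0 → w ∈ Submodule.span S {x}) : IsIndecomposable S M := by
  refine ⟨⟨w, 0, hw⟩, fun N N' hc => ?_⟩
  by_contra! hcon
  have key : ∀ N : Submodule S M, N ≠ ⊥ → w ∈ N := fun N hN => by
    obtain ⟨x, hx, hx0⟩ := Submodule.exists_mem_ne_zero_of_ne_bot hN
    exact (Submodule.span_singleton_le_iff_mem x N).mpr hx (h x hx0)
  exact hw (Submodule.disjoint_def.mp hc.disjoint w (key N hcon.1) (key N' hcon.2))

theorem isCoatom_of_forall_le {J : Submodule S M} (hJ : J ≠ ⊤)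
    (h : ∀ N : Submodule S M, N ≤ J ∨ N = ⊤) : IsCoatom J :=
  ⟨hJ, fun N hN => (h N).resolve_left hN.not_ge⟩

theorem jacobson_eq_of_forall_le {J : Submodule S M} (hJ : J ≠ ⊤)
    (h : ∀ N : Submodule S M, N ≤ J ∨ N = ⊤) : Module.jacobson S M = J := by
  have hco := isCoatom_of_forall_le hJ h
  refine le_antisymm (sInf_le hco) (le_sInf fun N hN => ?_)
  have hN' : IsCoatom N := hN
  rcases hN'.le_iff.mp ((h N).resolve_right hN'.1) with h' | h'
  · exact (hJ h').elim
  · exact h'.le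

end Module

/-! ### Zigzag algebras of a line -/

/-- Elements of an algebra satisfying the relations of the zigzag algebra of a line with `m`
vertices; the algebra may be larger than the algebra which they span. -/
structure IsZigzag (K : Type*) {S : Type*} [Field K] [Ring S] [Algebra K S] (m : ℕ)
    (e α β ω : ℕ → S) : Prop where
  e_mul_self : ∀ r, 1 ≤ r → r ≤ m → e r * e r = e r
  e_mul_e : ∀ r t, 1 ≤ r → r ≤ m → 1 ≤ t → t ≤ m → r ≠ t → e r * e t = 0
  e_mul_α : ∀ r, 1 ≤ r → r + 1 ≤ m → e r * α r = α r
  α_mul_e : ∀ r, 1 ≤ r → r + 1 ≤ m → α r * e (r + 1) = α r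
  e_mul_β : ∀ r, 1 ≤ r → r + 1 ≤ m → e (r + 1) * β r = β r
  β_mul_e : ∀ r, 1 ≤ r → r + 1 ≤ m → β r * e r = β r
  e_mul_ω : ∀ r, 1 ≤ r → r ≤ m → e r * ω r = ω r
  ω_mul_e : ∀ r, 1 ≤ r → r ≤ m → ω r * e r = ω r
  diag : ∀ r, 1 ≤ r → r ≤ m → ∀ h, ∃ a b : K, e r * h * e r = a • e r + b • ω r
  up : ∀ r, 1 ≤ r → r + 1 ≤ m → ∀ h, ∃ a : K, e r * h * e (r + 1) = a • α r
  down : ∀ r, 1 ≤ r → r + 1 ≤ m → ∀ h, ∃ a : K, e (r + 1) * h * e r = a • β r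
  far : ∀ r t, 1 ≤ r → r ≤ m → 1 ≤ t → t ≤ m → r + 2 ≤ t ∨ t + 2 ≤ r → ∀ h, e r * h * e t = 0
  ω_ne_zero : ∀ r, 1 ≤ r → r ≤ m → ω r ≠ 0
  ω_mul_self : ∀ r, 1 ≤ r → r ≤ m → ω r * ω r = 0
  α_mul_β : ∀ r, 1 ≤ r → r + 1 ≤ m → α r * β r = ω r
  faithful : ∀ r, 1 ≤ r → r ≤ m → ∀ x, e r * x = x → x ≠ 0 → ∃ h, x * h * e r ≠ 0

namespace IsZigzag

variable {K S : Type*} [Field K] [Ring S] [Algebra K S] {m : ℕ} {e α β ω : ℕ → S}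

/-- By faithfulness some `x h e_r = a e_r + b ω_r` is nonzero. If `a = 0`, dividing by `b` gives
`ω_r`; otherwise multiplying by `a⁻¹ ω_r` does, as `ω_r² = 0`. -/
theorem exists_mul_eq (hZ : IsZigzag K m e α β ω) {r : ℕ} (hr : 1 ≤ r) (hr' : r ≤ m) {x : S}
    (hx : e r * x = x) (h0 : x ≠ 0) : ∃ y, x * y = ω r := by
  obtain ⟨h, hh⟩ := hZ.faithful r hr hr' x hx h0
  obtain ⟨a, b, hab⟩ := hZ.diag r hr hr' (x * h)
  rw [← mul_assoc, hx] at hab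
  by_cases ha : a = 0
  · rw [ha, zero_smul, zero_add] at hab
    have hb : b ≠ 0 := by
      rintro rfl
      exact hh (by rw [hab, zero_smul])
    refine ⟨h * e r * algebraMap K S b⁻¹, ?_⟩
    rw [← mul_assoc, ← mul_assoc, hab, ← Algebra.commutes, ← Algebra.smul_def, smul_smul,
      inv_mul_cancel₀ hb, one_smul]
  · refine ⟨h * e r * (a⁻¹ • ω r), ?_⟩
    rw [← mul_assoc, ← mul_assoc, hab, mul_smul_comm, add_mul, smul_mul_assoc, smul_mul_assoc,
      hZ.e_mul_ω r hr hr', hZ.ω_mul_self r hr hr', smul_zero, add_zero, smul_smul,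
      inv_mul_cancel₀ ha, one_smul]

section Ideal

variable {r : ℕ} {P : Submodule Sᵐᵒᵖ S}

/-- Left multiplication by `e_r` retracts `S` onto `P`. Describing `P` by the condition `e_r x = x`
lets the same lemmas apply to `ε_r H` and to `ε_r H ε`. -/
theorem projective (hZ : IsZigzag K m e α β ω) (hr : 1 ≤ r) (hr' : r ≤ m)
    (hP : ∀ x, x ∈ P ↔ e r * x = x) : Module.Projective Sᵐᵒᵖ P := by
  let i : P →ₗ[Sᵐᵒᵖ] Sᵐᵒᵖ :=
    { toFun := fun x => MulOpposite.op x.1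
      map_add' := fun x y => rfl
      map_smul' := fun a x => rfl }
  let s : Sᵐᵒᵖ →ₗ[Sᵐᵒᵖ] P :=
    { toFun := fun y => ⟨e r * y.unop, (hP _).mpr (by
        rw [← mul_assoc, hZ.e_mul_self r hr hr'])⟩
      map_add' := fun x y => Subtype.ext (mul_add (e r) x.unop y.unop)
      map_smul' := fun a x => Subtype.ext (mul_assoc (e r) x.unop a.unop).symm }
  exact Module.Projective.of_split i s (LinearMap.ext fun x => Subtype.ext ((hP _).mp x.2))

theorem mem_span_of_ne_zero (hZ : IsZigzag K m e α β ω) (hr : 1 ≤ r) (hr' : r ≤ m)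
    (hP : ∀ x, x ∈ P ↔ e r * x = x) (hω : ω r ∈ P) (x : P) (hx : x ≠ 0) :
    (⟨ω r, hω⟩ : P) ∈ Submodule.span Sᵐᵒᵖ {x} := by
  obtain ⟨y, hy⟩ := hZ.exists_mul_eq hr hr' ((hP x.1).mp x.2) fun h => hx (Subtype.ext h)
  exact Submodule.mem_span_singleton.mpr ⟨MulOpposite.op y, Subtype.ext hy⟩

theorem ω_mem (hZ : IsZigzag K m e α β ω) (hr : 1 ≤ r) (hr' : r ≤ m)
    (hP : ∀ x, x ∈ P ↔ e r * x = x) : ω r ∈ P := (hP _).mpr (hZ.e_mul_ω r hr hr')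

theorem coe_ω_ne_zero (hZ : IsZigzag K m e α β ω) (hr : 1 ≤ r) (hr' : r ≤ m) (hω : ω r ∈ P) :
    (⟨ω r, hω⟩ : P) ≠ 0 := fun h => hZ.ω_ne_zero r hr hr' (congrArg Subtype.val h)

theorem isIndecomposable (hZ : IsZigzag K m e α β ω) (hr : 1 ≤ r) (hr' : r ≤ m)
    (hP : ∀ x, x ∈ P ↔ e r * x = x) : IsIndecomposable Sᵐᵒᵖ P :=
  isIndecomposable_of_forall_mem (hZ.coe_ω_ne_zero hr hr' (hZ.ω_mem hr hr' hP))
    (hZ.mem_span_of_ne_zero hr hr' hP _)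

theorem isSimpleModule_socle (hZ : IsZigzag K m e α β ω) (hr : 1 ≤ r) (hr' : r ≤ m)
    (hP : ∀ x, x ∈ P ↔ e r * x = x) : IsSimpleModule Sᵐᵒᵖ (socle Sᵐᵒᵖ P) :=
  HeckeBlock.isSimpleModule_socle (hZ.coe_ω_ne_zero hr hr' (hZ.ω_mem hr hr' hP))
    (hZ.mem_span_of_ne_zero hr hr' hP _)

theorem socle_eq (hZ : IsZigzag K m e α β ω) (hr : 1 ≤ r) (hr' : r ≤ m)
    (hP : ∀ x, x ∈ P ↔ e r * x = x) :
    socle Sᵐᵒᵖ P = Submodule.span Sᵐᵒᵖ {⟨ω r, hZ.ω_mem hr hr' hP⟩} :=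
  socle_eq_span (hZ.coe_ω_ne_zero hr hr' (hZ.ω_mem hr hr' hP))
    (hZ.mem_span_of_ne_zero hr hr' hP _)

end Ideal

/-! ### The case in which the idempotents sum to one -/

section Complete

variable {r : ℕ}

theorem α_ne_zero (hZ : IsZigzag K m e α β ω) (hr : 1 ≤ r) (hr' : r + 1 ≤ m) : α r ≠ 0 := by
  intro h
  have := hZ.α_mul_β r hr hr'
  rw [h, zero_mul] at this
  exact hZ.ω_ne_zero r hr (by omega) this.symm

theorem β_ne_zero (hZ : IsZigzag K m e α β ω) (hr : 1 ≤ r) (hr' : r + 1 ≤ m) : β r ≠ 0 := by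
  intro h
  have := hZ.α_mul_β r hr hr'
  rw [h, mul_zero] at this
  exact hZ.ω_ne_zero r hr (by omega) this.symm

/-- The product is `k α_r` for a scalar `k`; a further left multiplication by `ω_r` gives `k ω_r α_r
= 0`, and either factor being zero suffices. -/
theorem ω_mul_α (hZ : IsZigzag K m e α β ω) (hr : 1 ≤ r) (hr' : r + 1 ≤ m) : ω r * α r = 0 := by
  obtain ⟨k, hk⟩ := hZ.up r hr hr' (ω r * α r)
  rw [← mul_assoc, hZ.e_mul_ω r hr (by omega), mul_assoc, hZ.α_mul_e r hr hr'] at hk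
  have h := congrArg (ω r * ·) hk
  simp only [← mul_assoc, hZ.ω_mul_self r hr (by omega), zero_mul, mul_smul_comm] at h
  rcases smul_eq_zero.mp h.symm with h | h
  · rw [hk, h, zero_smul]
  · exact h

theorem ω_mul_β (hZ : IsZigzag K m e α β ω) (hr : 1 ≤ r) (hr' : r + 1 ≤ m) :
    ω (r + 1) * β r = 0 := by
  obtain ⟨k, hk⟩ := hZ.down r hr hr' (ω (r + 1) * β r)
  rw [← mul_assoc, hZ.e_mul_ω _ (by omega) hr', mul_assoc, hZ.β_mul_e r hr hr'] at hk
  have h := congrArg (ω (r + 1) * ·) hk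
  simp only [← mul_assoc, hZ.ω_mul_self _ (by omega) hr', zero_mul, mul_smul_comm] at h
  rcases smul_eq_zero.mp h.symm with h | h
  · rw [hk, h, zero_smul]
  · exact h

theorem ω_mul_mul_e (hZ : IsZigzag K m e α β ω) (hr : 1 ≤ r) (hr' : r ≤ m) {t : ℕ} (ht : 1 ≤ t)
    (ht' : t ≤ m) (hrt : r ≠ t) (x : S) : ω r * x * e t = 0 := by
  rw [← hZ.ω_mul_e r hr hr', mul_assoc, mul_assoc, ← mul_assoc (e r)]
  by_cases h₁ : t = r + 1
  · subst h₁
    obtain ⟨c, hc⟩ := hZ.up r hr ht' x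
    rw [hc, mul_smul_comm, hZ.ω_mul_α hr ht', smul_zero]
  by_cases h₂ : r = t + 1
  · subst h₂
    obtain ⟨c, hc⟩ := hZ.down t ht hr' x
    rw [hc, mul_smul_comm, hZ.ω_mul_β ht hr', smul_zero]
  · rw [hZ.far r t hr hr' ht ht' (by omega), mul_zero]

theorem eq_sum (hsum : ∑ t ∈ Finset.Icc 1 m, e t = 1) (x : S) :
    x = ∑ t ∈ Finset.Icc 1 m, x * e t := by
  rw [← Finset.mul_sum, hsum, mul_one]

theorem ω_mul_eq (hZ : IsZigzag K m e α β ω) (hsum : ∑ t ∈ Finset.Icc 1 m, e t = 1) (hr : 1 ≤ r)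
    (hr' : r ≤ m) (x : S) : ω r * x = ω r * x * e r := by
  conv_lhs => rw [eq_sum hsum (ω r * x)]
  refine Finset.sum_eq_single r (fun t ht hne => ?_) fun h => ?_
  · rw [Finset.mem_Icc] at ht
    exact hZ.ω_mul_mul_e hr hr' ht.1 ht.2 hne.symm x
  · exact (h (Finset.mem_Icc.mpr ⟨hr, hr'⟩)).elim

/-- Thus `ω_r S` is a line, on which `x` acts by the coefficient of `e_r` in `e_r x e_r`. -/
theorem ω_mul_eq_smul (hZ : IsZigzag K m e α β ω) (hsum : ∑ t ∈ Finset.Icc 1 m, e t = 1)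
    (hr : 1 ≤ r) (hr' : r ≤ m) {x : S} {a b : K} (h : e r * x * e r = a • e r + b • ω r) :
    ω r * x = a • ω r := by
  rw [hZ.ω_mul_eq hsum hr hr', ← hZ.ω_mul_e r hr hr', mul_assoc, mul_assoc, ← mul_assoc (e r), h,
    mul_add, mul_smul_comm, mul_smul_comm, hZ.ω_mul_e r hr hr', hZ.ω_mul_self r hr hr', smul_zero,
    add_zero]

theorem exists_ω_mul_eq (hZ : IsZigzag K m e α β ω) (hsum : ∑ t ∈ Finset.Icc 1 m, e t = 1)
    (hr : 1 ≤ r) (hr' : r ≤ m) (x : S) : ∃ a : K, ω r * x = a • ω r := by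
  obtain ⟨a, b, h⟩ := hZ.diag r hr hr' x
  exact ⟨a, hZ.ω_mul_eq_smul hsum hr hr' h⟩

variable {P : Submodule Sᵐᵒᵖ S}

/-- Left multiplication, as a homomorphism of right modules. -/
def leftMul (w : S) (P : Submodule Sᵐᵒᵖ S) : P →ₗ[Sᵐᵒᵖ] S where
  toFun x := w * x.1
  map_add' x y := mul_add w x.1 y.1
  map_smul' a x := (mul_assoc w x.1 a.unop).symm

theorem e_mem (hZ : IsZigzag K m e α β ω) (hr : 1 ≤ r) (hr' : r ≤ m)
    (hP : ∀ x, x ∈ P ↔ e r * x = x) : e r ∈ P := (hP _).mpr (hZ.e_mul_self r hr hr')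

theorem ker_leftMul_ne_top (hZ : IsZigzag K m e α β ω) (hr : 1 ≤ r) (hr' : r ≤ m)
    (hP : ∀ x, x ∈ P ↔ e r * x = x) : LinearMap.ker (leftMul (ω r) P) ≠ ⊤ := by
  intro h
  have h1 : (⟨e r, hZ.e_mem hr hr' hP⟩ : P) ∈ LinearMap.ker (leftMul (ω r) P) :=
    h ▸ Submodule.mem_top
  have h2 : ω r * e r = 0 := h1
  rw [hZ.ω_mul_e r hr hr'] at h2
  exact hZ.ω_ne_zero r hr hr' h2

theorem le_ker_or_eq_top (hZ : IsZigzag K m e α β ω) (hsum : ∑ t ∈ Finset.Icc 1 m, e t = 1)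
    (hr : 1 ≤ r) (hr' : r ≤ m) (hP : ∀ x, x ∈ P ↔ e r * x = x) (N : Submodule Sᵐᵒᵖ P) :
    N ≤ LinearMap.ker (leftMul (ω r) P) ∨ N = ⊤ := by
  by_cases h : N ≤ LinearMap.ker (leftMul (ω r) P)
  · exact Or.inl h
  right
  obtain ⟨x, hx, hx0⟩ := SetLike.not_le_iff_exists.mp h
  have hx0' : ω r * x.1 ≠ 0 := hx0
  obtain ⟨a, b, hab⟩ := hZ.diag r hr hr' x.1
  rw [hZ.ω_mul_eq_smul hsum hr hr' hab] at hx0'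
  have ha : a ≠ 0 := fun h => hx0' (by rw [h, zero_smul])
  rw [(hP x.1).mp x.2] at hab
  -- In the local ring `e_r S e_r` the element `a e_r + b ω_r` is invertible, because `ω_r² = 0`;
  -- this is its inverse. Hence `x` generates all of `e_r S`.
  have hinv : x.1 * (e r * (a⁻¹ • e r - (a⁻¹ * a⁻¹ * b) • ω r)) = e r := by
    rw [← mul_assoc, hab, mul_sub, add_mul, add_mul]
    simp only [smul_mul_assoc, mul_smul_comm, hZ.e_mul_self r hr hr', hZ.e_mul_ω r hr hr',
      hZ.ω_mul_e r hr hr', hZ.ω_mul_self r hr hr', smul_zero, add_zero, smul_smul]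
    have : a⁻¹ * b - a⁻¹ * a⁻¹ * b * a = 0 := by field_simp; ring
    rw [inv_mul_cancel₀ ha, one_smul, add_sub_assoc, ← sub_smul, this, zero_smul, add_zero]
  rw [eq_top_iff]
  intro y _
  have : y = MulOpposite.op (e r * (a⁻¹ • e r - (a⁻¹ * a⁻¹ * b) • ω r) * y.1) • x := by
    apply Subtype.ext
    change y.1 = x.1 * (e r * (a⁻¹ • e r - (a⁻¹ * a⁻¹ * b) • ω r) * y.1)
    rw [← mul_assoc, hinv, (hP y.1).mp y.2]
  rw [this]
  exact N.smul_mem _ hx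

theorem jacobson_eq (hZ : IsZigzag K m e α β ω) (hsum : ∑ t ∈ Finset.Icc 1 m, e t = 1)
    (hr : 1 ≤ r) (hr' : r ≤ m) (hP : ∀ x, x ∈ P ↔ e r * x = x) :
    Module.jacobson Sᵐᵒᵖ P = LinearMap.ker (leftMul (ω r) P) :=
  jacobson_eq_of_forall_le (hZ.ker_leftMul_ne_top hr hr' hP) (hZ.le_ker_or_eq_top hsum hr hr' hP)

theorem mem_jacobson (hZ : IsZigzag K m e α β ω) (hsum : ∑ t ∈ Finset.Icc 1 m, e t = 1)
    (hr : 1 ≤ r) (hr' : r ≤ m) (hP : ∀ x, x ∈ P ↔ e r * x = x) {x : P} :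
    x ∈ Module.jacobson Sᵐᵒᵖ P ↔ ω r * x.1 = 0 := by
  rw [hZ.jacobson_eq hsum hr hr' hP]
  rfl

theorem isCoatom_jacobson (hZ : IsZigzag K m e α β ω) (hsum : ∑ t ∈ Finset.Icc 1 m, e t = 1)
    (hr : 1 ≤ r) (hr' : r ≤ m) (hP : ∀ x, x ∈ P ↔ e r * x = x) :
    IsCoatom (Module.jacobson Sᵐᵒᵖ P) := by
  rw [hZ.jacobson_eq hsum hr hr' hP]
  exact isCoatom_of_forall_le (hZ.ker_leftMul_ne_top hr hr' hP)
    (hZ.le_ker_or_eq_top hsum hr hr' hP)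

theorem isSimpleModule_top (hZ : IsZigzag K m e α β ω) (hsum : ∑ t ∈ Finset.Icc 1 m, e t = 1)
    (hr : 1 ≤ r) (hr' : r ≤ m) (hP : ∀ x, x ∈ P ↔ e r * x = x) :
    IsSimpleModule Sᵐᵒᵖ (P ⧸ Module.jacobson Sᵐᵒᵖ P) :=
  isSimpleModule_iff_isCoatom.mpr (hZ.isCoatom_jacobson hsum hr hr' hP)

theorem mk_e_ne_zero (hZ : IsZigzag K m e α β ω) (hsum : ∑ t ∈ Finset.Icc 1 m, e t = 1)
    (hr : 1 ≤ r) (hr' : r ≤ m) (hP : ∀ x, x ∈ P ↔ e r * x = x) :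
    Submodule.Quotient.mk (p := Module.jacobson Sᵐᵒᵖ P) ⟨e r, hZ.e_mem hr hr' hP⟩ ≠ 0 := by
  rw [ne_eq, Submodule.Quotient.mk_eq_zero, hZ.mem_jacobson hsum hr hr' hP]
  change ω r * e r ≠ 0
  rw [hZ.ω_mul_e r hr hr']
  exact hZ.ω_ne_zero r hr hr'

theorem finrank_top (hZ : IsZigzag K m e α β ω) (hsum : ∑ t ∈ Finset.Icc 1 m, e t = 1)
    (hr : 1 ≤ r) (hr' : r ≤ m) (hP : ∀ x, x ∈ P ↔ e r * x = x) :
    Module.finrank K (P ⧸ Module.jacobson Sᵐᵒᵖ P) = 1 := by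
  rw [finrank_eq_one_iff_of_nonzero' _ (hZ.mk_e_ne_zero hsum hr hr' hP)]
  intro w
  obtain ⟨x, rfl⟩ := Submodule.Quotient.mk_surjective _ w
  obtain ⟨a, b, hab⟩ := hZ.diag r hr hr' x.1
  refine ⟨a, ?_⟩
  rw [← Submodule.Quotient.mk_smul, Submodule.Quotient.eq, hZ.mem_jacobson hsum hr hr' hP]
  change ω r * (a • e r - x.1) = 0
  rw [mul_sub, mul_smul_comm, hZ.ω_mul_e r hr hr', hZ.ω_mul_eq_smul hsum hr hr' hab, sub_self]

/-- The tops are told apart by the idempotents: `e_r` fixes the class of `e_r` in its own top and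
kills the top belonging to any other index. -/
theorem eq_of_top_equiv (hZ : IsZigzag K m e α β ω) (hsum : ∑ t ∈ Finset.Icc 1 m, e t = 1)
    (hr : 1 ≤ r) (hr' : r ≤ m) (hP : ∀ x, x ∈ P ↔ e r * x = x) {s : ℕ} (hs : 1 ≤ s) (hs' : s ≤ m)
    {Q : Submodule Sᵐᵒᵖ S} (hQ : ∀ x, x ∈ Q ↔ e s * x = x)
    (f : (P ⧸ Module.jacobson Sᵐᵒᵖ P) ≃ₗ[Sᵐᵒᵖ] (Q ⧸ Module.jacobson Sᵐᵒᵖ Q)) : r = s := by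
  by_contra hne
  refine hZ.mk_e_ne_zero hsum hr hr' hP (f.injective ?_)
  rw [map_zero]
  have h1 : (⟨e r, hZ.e_mem hr hr' hP⟩ : P) =
      MulOpposite.op (e r) • (⟨e r, hZ.e_mem hr hr' hP⟩ : P) :=
    Subtype.ext (hZ.e_mul_self r hr hr').symm
  rw [h1, Submodule.Quotient.mk_smul, map_smul]
  obtain ⟨y, hy⟩ := Submodule.Quotient.mk_surjective _
    (f (Submodule.Quotient.mk ⟨e r, hZ.e_mem hr hr' hP⟩))
  rw [← hy, ← Submodule.Quotient.mk_smul, Submodule.Quotient.mk_eq_zero,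
    hZ.mem_jacobson hsum hs hs' hQ]
  change ω s * (y.1 * e r) = 0
  rw [← mul_assoc, hZ.ω_mul_mul_e hs hs' hr hr' (Ne.symm hne)]

/-- As the idempotents sum to one, some `e_r` does not kill a given `v ≠ 0`. Then `x ↦ v x` maps
`e_r S` onto `M`, and its kernel is the unique maximal submodule. -/
theorem exists_equiv_top (hZ : IsZigzag K m e α β ω) (hsum : ∑ t ∈ Finset.Icc 1 m, e t = 1)
    {P : ℕ → Submodule Sᵐᵒᵖ S} (hP : ∀ r, 1 ≤ r → r ≤ m → ∀ x, x ∈ P r ↔ e r * x = x)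
    (M : Type*) [AddCommGroup M] [Module Sᵐᵒᵖ M] [IsSimpleModule Sᵐᵒᵖ M] :
    ∃ r ∈ Finset.Icc 1 m, Nonempty (M ≃ₗ[Sᵐᵒᵖ] (P r ⧸ Module.jacobson Sᵐᵒᵖ (P r))) := by
  have : Nontrivial M := IsSimpleModule.nontrivial Sᵐᵒᵖ M
  obtain ⟨v, hv⟩ := exists_ne (0 : M)
  obtain ⟨r, hr, hvr⟩ : ∃ r ∈ Finset.Icc 1 m, MulOpposite.op (e r) • v ≠ 0 := by
    by_contra! hcon
    apply hv
    rw [← one_smul Sᵐᵒᵖ v, ← MulOpposite.op_one, ← hsum, Finset.op_sum, Finset.sum_smul]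
    exact Finset.sum_eq_zero hcon
  have hr' := Finset.mem_Icc.mp hr
  have hPr := hP r hr'.1 hr'.2
  refine ⟨r, hr, ?_⟩
  let g : P r →ₗ[Sᵐᵒᵖ] M :=
    { toFun := fun x => MulOpposite.op x.1 • v
      map_add' := fun x y => add_smul (MulOpposite.op x.1) (MulOpposite.op y.1) v
      map_smul' := fun a x => mul_smul a (MulOpposite.op x.1) v }
  have hg0 : g ≠ 0 := fun h =>
    hvr (LinearMap.congr_fun h (⟨e r, hZ.e_mem hr'.1 hr'.2 hPr⟩ : P r))
  have hsurj : Function.Surjective g := LinearMap.surjective_of_ne_zero hg0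
  have hker : IsCoatom (LinearMap.ker g) := by
    rw [← isSimpleModule_iff_isCoatom]
    exact IsSimpleModule.congr (LinearMap.quotKerEquivOfSurjective g hsurj)
  have heq : LinearMap.ker g = Module.jacobson Sᵐᵒᵖ (P r) := by
    have hle : LinearMap.ker g ≤ Module.jacobson Sᵐᵒᵖ (P r) := by
      rw [hZ.jacobson_eq hsum hr'.1 hr'.2 hPr]
      exact (hZ.le_ker_or_eq_top hsum hr'.1 hr'.2 hPr _).resolve_right hker.1
    exact ((hker.le_iff.mp hle).resolve_left
      (hZ.isCoatom_jacobson hsum hr'.1 hr'.2 hPr).1).symm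
  exact ⟨(LinearMap.quotKerEquivOfSurjective g hsurj).symm.trans
    (Submodule.quotEquivOfEq _ _ heq)⟩

/-! ### Radicals and socles as subspaces -/

theorem exists_eq_add_of_ω_mul_eq_zero (hZ : IsZigzag K m e α β ω)
    (hsum : ∑ t ∈ Finset.Icc 1 m, e t = 1) (hr : 1 ≤ r) (hr' : r ≤ m) {x : S}
    (hx : e r * x = x) (hωx : ω r * x = 0) :
    ∃ b : K, x = b • ω r + (if r + 1 ≤ m then x * e (r + 1) else 0) +
      (if 2 ≤ r then x * e (r - 1) else 0) := by
  obtain ⟨a, b, hab⟩ := hZ.diag r hr hr' x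
  have ha : a = 0 := by
    rw [hZ.ω_mul_eq_smul hsum hr hr' hab] at hωx
    exact (smul_eq_zero.mp hωx).resolve_right (hZ.ω_ne_zero r hr hr')
  rw [ha, zero_smul, zero_add, hx] at hab
  -- Only `t = r` and its neighbours contribute. For `r = 1` the truncated value `r - 1 = 0` lies
  -- outside the range of summation.
  have hterm : ∀ t ∈ Finset.Icc 1 m, x * e t = (if t = r then b • ω r else 0) +
      (if t = r + 1 then x * e (r + 1) else 0) + (if t = r - 1 then x * e (r - 1) else 0) := by
    intro t ht
    rw [Finset.mem_Icc] at ht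
    by_cases h₁ : t = r
    · rw [if_pos h₁, if_neg (by omega), if_neg (by omega), h₁, hab, add_zero, add_zero]
    by_cases h₂ : t = r + 1
    · rw [if_neg h₁, if_pos h₂, if_neg (by omega), h₂, zero_add, add_zero]
    by_cases h₃ : t = r - 1
    · rw [if_neg h₁, if_neg h₂, if_pos h₃, h₃, zero_add, zero_add]
    · rw [if_neg h₁, if_neg h₂, if_neg h₃, add_zero, add_zero, ← hx,
        hZ.far r t hr hr' ht.1 ht.2 (by omega)]
  refine ⟨b, ?_⟩
  conv_lhs => rw [eq_sum hsum x, Finset.sum_congr rfl hterm, Finset.sum_add_distrib,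
    Finset.sum_add_distrib, Finset.sum_ite_eq', Finset.sum_ite_eq', Finset.sum_ite_eq']
  simp only [Finset.mem_Icc]
  rw [if_pos ⟨hr, hr'⟩]
  congr 2
  · simp only [show 1 ≤ r + 1 by omega, true_and]
  · simp only [show (1 ≤ r - 1 ∧ r - 1 ≤ m) ↔ 2 ≤ r by omega]

theorem exists_up (hZ : IsZigzag K m e α β ω) (hr : 1 ≤ r) (hr' : r + 1 ≤ m) {x : S}
    (hx : e r * x = x) : ∃ a : K, x * e (r + 1) = a • α r := by
  obtain ⟨a, h⟩ := hZ.up r hr hr' x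
  exact ⟨a, by rw [← h, hx]⟩

theorem exists_down (hZ : IsZigzag K m e α β ω) (hr : 2 ≤ r) (hr' : r ≤ m) {x : S}
    (hx : e r * x = x) : ∃ a : K, x * e (r - 1) = a • β (r - 1) := by
  obtain ⟨a, h⟩ := hZ.down (r - 1) (by omega) (by omega) x
  rw [Nat.sub_add_cancel (by omega)] at h
  exact ⟨a, by rw [← h, hx]⟩

/-- The radical of `e_r S`, as a subspace. -/
def radSpace (K : Type*) {S : Type*} [Field K] [Ring S] [Algebra K S] (a w : S) :
    Submodule K S where
  carrier := {x | a * x = x ∧ w * x = 0}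
  zero_mem' := by simp
  add_mem' := fun {x y} hx hy => by
    refine ⟨?_, ?_⟩
    · rw [mul_add, hx.1, hy.1]
    · rw [mul_add, hx.2, hy.2, add_zero]
  smul_mem' := fun c x hx => by
    refine ⟨?_, ?_⟩
    · rw [mul_smul_comm, hx.1]
    · rw [mul_smul_comm, hx.2, smul_zero]

theorem coe_jacobson (hZ : IsZigzag K m e α β ω) (hsum : ∑ t ∈ Finset.Icc 1 m, e t = 1)
    (hr : 1 ≤ r) (hr' : r ≤ m) (hP : ∀ x, x ∈ P ↔ e r * x = x) :
    {y | ∃ z ∈ Module.jacobson Sᵐᵒᵖ P, z.1 = y} = (radSpace K (e r) (ω r) : Set S) := by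
  ext y
  constructor
  · rintro ⟨z, hz, rfl⟩
    exact ⟨(hP _).mp z.2, (hZ.mem_jacobson hsum hr hr' hP).mp hz⟩
  · rintro ⟨h₁, h₂⟩
    exact ⟨⟨y, (hP y).mpr h₁⟩, (hZ.mem_jacobson hsum hr hr' hP).mpr h₂, rfl⟩

theorem ω_mem_radSpace (hZ : IsZigzag K m e α β ω) (hr : 1 ≤ r) (hr' : r ≤ m) :
    ω r ∈ radSpace K (e r) (ω r) := ⟨hZ.e_mul_ω r hr hr', hZ.ω_mul_self r hr hr'⟩

theorem α_mem_radSpace (hZ : IsZigzag K m e α β ω) (hr : 1 ≤ r) (hr' : r + 1 ≤ m) :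
    α r ∈ radSpace K (e r) (ω r) := ⟨hZ.e_mul_α r hr hr', hZ.ω_mul_α hr hr'⟩

theorem β_mem_radSpace (hZ : IsZigzag K m e α β ω) (hr : 1 ≤ r) (hr' : r + 1 ≤ m) :
    β r ∈ radSpace K (e (r + 1)) (ω (r + 1)) := ⟨hZ.e_mul_β r hr hr', hZ.ω_mul_β hr hr'⟩

theorem α_mul_e_of_ne (hZ : IsZigzag K m e α β ω) (hr : 1 ≤ r) (hr' : r + 1 ≤ m) {t : ℕ}
    (ht : 1 ≤ t) (ht' : t ≤ m) (h : t ≠ r + 1) : α r * e t = 0 := by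
  rw [← hZ.α_mul_e r hr hr', mul_assoc, hZ.e_mul_e _ t (by omega) hr' ht ht' h.symm, mul_zero]

theorem β_mul_e_of_ne (hZ : IsZigzag K m e α β ω) (hr : 1 ≤ r) (hr' : r + 1 ≤ m) {t : ℕ}
    (ht : 1 ≤ t) (ht' : t ≤ m) (h : t ≠ r) : β r * e t = 0 := by
  rw [← hZ.β_mul_e r hr hr', mul_assoc, hZ.e_mul_e r t hr (by omega) ht ht' h.symm, mul_zero]

theorem ω_mul_e_of_ne (hZ : IsZigzag K m e α β ω) (hr : 1 ≤ r) (hr' : r ≤ m) {t : ℕ}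
    (ht : 1 ≤ t) (ht' : t ≤ m) (h : t ≠ r) : ω r * e t = 0 := by
  rw [← hZ.ω_mul_e r hr hr', mul_assoc, hZ.e_mul_e r t hr hr' ht ht' h.symm, mul_zero]

/-- The three elements end at the distinct vertices `r + 1`, `r - 1` and `r`, so right
multiplication by idempotents separates their coefficients; for spanning, `x` is split as the sum of
the `x e_t`. -/
theorem isBasisOf_radSpace (hZ : IsZigzag K m e α β ω) (hsum : ∑ t ∈ Finset.Icc 1 m, e t = 1)
    (hr : 2 ≤ r) (hr' : r + 1 ≤ m) :
    IsBasisOf K ![α r, β (r - 1), ω r] (radSpace K (e r) (ω r)) := by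
  obtain ⟨t, rfl⟩ : ∃ t, r = t + 1 := ⟨r - 1, by omega⟩
  rw [Nat.add_sub_cancel]
  constructor
  · rw [Fintype.linearIndependent_iff]
    intro g hg
    replace hg : g 0 • α (t + 1) + g 1 • β t + g 2 • ω (t + 1) = 0 := by
      rw [Fin.sum_univ_three] at hg
      exact hg
    have h₀ := congrArg (· * e (t + 1 + 1)) hg
    simp only [add_mul, smul_mul_assoc, hZ.α_mul_e (t + 1) (by omega) hr',
      hZ.β_mul_e_of_ne (r := t) (t := t + 1 + 1) (by omega) (by omega) (by omega) hr' (by omega),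
      hZ.ω_mul_e_of_ne (r := t + 1) (t := t + 1 + 1) (by omega) (by omega) (by omega) hr'
      (by omega), smul_zero, add_zero, zero_mul] at h₀
    have h₁ := congrArg (· * e t) hg
    simp only [add_mul, smul_mul_assoc, hZ.β_mul_e t (by omega) (by omega),
      hZ.α_mul_e_of_ne (r := t + 1) (t := t) (by omega) hr' (by omega) (by omega) (by omega),
      hZ.ω_mul_e_of_ne (r := t + 1) (t := t) (by omega) (by omega) (by omega) (by omega)
      (by omega), smul_zero, add_zero, zero_add, zero_mul] at h₁
    have g₀ := (smul_eq_zero.mp h₀).resolve_right (hZ.α_ne_zero (by omega) hr')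
    have g₁ := (smul_eq_zero.mp h₁).resolve_right (hZ.β_ne_zero (by omega) (by omega))
    rw [g₀, g₁, zero_smul, zero_smul, zero_add, zero_add] at hg
    have g₂ := (smul_eq_zero.mp hg).resolve_right (hZ.ω_ne_zero _ (by omega) (by omega))
    intro i
    fin_cases i
    · exact g₀
    · exact g₁
    · exact g₂
  · refine congrArg _ (le_antisymm ?_ ?_)
    · rw [Submodule.span_le]
      rintro _ ⟨i, rfl⟩
      fin_cases i
      · exact hZ.α_mem_radSpace (by omega) hr'
      · exact hZ.β_mem_radSpace (by omega) (by omega)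
      · exact hZ.ω_mem_radSpace (by omega) (by omega)
    · rintro x ⟨hx, hωx⟩
      obtain ⟨b, hb⟩ := hZ.exists_eq_add_of_ω_mul_eq_zero hsum (by omega) (by omega) hx hωx
      obtain ⟨a, ha⟩ := hZ.exists_up (by omega) hr' hx
      obtain ⟨c, hc⟩ := hZ.exists_down hr (by omega) hx
      rw [if_pos hr', if_pos hr, ha, hc] at hb
      rw [hb]
      exact add_mem (add_mem (Submodule.smul_mem _ _ (Submodule.subset_span ⟨2, rfl⟩))
        (Submodule.smul_mem _ _ (Submodule.subset_span ⟨0, rfl⟩)))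
        (Submodule.smul_mem _ _ (Submodule.subset_span ⟨1, rfl⟩))

theorem isBasisOf_radSpace_first (hZ : IsZigzag K m e α β ω)
    (hsum : ∑ t ∈ Finset.Icc 1 m, e t = 1) (hm : 2 ≤ m) :
    IsBasisOf K ![α 1, ω 1] (radSpace K (e 1) (ω 1)) := by
  constructor
  · rw [LinearIndependent.pair_iff]
    intro a b h
    have h₀ := congrArg (· * e (1 + 1)) h
    simp only [add_mul, smul_mul_assoc, hZ.α_mul_e 1 le_rfl hm,
      hZ.ω_mul_e_of_ne (r := 1) (t := 1 + 1) le_rfl (by omega) (by omega) hm (by omega),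
      smul_zero, add_zero, zero_mul] at h₀
    have ha := (smul_eq_zero.mp h₀).resolve_right (hZ.α_ne_zero le_rfl hm)
    rw [ha, zero_smul, zero_add] at h
    exact ⟨ha, (smul_eq_zero.mp h).resolve_right (hZ.ω_ne_zero 1 le_rfl (by omega))⟩
  · refine congrArg _ (le_antisymm ?_ ?_)
    · rw [Submodule.span_le]
      rintro _ ⟨i, rfl⟩
      fin_cases i
      · exact hZ.α_mem_radSpace le_rfl hm
      · exact hZ.ω_mem_radSpace le_rfl (by omega)
    · rintro x ⟨hx, hωx⟩
      obtain ⟨b, hb⟩ := hZ.exists_eq_add_of_ω_mul_eq_zero hsum le_rfl (by omega) hx hωx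
      obtain ⟨a, ha⟩ := hZ.exists_up le_rfl hm hx
      rw [if_pos hm, if_neg (by omega), ha, add_zero] at hb
      rw [hb]
      exact add_mem (Submodule.smul_mem _ _ (Submodule.subset_span ⟨1, rfl⟩))
        (Submodule.smul_mem _ _ (Submodule.subset_span ⟨0, rfl⟩))

theorem isBasisOf_radSpace_last (hZ : IsZigzag K m e α β ω)
    (hsum : ∑ t ∈ Finset.Icc 1 m, e t = 1) (hm : 2 ≤ m) :
    IsBasisOf K ![β (m - 1), ω m] (radSpace K (e m) (ω m)) := by
  obtain ⟨t, rfl⟩ : ∃ t, m = t + 1 := ⟨m - 1, by omega⟩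
  rw [Nat.add_sub_cancel]
  have ht : 1 ≤ t := by omega
  constructor
  · rw [LinearIndependent.pair_iff]
    intro a b h
    have h₀ := congrArg (· * e t) h
    simp only [add_mul, smul_mul_assoc, hZ.β_mul_e t ht le_rfl,
      hZ.ω_mul_e_of_ne (r := t + 1) (t := t) (by omega) le_rfl ht (by omega) (by omega),
      smul_zero, add_zero, zero_mul] at h₀
    have ha := (smul_eq_zero.mp h₀).resolve_right (hZ.β_ne_zero ht le_rfl)
    rw [ha, zero_smul, zero_add] at h
    exact ⟨ha, (smul_eq_zero.mp h).resolve_right (hZ.ω_ne_zero _ (by omega) le_rfl)⟩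
  · refine congrArg _ (le_antisymm ?_ ?_)
    · rw [Submodule.span_le]
      rintro _ ⟨i, rfl⟩
      fin_cases i
      · exact hZ.β_mem_radSpace ht le_rfl
      · exact hZ.ω_mem_radSpace (by omega) le_rfl
    · rintro x ⟨hx, hωx⟩
      obtain ⟨b, hb⟩ := hZ.exists_eq_add_of_ω_mul_eq_zero hsum (by omega) le_rfl hx hωx
      obtain ⟨c, hc⟩ := hZ.exists_down hm le_rfl hx
      rw [if_neg (by omega), if_pos hm, hc, add_zero] at hb
      rw [hb]
      exact add_mem (Submodule.smul_mem _ _ (Submodule.subset_span ⟨1, rfl⟩))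
        (Submodule.smul_mem _ _ (Submodule.subset_span ⟨0, rfl⟩))

theorem coe_socle (hZ : IsZigzag K m e α β ω) (hsum : ∑ t ∈ Finset.Icc 1 m, e t = 1)
    (hr : 1 ≤ r) (hr' : r ≤ m) (hP : ∀ x, x ∈ P ↔ e r * x = x) :
    {y | ∃ z ∈ socle Sᵐᵒᵖ P, z.1 = y} = (Submodule.span K {ω r} : Set S) := by
  rw [hZ.socle_eq hr hr' hP]
  ext y
  simp only [Set.mem_ofPred_eq, SetLike.mem_coe, Submodule.mem_span_singleton]
  constructor
  · rintro ⟨_, ⟨a, rfl⟩, rfl⟩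
    obtain ⟨c, hc⟩ := hZ.exists_ω_mul_eq hsum hr hr' a.unop
    exact ⟨c, hc.symm⟩
  · rintro ⟨c, rfl⟩
    refine ⟨_, ⟨MulOpposite.op (algebraMap K S c), rfl⟩, ?_⟩
    change ω r * algebraMap K S c = c • ω r
    rw [← Algebra.commutes, ← Algebra.smul_def]

theorem span_ω_le_socle (hZ : IsZigzag K m e α β ω)
    (hr : 1 ≤ r) (hr' : r ≤ m) : Submodule.span Sᵐᵒᵖ {ω r} ≤ socle Sᵐᵒᵖ S := by
  refine le_sSup (isSimpleModule_iff_isAtom.mpr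
    (isAtom_span_of_forall_mem (hZ.ω_ne_zero r hr hr') fun x hx hx0 => ?_))
  obtain ⟨a, rfl⟩ := Submodule.mem_span_singleton.mp hx
  have hx' : e r * (a • ω r) = a • ω r := by
    rw [mul_smul_comm, hZ.e_mul_ω r hr hr']
  obtain ⟨y, hy⟩ := hZ.exists_mul_eq hr hr' hx' hx0
  exact Submodule.mem_span_singleton.mpr ⟨MulOpposite.op y, hy⟩

/-- Since `ω_r S` is a line, the condition defines a right submodule and may be checked on a simple
submodule `N`. -/
theorem exists_e_mul_eq_of_mem_socle (hZ : IsZigzag K m e α β ω)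
    (hsum : ∑ t ∈ Finset.Icc 1 m, e t = 1) (hr : 1 ≤ r) (hr' : r ≤ m) {x : S}
    (hx : x ∈ socle Sᵐᵒᵖ S) : ∃ c : K, e r * x = c • ω r := by
  let D : Submodule Sᵐᵒᵖ S :=
    { carrier := {x | ∃ c : K, e r * x = c • ω r}
      zero_mem' := ⟨0, by simp⟩
      add_mem' := by
        rintro x y ⟨c, hc⟩ ⟨d, hd⟩
        exact ⟨c + d, by rw [mul_add, hc, hd, add_smul]⟩
      smul_mem' := by
        rintro a x ⟨c, hc⟩
        obtain ⟨d, hd⟩ := hZ.exists_ω_mul_eq hsum hr hr' a.unop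
        refine ⟨c * d, ?_⟩
        change e r * (x * a.unop) = _
        rw [← mul_assoc, hc, smul_mul_assoc, hd, smul_smul] }
  suffices h : socle Sᵐᵒᵖ S ≤ D from h hx
  refine sSup_le fun N hN x hx => ?_
  have hN' : IsSimpleModule Sᵐᵒᵖ N := hN
  by_cases h0 : e r * x = 0
  · exact ⟨0, by rw [h0, zero_smul]⟩
  obtain ⟨y, hy⟩ := hZ.exists_mul_eq hr hr' (x := e r * x)
    (by rw [← mul_assoc, hZ.e_mul_self r hr hr']) h0
  have hxy : (⟨x * y, N.smul_mem (MulOpposite.op y) hx⟩ : N) ≠ 0 := by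
    intro h
    have h' : x * y = 0 := congrArg Subtype.val h
    rw [mul_assoc, h', mul_zero] at hy
    exact hZ.ω_ne_zero r hr hr' hy.symm
  -- The nonzero element `x y` generates `N`, so `x = x y z` and `e_r x = ω_r z` lies on the line of
  -- `ω_r`.
  obtain ⟨z, hz⟩ := IsSimpleModule.toSpanSingleton_surjective Sᵐᵒᵖ hxy ⟨x, hx⟩
  have hz' : x * y * z.unop = x := congrArg Subtype.val hz
  obtain ⟨d, hd⟩ := hZ.exists_ω_mul_eq hsum hr hr' z.unop
  refine ⟨d, ?_⟩
  rw [← hz', ← mul_assoc, ← mul_assoc, hy, hd]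

theorem coe_socle_self (hZ : IsZigzag K m e α β ω) (hsum : ∑ t ∈ Finset.Icc 1 m, e t = 1) :
    (socle Sᵐᵒᵖ S : Set S) = (Submodule.span K (ω '' (Finset.Icc 1 m : Set ℕ)) : Set S) := by
  apply Set.Subset.antisymm
  · intro x hx
    have h : x = ∑ t ∈ Finset.Icc 1 m, e t * x := by rw [← Finset.sum_mul, hsum, one_mul]
    rw [h]
    refine Submodule.sum_mem _ fun t ht => ?_
    have ht' := Finset.mem_Icc.mp ht
    obtain ⟨c, hc⟩ := hZ.exists_e_mul_eq_of_mem_socle hsum ht'.1 ht'.2 hx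
    rw [hc]
    exact Submodule.smul_mem _ _ (Submodule.subset_span ⟨t, Finset.mem_coe.mpr ht, rfl⟩)
  · intro x hx
    induction hx using Submodule.span_induction with
    | mem x hx =>
      obtain ⟨t, ht, rfl⟩ := hx
      have ht' := Finset.mem_Icc.mp (Finset.mem_coe.mp ht)
      exact hZ.span_ω_le_socle ht'.1 ht'.2 (Submodule.mem_span_singleton_self _)
    | zero => exact zero_mem _
    | add x y _ _ hx hy => exact add_mem hx hy
    | smul c x _ hx =>
      have : c • x = MulOpposite.op (algebraMap K S c) • x := by
        change c • x = x * algebraMap K S c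
        rw [← Algebra.commutes, ← Algebra.smul_def]
      rw [this]
      exact Submodule.smul_mem _ _ hx

end Complete

end IsZigzag

end HeckeBlock

end

noncomputable section

namespace HeckeBlock

/-! ### Passing to the corner algebra -/

section Corner

variable {K R : Type*} [Field K] [Ring R] [Algebra K R] {E : R}

/-- The element `E x E` of the corner algebra. -/
def toCorner (hE : IsIdempotentElem E) (x : R) : CornerAlg hE := ⟨E * x * E, ⟨x, rfl⟩⟩

theorem cornerVal_toCorner (hE : IsIdempotentElem E) {x : R} (h : E * x = x) (h' : x * E = x) :
    cornerVal hE (toCorner hE x) = x := by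
  change E * x * E = x
  rw [h, h']

/-- The inclusion of the corner algebra, as a linear map. -/
def cornerValLinear (K : Type*) {R : Type*} [Field K] [Ring R] [Algebra K R] {E : R}
    (hE : IsIdempotentElem E) : CornerAlg hE →ₗ[K] R where
  toFun := cornerVal hE
  map_add' := map_add _
  map_smul' _ _ := rfl

theorem ker_cornerValLinear (hE : IsIdempotentElem E) :
    LinearMap.ker (cornerValLinear K hE) = ⊥ :=
  LinearMap.ker_eq_bot.mpr (cornerVal_injective hE)

theorem cornerVal_smul (hE : IsIdempotentElem E) (c : K) (a : CornerAlg hE) :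
    cornerVal hE (c • a) = c • cornerVal hE a := rfl

theorem image_cornerVal_span (hE : IsIdempotentElem E) (s : Set (CornerAlg hE)) :
    cornerVal hE '' (Submodule.span K s : Set (CornerAlg hE)) =
      (Submodule.span K (cornerVal hE '' s) : Set R) :=
  congrArg SetLike.coe (Submodule.map_span (cornerValLinear K hE) s)

theorem IsBasisOf.image_cornerVal (hE : IsIdempotentElem E) {ι : Type*} {v : ι → CornerAlg hE}
    {s : Set (CornerAlg hE)} (h : IsBasisOf K v s) :
    IsBasisOf K (cornerVal hE ∘ v) (cornerVal hE '' s) := by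
  refine ⟨h.1.map' (cornerValLinear K hE) (ker_cornerValLinear hE), ?_⟩
  rw [← h.2, image_cornerVal_span, Set.range_comp]

theorem asSubset_eq_image (hE : IsIdempotentElem E) {x : R}
    (N : Submodule (CornerAlg hE)ᵐᵒᵖ (cornerRightIdeal hE x)) :
    asSubset hE N = cornerVal hE '' {y | ∃ z ∈ N, z.1 = y} := by
  ext y
  constructor
  · rintro ⟨z, hz, rfl⟩
    exact ⟨z.1, ⟨z, hz, rfl⟩, rfl⟩
  · rintro ⟨_, ⟨z, hz, rfl⟩, rfl⟩
    exact ⟨z, hz, rfl⟩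

theorem mem_cornerRightIdeal_iff (hE : IsIdempotentElem E) {x : R} (hx : x * x = x)
    (h : E * x = x) (h' : x * E = x) (a : CornerAlg hE) :
    a ∈ cornerRightIdeal hE x ↔ toCorner hE x * a = a := by
  constructor
  · rintro ⟨g, hg⟩
    apply cornerVal_injective
    rw [cornerVal_mul, cornerVal_toCorner hE h h', hg, ← mul_assoc, ← mul_assoc, hx]
  · intro ha
    refine ⟨cornerVal hE a, ?_⟩
    conv_lhs => rw [← ha, cornerVal_mul, cornerVal_toCorner hE h h', ← cornerVal_mul_right hE a]
    rw [mul_assoc]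

end Corner

namespace IsZigzag

variable {K S : Type*} [Field K] [Ring S] [Algebra K S] {m : ℕ} {e α β ω : ℕ → S}

theorem sum_mul_e (hZ : IsZigzag K m e α β ω) {r : ℕ} (hr : 1 ≤ r) (hr' : r ≤ m) :
    (∑ t ∈ Finset.Icc 1 m, e t) * e r = e r := by
  rw [Finset.sum_mul, Finset.sum_eq_single r, hZ.e_mul_self r hr hr']
  · intro t ht hne
    rw [Finset.mem_Icc] at ht
    exact hZ.e_mul_e t r ht.1 ht.2 hr hr' hne
  · exact fun h => (h (Finset.mem_Icc.mpr ⟨hr, hr'⟩)).elim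

theorem e_mul_sum (hZ : IsZigzag K m e α β ω) {r : ℕ} (hr : 1 ≤ r) (hr' : r ≤ m) :
    e r * (∑ t ∈ Finset.Icc 1 m, e t) = e r := by
  rw [Finset.mul_sum, Finset.sum_eq_single r, hZ.e_mul_self r hr hr']
  · intro t ht hne
    rw [Finset.mem_Icc] at ht
    exact hZ.e_mul_e r t hr hr' ht.1 ht.2 hne.symm
  · exact fun h => (h (Finset.mem_Icc.mpr ⟨hr, hr'⟩)).elim

theorem isIdempotentElem_sum (hZ : IsZigzag K m e α β ω) :
    IsIdempotentElem (∑ t ∈ Finset.Icc 1 m, e t) := by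
  rw [IsIdempotentElem, Finset.mul_sum]
  refine Finset.sum_congr rfl fun t ht => ?_
  rw [Finset.mem_Icc] at ht
  exact hZ.sum_mul_e ht.1 ht.2

theorem cornerVal_toCorner_of_mul (hZ : IsZigzag K m e α β ω)
    (hE : IsIdempotentElem (∑ t ∈ Finset.Icc 1 m, e t)) {r t : ℕ} (hr : 1 ≤ r) (hr' : r ≤ m)
    (ht : 1 ≤ t) (ht' : t ≤ m) {x : S} (h : e r * x = x) (h' : x * e t = x) :
    cornerVal hE (toCorner hE x) = x := by
  apply cornerVal_toCorner
  · rw [← h, ← mul_assoc, hZ.sum_mul_e hr hr']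
  · rw [← h', mul_assoc, hZ.e_mul_sum ht ht']

theorem cornerVal_e (hZ : IsZigzag K m e α β ω)
    (hE : IsIdempotentElem (∑ t ∈ Finset.Icc 1 m, e t)) {r : ℕ} (hr : 1 ≤ r) (hr' : r ≤ m) :
    cornerVal hE (toCorner hE (e r)) = e r :=
  hZ.cornerVal_toCorner_of_mul hE hr hr' hr hr' (hZ.e_mul_self r hr hr') (hZ.e_mul_self r hr hr')

theorem cornerVal_α (hZ : IsZigzag K m e α β ω)
    (hE : IsIdempotentElem (∑ t ∈ Finset.Icc 1 m, e t)) {r : ℕ} (hr : 1 ≤ r) (hr' : r + 1 ≤ m) :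
    cornerVal hE (toCorner hE (α r)) = α r :=
  hZ.cornerVal_toCorner_of_mul hE hr (by omega) (by omega) hr' (hZ.e_mul_α r hr hr')
    (hZ.α_mul_e r hr hr')

theorem cornerVal_β (hZ : IsZigzag K m e α β ω)
    (hE : IsIdempotentElem (∑ t ∈ Finset.Icc 1 m, e t)) {r : ℕ} (hr : 1 ≤ r) (hr' : r + 1 ≤ m) :
    cornerVal hE (toCorner hE (β r)) = β r :=
  hZ.cornerVal_toCorner_of_mul hE (by omega) hr' hr (by omega) (hZ.e_mul_β r hr hr')
    (hZ.β_mul_e r hr hr')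

theorem cornerVal_ω (hZ : IsZigzag K m e α β ω)
    (hE : IsIdempotentElem (∑ t ∈ Finset.Icc 1 m, e t)) {r : ℕ} (hr : 1 ≤ r) (hr' : r ≤ m) :
    cornerVal hE (toCorner hE (ω r)) = ω r :=
  hZ.cornerVal_toCorner_of_mul hE hr hr' hr hr' (hZ.e_mul_ω r hr hr') (hZ.ω_mul_e r hr hr')

theorem sum_toCorner (hZ : IsZigzag K m e α β ω)
    (hE : IsIdempotentElem (∑ t ∈ Finset.Icc 1 m, e t)) :
    ∑ t ∈ Finset.Icc 1 m, toCorner hE (e t) = 1 := by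
  apply cornerVal_injective
  rw [map_sum]
  refine Finset.sum_congr rfl fun t ht => ?_
  rw [Finset.mem_Icc] at ht
  exact hZ.cornerVal_e hE ht.1 ht.2

theorem toCorner (hZ : IsZigzag K m e α β ω)
    (hE : IsIdempotentElem (∑ t ∈ Finset.Icc 1 m, e t)) :
    IsZigzag K m (fun r => toCorner hE (e r)) (fun r => toCorner hE (α r))
      (fun r => toCorner hE (β r)) (fun r => toCorner hE (ω r)) where
  e_mul_self r hr hr' := by
    apply cornerVal_injective
    rw [cornerVal_mul, hZ.cornerVal_e hE hr hr', hZ.e_mul_self r hr hr']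
  e_mul_e r t hr hr' ht ht' h := by
    apply cornerVal_injective
    rw [cornerVal_mul, hZ.cornerVal_e hE hr hr', hZ.cornerVal_e hE ht ht',
      hZ.e_mul_e r t hr hr' ht ht' h, map_zero]
  e_mul_α r hr hr' := by
    apply cornerVal_injective
    rw [cornerVal_mul, hZ.cornerVal_e hE hr (by omega), hZ.cornerVal_α hE hr hr',
      hZ.e_mul_α r hr hr']
  α_mul_e r hr hr' := by
    apply cornerVal_injective
    rw [cornerVal_mul, hZ.cornerVal_e hE (by omega) hr', hZ.cornerVal_α hE hr hr',
      hZ.α_mul_e r hr hr']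
  e_mul_β r hr hr' := by
    apply cornerVal_injective
    rw [cornerVal_mul, hZ.cornerVal_e hE (by omega) hr', hZ.cornerVal_β hE hr hr',
      hZ.e_mul_β r hr hr']
  β_mul_e r hr hr' := by
    apply cornerVal_injective
    rw [cornerVal_mul, hZ.cornerVal_e hE hr (by omega), hZ.cornerVal_β hE hr hr',
      hZ.β_mul_e r hr hr']
  e_mul_ω r hr hr' := by
    apply cornerVal_injective
    rw [cornerVal_mul, hZ.cornerVal_e hE hr hr', hZ.cornerVal_ω hE hr hr', hZ.e_mul_ω r hr hr']
  ω_mul_e r hr hr' := by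
    apply cornerVal_injective
    rw [cornerVal_mul, hZ.cornerVal_e hE hr hr', hZ.cornerVal_ω hE hr hr', hZ.ω_mul_e r hr hr']
  diag r hr hr' h := by
    obtain ⟨a, b, hab⟩ := hZ.diag r hr hr' (cornerVal hE h)
    refine ⟨a, b, cornerVal_injective hE ?_⟩
    rw [cornerVal_mul, cornerVal_mul, hZ.cornerVal_e hE hr hr', hab, map_add, cornerVal_smul,
      cornerVal_smul, hZ.cornerVal_e hE hr hr', hZ.cornerVal_ω hE hr hr']
  up r hr hr' h := by
    obtain ⟨a, ha⟩ := hZ.up r hr hr' (cornerVal hE h)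
    refine ⟨a, cornerVal_injective hE ?_⟩
    rw [cornerVal_mul, cornerVal_mul, hZ.cornerVal_e hE hr (by omega),
      hZ.cornerVal_e hE (by omega) hr', ha, cornerVal_smul, hZ.cornerVal_α hE hr hr']
  down r hr hr' h := by
    obtain ⟨a, ha⟩ := hZ.down r hr hr' (cornerVal hE h)
    refine ⟨a, cornerVal_injective hE ?_⟩
    rw [cornerVal_mul, cornerVal_mul, hZ.cornerVal_e hE hr (by omega),
      hZ.cornerVal_e hE (by omega) hr', ha, cornerVal_smul, hZ.cornerVal_β hE hr hr']
  far r t hr hr' ht ht' hrt h := by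
    apply cornerVal_injective
    rw [cornerVal_mul, cornerVal_mul, hZ.cornerVal_e hE hr hr', hZ.cornerVal_e hE ht ht',
      hZ.far r t hr hr' ht ht' hrt, map_zero]
  ω_ne_zero r hr hr' h := by
    have := congrArg (cornerVal hE) h
    rw [hZ.cornerVal_ω hE hr hr', map_zero] at this
    exact hZ.ω_ne_zero r hr hr' this
  ω_mul_self r hr hr' := by
    apply cornerVal_injective
    rw [cornerVal_mul, hZ.cornerVal_ω hE hr hr', hZ.ω_mul_self r hr hr', map_zero]
  α_mul_β r hr hr' := by
    apply cornerVal_injective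
    rw [cornerVal_mul, hZ.cornerVal_α hE hr hr', hZ.cornerVal_β hE hr hr',
      hZ.cornerVal_ω hE hr (by omega), hZ.α_mul_β r hr hr']
  faithful r hr hr' x hx hx0 := by
    have hx' : e r * cornerVal hE x = cornerVal hE x := by
      conv_rhs => rw [← hx, cornerVal_mul, hZ.cornerVal_e hE hr hr']
    obtain ⟨h, hh⟩ := hZ.faithful r hr hr' (cornerVal hE x) hx' fun h0 =>
      hx0 (cornerVal_injective hE (h0.trans (map_zero _).symm))
    -- Truncating the witness to `E h E` changes nothing, as `x E = x` and `E e_r = e_r`.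
    refine ⟨HeckeBlock.toCorner hE h, fun h0 => hh ?_⟩
    have h1 := congrArg (cornerVal hE) h0
    rw [cornerVal_mul, cornerVal_mul, hZ.cornerVal_e hE hr hr', map_zero] at h1
    change cornerVal hE x * ((∑ t ∈ Finset.Icc 1 m, e t) * h * (∑ t ∈ Finset.Icc 1 m, e t)) *
      e r = 0 at h1
    rwa [← mul_assoc, ← mul_assoc, cornerVal_mul_right, mul_assoc _ _ (e r),
      hZ.sum_mul_e hr hr'] at h1

theorem mem_cornerRightIdeal (hZ : IsZigzag K m e α β ω)
    (hE : IsIdempotentElem (∑ t ∈ Finset.Icc 1 m, e t)) {r : ℕ} (hr : 1 ≤ r) (hr' : r ≤ m)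
    (a : CornerAlg hE) :
    a ∈ cornerRightIdeal hE (e r) ↔ HeckeBlock.toCorner hE (e r) * a = a :=
  mem_cornerRightIdeal_iff hE (hZ.e_mul_self r hr hr') (hZ.sum_mul_e hr hr') (hZ.e_mul_sum hr hr') a

theorem mem_rightIdeal (hZ : IsZigzag K m e α β ω) {r : ℕ} (hr : 1 ≤ r) (hr' : r ≤ m) (x : S) :
    x ∈ rightIdeal (e r) ↔ e r * x = x := by
  rw [rightIdeal, Submodule.mem_span_singleton]
  constructor
  · rintro ⟨a, rfl⟩
    rw [mul_smul_comm, hZ.e_mul_self r hr hr']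
  · exact fun h => ⟨MulOpposite.op x, h⟩

theorem map_socle_rightIdeal (hZ : IsZigzag K m e α β ω) {r : ℕ} (hr : 1 ≤ r) (hr' : r ≤ m) :
    (socle Sᵐᵒᵖ (rightIdeal (e r))).map (rightIdeal (e r)).subtype = rightIdeal (ω r) := by
  rw [hZ.socle_eq hr hr' (hZ.mem_rightIdeal hr hr'), Submodule.map_span, Set.image_singleton]
  rfl

theorem asSubset_cornerRad (hZ : IsZigzag K m e α β ω)
    (hE : IsIdempotentElem (∑ t ∈ Finset.Icc 1 m, e t)) {r : ℕ} (hr : 1 ≤ r) (hr' : r ≤ m) :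
    asSubset hE (cornerRad hE (e r)) = cornerVal hE '' (radSpace K (HeckeBlock.toCorner hE (e r))
      (HeckeBlock.toCorner hE (ω r)) : Set (CornerAlg hE)) := by
  rw [asSubset_eq_image, ← (hZ.toCorner hE).coe_jacobson (hZ.sum_toCorner hE) hr hr'
    (hZ.mem_cornerRightIdeal hE hr hr')]
  rfl

theorem isBasisOf_cornerRad (hZ : IsZigzag K m e α β ω)
    (hE : IsIdempotentElem (∑ t ∈ Finset.Icc 1 m, e t)) {r : ℕ} (hr : 2 ≤ r) (hr' : r + 1 ≤ m) :
    IsBasisOf K ![α r, β (r - 1), ω r] (asSubset hE (cornerRad hE (e r))) := by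
  have h := ((hZ.toCorner hE).isBasisOf_radSpace (hZ.sum_toCorner hE) hr hr').image_cornerVal
  rw [hZ.asSubset_cornerRad hE (by omega) (by omega)]
  convert h using 1
  funext i
  fin_cases i
  · exact (hZ.cornerVal_α hE (by omega) hr').symm
  · exact (hZ.cornerVal_β hE (by omega) (by omega)).symm
  · exact (hZ.cornerVal_ω hE (by omega) (by omega)).symm

theorem isBasisOf_cornerRad_first (hZ : IsZigzag K m e α β ω)
    (hE : IsIdempotentElem (∑ t ∈ Finset.Icc 1 m, e t)) (hm : 2 ≤ m) :
    IsBasisOf K ![α 1, ω 1] (asSubset hE (cornerRad hE (e 1))) := by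
  have h := ((hZ.toCorner hE).isBasisOf_radSpace_first (hZ.sum_toCorner hE) hm).image_cornerVal
  rw [hZ.asSubset_cornerRad hE (by omega) (by omega)]
  convert h using 1
  funext i
  fin_cases i
  · exact (hZ.cornerVal_α hE le_rfl hm).symm
  · exact (hZ.cornerVal_ω hE le_rfl (by omega)).symm

theorem isBasisOf_cornerRad_last (hZ : IsZigzag K m e α β ω)
    (hE : IsIdempotentElem (∑ t ∈ Finset.Icc 1 m, e t)) (hm : 2 ≤ m) :
    IsBasisOf K ![β (m - 1), ω m] (asSubset hE (cornerRad hE (e m))) := by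
  have h := ((hZ.toCorner hE).isBasisOf_radSpace_last (hZ.sum_toCorner hE) hm).image_cornerVal
  rw [hZ.asSubset_cornerRad hE (by omega) le_rfl]
  convert h using 1
  funext i
  fin_cases i
  · exact (hZ.cornerVal_β hE (by omega) (by omega)).symm
  · exact (hZ.cornerVal_ω hE (by omega) le_rfl).symm

theorem exists_equiv_cornerTop (hZ : IsZigzag K m e α β ω)
    (hE : IsIdempotentElem (∑ t ∈ Finset.Icc 1 m, e t)) (M : Type*) [AddCommGroup M]
    [Module (CornerAlg hE)ᵐᵒᵖ M] [IsSimpleModule (CornerAlg hE)ᵐᵒᵖ M] :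
    ∃ r ∈ Finset.Icc 1 m, Nonempty (M ≃ₗ[(CornerAlg hE)ᵐᵒᵖ] (CornerTop hE (e r))) :=
  (hZ.toCorner hE).exists_equiv_top (hZ.sum_toCorner hE)
    (fun _ hr hr' => hZ.mem_cornerRightIdeal hE hr hr') M

theorem asSubset_socle (hZ : IsZigzag K m e α β ω)
    (hE : IsIdempotentElem (∑ t ∈ Finset.Icc 1 m, e t)) {r : ℕ} (hr : 1 ≤ r) (hr' : r ≤ m) :
    asSubset hE (socle (CornerAlg hE)ᵐᵒᵖ (cornerRightIdeal hE (e r))) =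
      (Submodule.span K {ω r} : Set S) := by
  rw [asSubset_eq_image, (hZ.toCorner hE).coe_socle (hZ.sum_toCorner hE) hr hr'
    (hZ.mem_cornerRightIdeal hE hr hr'), image_cornerVal_span, Set.image_singleton,
    hZ.cornerVal_ω hE hr hr']

theorem image_socle_corner (hZ : IsZigzag K m e α β ω)
    (hE : IsIdempotentElem (∑ t ∈ Finset.Icc 1 m, e t)) :
    cornerVal hE '' (socle (CornerAlg hE)ᵐᵒᵖ (CornerAlg hE) : Set (CornerAlg hE)) =
      (Submodule.span K (ω '' (Finset.Icc 1 m : Set ℕ)) : Set S) := by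
  rw [(hZ.toCorner hE).coe_socle_self (hZ.sum_toCorner hE), image_cornerVal_span, Set.image_image,
    Set.image_congr fun t ht => ?_]
  have ht' := Finset.mem_Icc.mp (Finset.mem_coe.mp ht)
  exact hZ.cornerVal_ω hE ht'.1 ht'.2

end IsZigzag

/-! ### The Hecke algebra -/

section Hecke

variable {K : Type*} [Field K] {q : K} {ℓ : ℕ}

theorem socElt_of_le {r : ℕ} (hr : r ≤ ℓ - 2) : socElt q ℓ r = alpha q ℓ r * beta q ℓ r :=
  if_pos hr

theorem socElt_last (hℓ : 3 ≤ ℓ) :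
    socElt q ℓ (ℓ - 1) = beta q ℓ (ℓ - 2) * alpha q ℓ (ℓ - 2) :=
  if_neg (by omega)

/-- Everything specific to the Hecke algebra that the radicals, socles and simple modules require is
contained in this instance of the axioms, with `ℓ - 1` vertices. -/
theorem isZigzag_hecke (hℓ : 3 ≤ ℓ) (hq : IsPrimitiveRoot q ℓ) :
    IsZigzag K (ℓ - 1) (eps q ℓ) (alpha q ℓ) (beta q ℓ) (socElt q ℓ) where
  e_mul_self _ hr hr' := eps_mul_self hℓ hq hr hr'
  e_mul_e _ _ hr hr' ht ht' h := eps_mul_eps_of_ne hℓ hq hr hr' ht ht' h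
  e_mul_α _ hr _ := eps_mul_alpha hℓ hq hr (by omega)
  α_mul_e _ _ _ := alpha_mul_eps hℓ hq (by omega)
  e_mul_β _ _ _ := eps_mul_beta hℓ hq (by omega)
  β_mul_e _ hr _ := beta_mul_eps hℓ hq hr (by omega)
  e_mul_ω _ hr hr' := eps_mul_socElt hℓ hq hr hr'
  ω_mul_e _ hr hr' := socElt_mul_eps hℓ hq hr hr'
  diag _ hr hr' h := by
    obtain ⟨a, b, hab⟩ := Submodule.mem_span_pair.mp (mem_span_eps_socElt hℓ hq hr hr' h)
    exact ⟨a, b, hab.symm⟩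
  up _ hr hr' h := by
    obtain ⟨a, ha⟩ := Submodule.mem_span_singleton.mp (mem_span_alpha hℓ hq hr (by omega) h)
    exact ⟨a, ha.symm⟩
  down _ hr hr' h := by
    obtain ⟨a, ha⟩ := Submodule.mem_span_singleton.mp (mem_span_beta hℓ hq hr (by omega) h)
    exact ⟨a, ha.symm⟩
  far _ _ _ hr' _ ht' hrt h := eps_mul_mul_eps_eq_zero hℓ hq (by omega) (by omega) hrt h
  ω_ne_zero _ hr hr' := socElt_ne_zero hℓ hq hr hr'
  ω_mul_self _ hr hr' := socElt_mul_self hℓ hq hr hr'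
  α_mul_β _ _ _ := (socElt_of_le (by omega)).symm
  faithful _ hr hr' _ hx hx0 := exists_mul_mul_eps_ne_zero hℓ hq hr hr' hx hx0

theorem socElt_image (hℓ : 3 ≤ ℓ) :
    socElt q ℓ '' (Finset.Icc 1 (ℓ - 1) : Set ℕ) =
      (fun r => alpha q ℓ r * beta q ℓ r) '' (Finset.Icc 1 (ℓ - 2) : Set ℕ) ∪
        {beta q ℓ (ℓ - 2) * alpha q ℓ (ℓ - 2)} := by
  have h : (Finset.Icc 1 (ℓ - 1) : Set ℕ) = (Finset.Icc 1 (ℓ - 2) : Set ℕ) ∪ {ℓ - 1} := by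
    ext t
    simp only [Finset.coe_Icc, Set.mem_Icc, Set.mem_union, Set.mem_singleton_iff]
    omega
  rw [h, Set.image_union, Set.image_singleton, socElt_last hℓ]
  congr 1
  refine Set.image_congr fun t ht => socElt_of_le ?_
  exact (Finset.mem_Icc.mp (Finset.mem_coe.mp ht)).2

end Hecke

end HeckeBlock

end

open HeckeBlock

theorem corollary3p15 {K : Type*} [Field K] {q : K} {ℓ : ℕ} (hℓ : 3 ≤ ℓ)
    (hq : IsPrimitiveRoot q ℓ) :
    -- the objects are well defined: orthogonal idempotents, and unique representatives `d`
    (∀ r ∈ Finset.Icc 1 (ℓ - 1), ∀ s ∈ Finset.Icc 1 (ℓ - 1),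
      eps q ℓ r * eps q ℓ s = if r = s then eps q ℓ r else 0) ∧
    (∀ r ∈ Finset.Icc 1 (ℓ - 2), ∃! d, IsArrowRep q ℓ r d) ∧
    -- the right `H`-modules `ε_r H`
    (∀ r ∈ Finset.Icc 1 (ℓ - 1),
      Module.Projective (Hecke q ℓ)ᵐᵒᵖ
        (rightIdeal (eps q ℓ r)) ∧
      IsIndecomposable (Hecke q ℓ)ᵐᵒᵖ
        (rightIdeal (eps q ℓ r)) ∧
      IsSimpleModule (Hecke q ℓ)ᵐᵒᵖ
        (socle (Hecke q ℓ)ᵐᵒᵖ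
          (rightIdeal (eps q ℓ r))) ∧
      (socle (Hecke q ℓ)ᵐᵒᵖ
          (rightIdeal (eps q ℓ r))).map
          (rightIdeal (eps q ℓ r)).subtype =
        rightIdeal (socElt q ℓ r)) ∧
    -- the algebra `ε H ε` and its right modules `ε_r H ε`
    ∃ hε : IsIdempotentElem (epsSum q ℓ),
      (∀ r ∈ Finset.Icc 1 (ℓ - 1),
        Module.Projective (CornerAlg hε)ᵐᵒᵖ
          (cornerRightIdeal hε (eps q ℓ r)) ∧
        IsIndecomposable (CornerAlg hε)ᵐᵒᵖ
          (cornerRightIdeal hε (eps q ℓ r))) ∧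
      -- radicals
      (∀ r ∈ Finset.Icc 2 (ℓ - 2),
        IsBasisOf K
          ![alpha q ℓ r, beta q ℓ (r - 1),
            alpha q ℓ r * beta q ℓ r]
          (asSubset hε (cornerRad hε (eps q ℓ r)))) ∧
      IsBasisOf K
        ![alpha q ℓ 1, alpha q ℓ 1 * beta q ℓ 1]
        (asSubset hε (cornerRad hε (eps q ℓ 1))) ∧
      IsBasisOf K
        ![beta q ℓ (ℓ - 2),
          beta q ℓ (ℓ - 2) * alpha q ℓ (ℓ - 2)]
        (asSubset hε (cornerRad hε (eps q ℓ (ℓ - 1)))) ∧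
      -- socles
      (∀ r ∈ Finset.Icc 1 (ℓ - 1),
        IsSimpleModule (CornerAlg hε)ᵐᵒᵖ
          (socle (CornerAlg hε)ᵐᵒᵖ
            (cornerRightIdeal hε (eps q ℓ r))) ∧
        asSubset hε
            (socle (CornerAlg hε)ᵐᵒᵖ
              (cornerRightIdeal hε (eps q ℓ r))) =
          (Submodule.span K {socElt q ℓ r} : Set (Hecke q ℓ))) ∧
      -- simple modules
      (∀ r ∈ Finset.Icc 1 (ℓ - 1),
        IsSimpleModule (CornerAlg hε)ᵐᵒᵖ
          (CornerTop hε (eps q ℓ r)) ∧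
        Module.finrank K
          (CornerTop hε (eps q ℓ r)) = 1) ∧
      (∀ r ∈ Finset.Icc 1 (ℓ - 1), ∀ s ∈ Finset.Icc 1 (ℓ - 1),
        Nonempty
          ((CornerTop hε (eps q ℓ r)) ≃ₗ[(CornerAlg hε)ᵐᵒᵖ]
            (CornerTop hε (eps q ℓ s))) → r = s) ∧
      (∀ (M : Type*) [AddCommGroup M] [Module (CornerAlg hε)ᵐᵒᵖ M] [IsSimpleModule (CornerAlg hε)ᵐᵒᵖ M],
        ∃ r ∈ Finset.Icc 1 (ℓ - 1),
          Nonempty (M ≃ₗ[(CornerAlg hε)ᵐᵒᵖ]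
            (CornerTop hε (eps q ℓ r)))) ∧
      -- the socle of `ε H ε`
      cornerVal hε '' (socle (CornerAlg hε)ᵐᵒᵖ (CornerAlg hε) : Set (CornerAlg hε)) =
        (Submodule.span K
          ((fun r => alpha q ℓ r * beta q ℓ r) ''
              (Finset.Icc 1 (ℓ - 2) : Set ℕ) ∪
            {beta q ℓ (ℓ - 2) * alpha q ℓ (ℓ - 2)}) :
          Set (Hecke q ℓ)) := by
  have hZ := isZigzag_hecke hℓ hq
  refine ⟨?_, ?_, ?_, hZ.isIdempotentElem_sum, ?_, ?_, ?_, ?_, ?_, ?_, ?_, ?_, ?_⟩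
  · intro r hr s hs
    rw [Finset.mem_Icc] at hr hs
    split_ifs with h
    · rw [← h, eps_mul_self hℓ hq hr.1 hr.2]
    · exact eps_mul_eps_of_ne hℓ hq hr.1 hr.2 hs.1 hs.2 h
  · intro r hr
    rw [Finset.mem_Icc] at hr
    exact existsUnique_isArrowRep hℓ hq hr.1 hr.2
  · intro r hr
    rw [Finset.mem_Icc] at hr
    have hP := hZ.mem_rightIdeal hr.1 hr.2
    exact ⟨hZ.projective hr.1 hr.2 hP, hZ.isIndecomposable hr.1 hr.2 hP,
      hZ.isSimpleModule_socle hr.1 hr.2 hP, hZ.map_socle_rightIdeal hr.1 hr.2⟩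
  · intro r hr
    rw [Finset.mem_Icc] at hr
    have hP := hZ.mem_cornerRightIdeal hZ.isIdempotentElem_sum hr.1 hr.2
    exact ⟨(hZ.toCorner _).projective hr.1 hr.2 hP, (hZ.toCorner _).isIndecomposable hr.1 hr.2 hP⟩
  · intro r hr
    rw [Finset.mem_Icc] at hr
    rw [← socElt_of_le hr.2]
    exact hZ.isBasisOf_cornerRad _ hr.1 (by omega)
  · rw [← socElt_of_le (by omega)]
    exact hZ.isBasisOf_cornerRad_first _ (by omega)
  · rw [← socElt_last hℓ]
    exact hZ.isBasisOf_cornerRad_last _ (by omega)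
  · intro r hr
    rw [Finset.mem_Icc] at hr
    exact ⟨(hZ.toCorner _).isSimpleModule_socle hr.1 hr.2 (hZ.mem_cornerRightIdeal _ hr.1 hr.2),
      hZ.asSubset_socle _ hr.1 hr.2⟩
  · intro r hr
    rw [Finset.mem_Icc] at hr
    have hP := hZ.mem_cornerRightIdeal hZ.isIdempotentElem_sum hr.1 hr.2
    exact ⟨(hZ.toCorner _).isSimpleModule_top (hZ.sum_toCorner _) hr.1 hr.2 hP,
      (hZ.toCorner _).finrank_top (hZ.sum_toCorner _) hr.1 hr.2 hP⟩
  · rintro r hr s hs ⟨f⟩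
    rw [Finset.mem_Icc] at hr hs
    exact (hZ.toCorner _).eq_of_top_equiv (hZ.sum_toCorner _) hr.1 hr.2
      (hZ.mem_cornerRightIdeal _ hr.1 hr.2) hs.1 hs.2 (hZ.mem_cornerRightIdeal _ hs.1 hs.2) f
  · exact hZ.exists_equiv_cornerTop hZ.isIdempotentElem_sum
  · rw [← socElt_image hℓ]
    exact hZ.image_socle_corner _
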